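/- Let $\Gamma$ be a finite quiver with vertex set $I$ (finitely many vertices and arrows) and let $\theta\colon I\to\mathbb Z$ be a stability. For $0\ne\alpha\in\mathbb N^I$ let $\mu(\alpha)=\sum_i\theta_i\alpha^i/\sum_i\alpha^i$, and put $\mu(M)=\mu(\dim M)$ for a nonzero finite-dimensional representation $M$ of $\Gamma$ over a field. A nonzero $M$ is stable (semistable) if $\mu(N)<\mu(M)$ (resp. $\mu(N)\le\mu(M)$) for every nonzero proper subrepresentation $N\subset M$; it is absolutely stable if it is stable and stays stable after every finite extension of the base field. For a finite field $k$, the Hall algebra of $\Gamma$ over $k$ has as $\mathbb Q$-basis the isomorphism classes $[M]$ of finite-dimensional representations of $\Gamma$ over $k$, with product $[M]\cdot[N]=\sum_{[X]}g^X_{M,N}[X]$, where $g^X_{M,N}$ is the number of subrepresentations $U\subset X$ with $U\simeq N$ and $X/U\simeq M$. It is graded by $\sum_i\dim M_i$; in its completion, for $\mu\in\mathbb Q$, let $e_{\mu,k}=\sum_{[M]}[M]$, the sum over the semistable $M$ of slope $\mu$ together with $M=0$. Let $\int$ be the continuous $\mathbb Q$-linear map from the completion to power series with rational coefficients in $x_i$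 $(i\in I)$ given by $\int[M]=\frac{1}{\#\mathrm{Aut}\,M}x^{\dim M}$. For $f\in\mathbb Q(q)[[x_i\mid i\in I]]$ without constant term put $\mathrm{Exp}(f)=\exp\big(\sum_{n\ge1}\frac1n\psi_n(f)\big)$, where $\psi_n$ replaces $q$ by $q^n$ and each $x_i$ by $x_i^n$. Then there are polynomials $a_\alpha\in\mathbb Z[q]$ $(\alpha\in\mathbb N^I)$ such that, for every finite field $F$ and every $\alpha$, the number of isomorphism classes of absolutely stable representations of $\Gamma$ over $F$ of dimension vector $\alpha$ is $a_\alpha(\#F)$; and for every $\mu\in\mathbb Q$, with $$a(q)=\sum_{\alpha\ne0,\ \mu(\alpha)=\mu}a_\alpha(q)\,x^\alpha,$$ and every finite field $k$, the element $e_{\mu,k}$ is invertible in the completed Hall algebra, the coefficients of $\mathrm{Exp}\big(\frac{a(q)}{1-q}\big)$ have no pole at $q=\#k$, and $$\int e_{\mu,k}^{-1}=\mathrm{Exp}\Big(\frac{a(q)}{1-q}\Big)\Big|_{q=\#k}.$$ -/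

import Mathlib

open scoped TensorProduct

universe u v w

noncomputable section

/-- A finite-dimensional representation over the field `k` of the quiver with vertex set `I`. -/
structure QuiverRep (k : Type u) [Field k] (I : Type w) [Quiver.{v} I] where
  V : I → Type u
  [addCommGroup : ∀ i, AddCommGroup (V i)]
  [module : ∀ i, Module k (V i)]
  [finiteDimensional : ∀ i, FiniteDimensional k (V i)]
  map : ∀ {i j : I}, (i ⟶ j) → V i →ₗ[k] V j

namespace QuiverRep

attribute [instance] addCommGroup module finiteDimensional

variable {k : Type u} [Field k] {I : Type w} [Quiver.{v} I]

/-- The zero representation is the one all of whose spaces vanish. -/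
def IsZero (M : QuiverRep k I) : Prop := ∀ i, Subsingleton (M.V i)

/-- The dimension vector. -/
def dim [Finite I] (M : QuiverRep k I) : I →₀ ℕ :=
  Finsupp.equivFunOnFinite.symm fun i => Module.finrank k (M.V i)

/-- Isomorphisms of representations. -/
@[ext]
structure Iso (M N : QuiverRep k I) where
  equiv : ∀ i, M.V i ≃ₗ[k] N.V i
  comm : ∀ {i j : I} (h : i ⟶ j) (x : M.V i), equiv j (M.map h x) = N.map h (equiv i x)

namespace Iso

def refl (M : QuiverRep k I) : Iso M M := ⟨fun _ => LinearEquiv.refl k _, fun _ _ => rfl⟩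

def symm {M N : QuiverRep k I} (e : Iso M N) : Iso N M :=
  ⟨fun i => (e.equiv i).symm, fun {i j} h x => by
    rw [LinearEquiv.symm_apply_eq, e.comm, LinearEquiv.apply_symm_apply]⟩

def trans {M N P : QuiverRep k I} (e : Iso M N) (f : Iso N P) : Iso M P :=
  ⟨fun i => (e.equiv i).trans (f.equiv i), fun {i j} h x => by
    simp only [LinearEquiv.trans_apply, e.comm, f.comm]⟩

end Iso

instance isoSetoid (k : Type u) [Field k] (I : Type w) [Quiver.{v} I] :
    Setoid (QuiverRep k I) where
  r M N := Nonempty (Iso M N)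
  iseqv := ⟨fun M => ⟨Iso.refl M⟩, fun ⟨e⟩ => ⟨e.symm⟩, fun ⟨e⟩ ⟨f⟩ => ⟨e.trans f⟩⟩

/-- Subrepresentations. -/
@[ext]
structure Sub (M : QuiverRep k I) where
  space : ∀ i, Submodule k (M.V i)
  map_mem : ∀ {i j : I} (h : i ⟶ j) {x : M.V i}, x ∈ space i → M.map h x ∈ space j

namespace Sub

variable {M : QuiverRep k I}

/-- A subrepresentation as a representation. -/
def toRep (U : Sub M) : QuiverRep k I where
  V i := U.space i
  map h := (M.map h).restrict fun _ hx => U.map_mem h hx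

/-- The quotient of a representation by a subrepresentation. -/
def quotient (U : Sub M) : QuiverRep k I where
  V i := M.V i ⧸ U.space i
  map {i j} h := (U.space i).mapQ (U.space j) (M.map h) fun _ hx => U.map_mem h hx

def IsNonzero (U : Sub M) : Prop := ∃ i, U.space i ≠ ⊥

def IsProper (U : Sub M) : Prop := ∃ i, U.space i ≠ ⊤

def mkQ (U : Sub M) (i : I) : M.V i →ₗ[k] U.quotient.V i := (U.space i).mkQ

def subtype (U : Sub M) (i : I) : U.toRep.V i →ₗ[k] M.V i := (U.space i).subtype

theorem mkQ_surjective (U : Sub M) (i : I) : Function.Surjective (U.mkQ i) :=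
  Submodule.mkQ_surjective _

theorem subtype_injective (U : Sub M) (i : I) : Function.Injective (U.subtype i) :=
  Subtype.val_injective

theorem mkQ_eq_zero (U : Sub M) (i : I) (x : M.V i) : U.mkQ i x = 0 ↔ x ∈ U.space i :=
  Submodule.Quotient.mk_eq_zero _

theorem exists_subtype_eq (U : Sub M) (i : I) (x : M.V i) :
    (∃ y, U.subtype i y = x) ↔ x ∈ U.space i :=
  ⟨fun ⟨y, hy⟩ => hy ▸ y.2, fun h => ⟨⟨x, h⟩, rfl⟩⟩

theorem mkQ_map (U : Sub M) {i j : I} (h : i ⟶ j) (x : M.V i) :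
    U.mkQ j (M.map h x) = U.quotient.map h (U.mkQ i x) := rfl

theorem subtype_map (U : Sub M) {i j : I} (h : i ⟶ j) (x : U.toRep.V i) :
    U.subtype j (U.toRep.map h x) = M.map h (U.subtype i x) := rfl

end Sub

/-- Extension of scalars along a field extension. -/
def baseChange (M : QuiverRep k I) (L : Type u) [Field L] [Algebra k L] : QuiverRep L I where
  V i := L ⊗[k] M.V i
  map h := (M.map h).baseChange L

end QuiverRep

/-- The dimSlope `θ(α) / ∑ αᵢ` of a nonzero dimension vector `α`. -/
def dimSlope {I : Type w} [Fintype I] (θ : I → ℤ) (α : I →₀ ℕ) : ℚ :=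
  ((∑ i, θ i * (α i : ℤ) : ℤ) : ℚ) / ((∑ i, α i : ℕ) : ℚ)

namespace QuiverRep

section Stability

variable {k : Type u} [Field k] {I : Type w} [Quiver.{v} I] [Fintype I]

/-- Stability of a representation; the zero representation is not stable. -/
def IsStable (θ : I → ℤ) (M : QuiverRep k I) : Prop :=
  ¬ M.IsZero ∧ ∀ N : Sub M, N.IsNonzero → N.IsProper → dimSlope θ N.toRep.dim < dimSlope θ M.dim

/-- Semistability of a nonzero representation. -/
def IsSemistable (θ : I → ℤ) (M : QuiverRep k I) : Prop :=
  ¬ M.IsZero ∧ ∀ N : Sub M, N.IsNonzero → N.IsProper → dimSlope θ N.toRep.dim ≤ dimSlope θ M.dim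

/-- A stable representation is absolutely stable if it stays stable after any finite extension
of the base field. -/
def IsAbsolutelyStable (θ : I → ℤ) (M : QuiverRep k I) : Prop :=
  M.IsStable θ ∧ ∀ (L : Type u) [Field L] [Algebra k L] [FiniteDimensional k L],
    (M.baseChange L).IsStable θ

/-- The objects of the category of semistable representations of dimSlope `μ`, which by convention
contains the zero representation. -/
def IsSemistableOfSlope (θ : I → ℤ) (μ : ℚ) (M : QuiverRep k I) : Prop :=
  M.IsZero ∨ (M.IsSemistable θ ∧ dimSlope θ M.dim = μ)

end Stability

section Invariance

variable {k : Type u} [Field k] {I : Type w} [Quiver.{v} I]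

theorem class_quotient_eq {X Y : QuiverRep k I} (f : ∀ i, X.V i →ₗ[k] Y.V i)
    (comm : ∀ {i j : I} (h : i ⟶ j) (x : X.V i), f j (X.map h x) = Y.map h (f i x))
    (surj : ∀ i, Function.Surjective (f i)) (U : Sub X)
    (hU : ∀ i x, f i x = 0 ↔ x ∈ U.space i) : Nonempty (Iso U.quotient Y) :=
  ⟨{ equiv := fun i => (Submodule.quotEquivOfEq (U.space i) (LinearMap.ker (f i))
        (by ext x; exact (hU i x).symm)).trans ((f i).quotKerEquivOfSurjective (surj i))
     comm := by
        intro i j h x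
        obtain ⟨x, rfl⟩ := Submodule.mkQ_surjective _ x
        exact comm h x }⟩

theorem class_sub_eq {X Y : QuiverRep k I} (f : ∀ i, Y.V i →ₗ[k] X.V i)
    (comm : ∀ {i j : I} (h : i ⟶ j) (y : Y.V i), f j (Y.map h y) = X.map h (f i y))
    (inj : ∀ i, Function.Injective (f i)) (U : Sub X)
    (hU : ∀ i x, (∃ y, f i y = x) ↔ x ∈ U.space i) : Nonempty (Iso Y U.toRep) :=
  ⟨{ equiv := fun i => (LinearEquiv.ofInjective (f i) (inj i)).trans
        (LinearEquiv.ofEq _ _ (by ext x; exact hU i x))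
     comm := by
        intro i j h y
        apply Subtype.ext
        exact comm h y }⟩

instance finite_V [Finite k] (M : QuiverRep k I) (i : I) : Finite (M.V i) :=
  Module.finite_of_finite k

instance finite_sub [Finite k] [Finite I] (M : QuiverRep k I) : Finite (Sub M) :=
  Finite.of_injective (fun U : Sub M => U.space) fun _ _ h => Sub.ext h

instance fintypeSub [Finite k] [Finite I] (M : QuiverRep k I) : Fintype (Sub M) :=
  Fintype.ofFinite _

/-- Transport of subrepresentations along an isomorphism. -/
def Sub.mapIso {X Y : QuiverRep k I} (e : Iso X Y) (U : Sub X) : Sub Y where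
  space i := (U.space i).map (e.equiv i : X.V i →ₗ[k] Y.V i)
  map_mem := by
    rintro i j h _ ⟨x, hx, rfl⟩
    exact ⟨X.map h x, U.map_mem h hx, e.comm h x⟩

theorem Sub.mapIso_bijective {X Y : QuiverRep k I} (e : Iso X Y) :
    Function.Bijective (Sub.mapIso e) := by
  refine Function.bijective_iff_has_inverse.2 ⟨Sub.mapIso e.symm, fun U => ?_, fun U => ?_⟩
  · ext i x
    simp [Sub.mapIso, Iso.symm]
  · ext i x
    simp [Sub.mapIso, Iso.symm]

theorem Sub.mapIso_quotient {X Y : QuiverRep k I} (e : Iso X Y) (U : Sub X) :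
    Nonempty (Iso U.quotient (Sub.mapIso e U).quotient) := by
  refine class_quotient_eq
    (fun i => (Sub.mapIso e U).mkQ i ∘ₗ (e.equiv i : X.V i →ₗ[k] Y.V i)) ?_ ?_ U ?_
  · intro i j h x
    simp only [LinearMap.comp_apply, LinearEquiv.coe_coe, e.comm, Sub.mkQ_map]
  · intro i
    exact (Sub.mkQ_surjective _ i).comp (e.equiv i).surjective
  · intro i x
    rw [LinearMap.comp_apply, Sub.mkQ_eq_zero]
    simp [Sub.mapIso]

theorem Sub.mapIso_toRep {X Y : QuiverRep k I} (e : Iso X Y) (U : Sub X) :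
    Nonempty (Iso U.toRep (Sub.mapIso e U).toRep) := by
  refine class_sub_eq
    (fun i => (e.equiv i : X.V i →ₗ[k] Y.V i) ∘ₗ U.subtype i) ?_ ?_ (Sub.mapIso e U) ?_
  · intro i j h x
    simp only [LinearMap.comp_apply, LinearEquiv.coe_coe, e.comm, Sub.subtype_map]
  · intro i
    exact (e.equiv i).injective.comp (Sub.subtype_injective U i)
  · intro i x
    exact ⟨fun ⟨y, hy⟩ => ⟨y.1, y.2, hy⟩, fun ⟨y, hy, h⟩ => ⟨⟨y, hy⟩, h⟩⟩

/-- Preimage of a subrepresentation of a quotient. -/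
def Sub.pull {X : QuiverRep k I} (U : Sub X) (W : Sub U.quotient) : Sub X where
  space i := (W.space i).comap (U.mkQ i)
  map_mem h _ hx := W.map_mem h hx

/-- Image of a subrepresentation in a quotient. -/
def Sub.push {X : QuiverRep k I} (U : Sub X) (W : Sub X) : Sub U.quotient where
  space i := (W.space i).map (U.mkQ i)
  map_mem := by
    rintro i j h _ ⟨x, hx, rfl⟩
    exact ⟨X.map h x, W.map_mem h hx, U.mkQ_map h x⟩

/-- The intersection of `U` with `W`, inside `W`. -/
def Sub.restr {X : QuiverRep k I} (W : Sub X) (U : Sub X) : Sub W.toRep where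
  space i := (U.space i).comap (W.subtype i)
  map_mem h _ hx := U.map_mem h hx

/-- A subrepresentation of `W`, inside `X`. -/
def Sub.incl {X : QuiverRep k I} (W : Sub X) (T : Sub W.toRep) : Sub X where
  space i := (T.space i).map (W.subtype i)
  map_mem := by
    rintro i j h _ ⟨x, hx, rfl⟩
    exact ⟨W.toRep.map h x, T.map_mem h hx, W.subtype_map h x⟩

theorem Sub.le_pull {X : QuiverRep k I} (U : Sub X) (W : Sub U.quotient) (i : I) :
    U.space i ≤ (U.pull W).space i := fun x hx => by
  show U.mkQ i x ∈ W.space i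
  exact (U.mkQ_eq_zero i x).2 hx ▸ zero_mem (W.space i)

theorem Sub.push_pull {X : QuiverRep k I} (U : Sub X) (W : Sub U.quotient) :
    U.push (U.pull W) = W := by
  refine Sub.ext (funext fun i => ?_)
  exact Submodule.map_comap_eq_of_surjective (U.mkQ_surjective i) _

theorem Sub.pull_push {X : QuiverRep k I} (U W : Sub X) (h : ∀ i, U.space i ≤ W.space i) :
    U.pull (U.push W) = W := by
  refine Sub.ext (funext fun i => ?_)
  refine (Submodule.comap_map_eq _ _).trans (sup_eq_left.2 fun x hx => h i ?_)
  exact (U.mkQ_eq_zero i x).1 hx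

theorem Sub.incl_le {X : QuiverRep k I} (W : Sub X) (T : Sub W.toRep) (i : I) :
    (W.incl T).space i ≤ W.space i := by
  rintro _ ⟨y, -, rfl⟩
  exact y.2

theorem Sub.restr_incl {X : QuiverRep k I} (W : Sub X) (T : Sub W.toRep) :
    W.restr (W.incl T) = T := by
  refine Sub.ext (funext fun i => ?_)
  exact Submodule.comap_map_eq_of_injective (W.subtype_injective i) _

theorem Sub.incl_restr {X : QuiverRep k I} (W U : Sub X) (h : ∀ i, U.space i ≤ W.space i) :
    W.incl (W.restr U) = U := by
  refine Sub.ext (funext fun i => ?_)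
  ext x
  exact ⟨fun ⟨y, hy, hx⟩ => hx ▸ hy, fun hx => ⟨⟨x, h i hx⟩, hx, rfl⟩⟩

theorem Sub.pull_quotient {X : QuiverRep k I} (U : Sub X) (W : Sub U.quotient) :
    Nonempty (Iso (U.pull W).quotient W.quotient) := by
  refine class_quotient_eq (fun i => W.mkQ i ∘ₗ U.mkQ i) ?_ ?_ _ ?_
  · intro i j h x
    simp only [LinearMap.comp_apply, Sub.mkQ_map]
  · intro i
    exact (W.mkQ_surjective i).comp (U.mkQ_surjective i)
  · intro i x
    rw [LinearMap.comp_apply, Sub.mkQ_eq_zero]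
    rfl

theorem Sub.pull_restr {X : QuiverRep k I} (U : Sub X) (W : Sub U.quotient) :
    Nonempty (Iso ((U.pull W).restr U).quotient W.toRep) := by
  refine class_quotient_eq
    (fun i => (U.mkQ i ∘ₗ (U.pull W).subtype i).codRestrict (W.space i) fun y => y.2) ?_ ?_ _ ?_
  · intro i j h x
    rfl
  · rintro i ⟨y, hy⟩
    obtain ⟨x, rfl⟩ := U.mkQ_surjective i y
    exact ⟨⟨x, hy⟩, rfl⟩
  · intro i x
    exact Subtype.ext_iff.trans (U.mkQ_eq_zero i _)

theorem Sub.incl_toRep {X : QuiverRep k I} (W : Sub X) (T : Sub W.toRep) :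
    Nonempty (Iso T.toRep (W.incl T).toRep) := by
  refine class_sub_eq (fun i => W.subtype i ∘ₗ T.subtype i) ?_ ?_ _ ?_
  · intro i j h x
    rfl
  · intro i
    exact (W.subtype_injective i).comp (T.subtype_injective i)
  · intro i x
    exact ⟨fun ⟨y, hy⟩ => ⟨y.1, y.2, hy⟩, fun ⟨y, hy, h⟩ => ⟨⟨y, hy⟩, h⟩⟩

/-- The zero subrepresentation. -/
def Sub.zero (X : QuiverRep k I) : Sub X where
  space _ := ⊥
  map_mem := by
    intro i j h x hx
    simp [(Submodule.mem_bot k).1 hx]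

/-- The whole representation as a subrepresentation of itself. -/
def Sub.whole (X : QuiverRep k I) : Sub X where
  space _ := ⊤
  map_mem _ _ _ := Submodule.mem_top

theorem Sub.zero_quotient (X : QuiverRep k I) : Nonempty (Iso (Sub.zero X).quotient X) :=
  class_quotient_eq (fun _ => LinearMap.id) (fun _ _ => rfl) (fun _ => Function.surjective_id) _
    fun _ _ => (Submodule.mem_bot k).symm

theorem Sub.whole_toRep (X : QuiverRep k I) : Nonempty (Iso X (Sub.whole X).toRep) :=
  class_sub_eq (fun _ => LinearMap.id) (fun _ _ => rfl) (fun _ => Function.injective_id) _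
    fun _ x => ⟨fun _ => Submodule.mem_top, fun _ => ⟨x, rfl⟩⟩

theorem Sub.toRep_isZero_iff {X : QuiverRep k I} (U : Sub X) :
    U.toRep.IsZero ↔ U = Sub.zero X := by
  constructor
  · intro h
    refine Sub.ext (funext fun i => ?_)
    have : Subsingleton (U.space i) := h i
    exact (Submodule.subsingleton_iff_eq_bot).1 this
  · rintro rfl i
    exact (Submodule.subsingleton_iff_eq_bot).2 rfl

theorem Sub.quotient_isZero_iff {X : QuiverRep k I} (U : Sub X) :
    U.quotient.IsZero ↔ U = Sub.whole X := by
  constructor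
  · intro h
    refine Sub.ext (funext fun i => ?_)
    have : Subsingleton (X.V i ⧸ U.space i) := h i
    exact (Submodule.Quotient.subsingleton_iff).1 this
  · rintro rfl i
    exact (Submodule.Quotient.subsingleton_iff).2 rfl

theorem IsZero.of_iso {X Y : QuiverRep k I} (h : X.IsZero) (e : Iso X Y) : Y.IsZero := fun i =>
  have := h i
  (e.equiv i).symm.toEquiv.subsingleton

end Invariance

end QuiverRep

/-- Isomorphism classes of representations. -/
def IsoClass (k : Type u) [Field k] (I : Type w) [Quiver.{v} I] :=
  Quotient (QuiverRep.isoSetoid k I)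

namespace IsoClass

open QuiverRep

variable {k : Type u} [Field k] {I : Type w} [Quiver.{v} I]

def mk (M : QuiverRep k I) : IsoClass k I := Quotient.mk _ M

theorem mk_eq {M N : QuiverRep k I} : mk M = mk N ↔ Nonempty (Iso M N) := Quotient.eq

def dim [Finite I] (c : IsoClass k I) : I →₀ ℕ :=
  Quotient.lift (s := isoSetoid k I) QuiverRep.dim (by
    rintro M N ⟨e⟩
    ext i
    exact (e.equiv i).finrank_eq) c

/-- The order of the automorphism group. -/
def cardAut (c : IsoClass k I) : ℕ :=
  Quotient.lift (s := isoSetoid k I) (fun M : QuiverRep k I => Nat.card (Iso M M)) (by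
    rintro M N ⟨e⟩
    exact Nat.card_congr
      { toFun := fun f => (e.symm.trans f).trans e
        invFun := fun f => (e.trans f).trans e.symm
        left_inv := fun f => by ext i x; simp [Iso.trans, Iso.symm]
        right_inv := fun f => by ext i x; simp [Iso.trans, Iso.symm] }) c

/-- Over a finite field there are only finitely many classes of a given dimension vector. -/
theorem finite_dim_eq [Finite k] [Finite I] [∀ i j : I, Finite (i ⟶ j)] (α : I →₀ ℕ) :
    {c : IsoClass k I | c.dim = α}.Finite := by
  let R := ∀ p : Σ i j : I, (i ⟶ j), (Fin (α p.1) → k) →ₗ[k] (Fin (α p.2.1) → k)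
  have : ∀ a b : ℕ, Finite ((Fin a → k) →ₗ[k] (Fin b → k)) := fun a b =>
    Module.finite_of_finite k
  have : Finite R := inferInstance
  let F : R → IsoClass k I := fun x => mk
    { V := fun i => Fin (α i) → k
      map := fun {i j} h => x ⟨i, j, h⟩ }
  refine (Set.finite_range F).subset ?_
  rintro ⟨M⟩ hM
  have hd : ∀ i, Module.finrank k (M.V i) = α i := fun i => DFunLike.congr_fun hM i
  let e : ∀ i, M.V i ≃ₗ[k] (Fin (α i) → k) := fun i =>
    LinearEquiv.ofFinrankEq _ _ (by simp [hd i])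
  refine ⟨fun p => (e p.2.1 : M.V p.2.1 →ₗ[k] _) ∘ₗ M.map p.2.2 ∘ₗ
    ((e p.1).symm : _ →ₗ[k] M.V p.1), ?_⟩
  refine mk_eq.2 ⟨Iso.symm ⟨e, ?_⟩⟩
  intro i j h x
  simp

end IsoClass

/-- The completed Hall algebra over a finite field.  In each height there are only finitely many
isomorphism classes, so the product of the graded pieces is the space of all rational functions on
the set of isomorphism classes; a function `f` stands for the series `∑ f([M]) [M]`. -/
def CompletedHall (k : Type u) [Field k] (I : Type w) [Quiver.{v} I] := IsoClass k I → ℚ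

namespace CompletedHall

open QuiverRep

variable {k : Type u} [Field k] {I : Type w} [Quiver.{v} I]

instance : AddCommGroup (CompletedHall k I) := inferInstanceAs (AddCommGroup (IsoClass k I → ℚ))

instance : Module ℚ (CompletedHall k I) := inferInstanceAs (Module ℚ (IsoClass k I → ℚ))

@[ext]
theorem ext {f g : CompletedHall k I} (h : ∀ M, f (IsoClass.mk M) = g (IsoClass.mk M)) : f = g :=
  funext fun c => Quotient.inductionOn c h

/-- The class of the zero representation. -/
instance : One (CompletedHall k I) where
  one c := by
    classical
    exact if ∃ M : QuiverRep k I, IsoClass.mk M = c ∧ M.IsZero then 1 else 0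

theorem one_apply (M : QuiverRep k I) [Decidable M.IsZero] :
    (1 : CompletedHall k I) (IsoClass.mk M) = if M.IsZero then 1 else 0 := by
  classical
  have : (∃ N : QuiverRep k I, IsoClass.mk N = IsoClass.mk M ∧ N.IsZero) ↔ M.IsZero :=
    ⟨fun ⟨N, h, hN⟩ => hN.of_iso (IsoClass.mk_eq.1 h).some, fun h => ⟨M, rfl, h⟩⟩
  exact if_congr this rfl rfl

/-- The basis element `[M]`. -/
def of (M : QuiverRep k I) : CompletedHall k I := by
  classical
  exact fun c => if c = IsoClass.mk M then 1 else 0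

theorem add_apply (f g : CompletedHall k I) (c : IsoClass k I) : (f + g) c = f c + g c := rfl

variable [Finite k] [Finite I]

/-- The product: the coefficient of `f * g` at `[X]` is the sum of `f([X/U]) g([U])` over all
subrepresentations `U` of `X`. -/
instance : Mul (CompletedHall k I) where
  mul f g := Quotient.lift
    (fun X : QuiverRep k I =>
      ∑ U : Sub X, f (IsoClass.mk U.quotient) * g (IsoClass.mk U.toRep))
    (fun X Y ⟨e⟩ => Fintype.sum_bijective (Sub.mapIso e) (Sub.mapIso_bijective e) _ _
      (fun U => by
        rw [IsoClass.mk_eq.2 (Sub.mapIso_quotient e U), IsoClass.mk_eq.2 (Sub.mapIso_toRep e U)]))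

theorem mul_apply (f g : CompletedHall k I) (X : QuiverRep k I) :
    (f * g) (IsoClass.mk X) =
      ∑ U : Sub X, f (IsoClass.mk U.quotient) * g (IsoClass.mk U.toRep) := rfl

/-- The structure constants: `[X]` occurs in `[M] * [N]` as often as there are subrepresentations
`U` of `X` with `U ≃ N` and `X / U ≃ M`. -/
theorem of_mul_of (M N X : QuiverRep k I) :
    (of M * of N) (IsoClass.mk X) =
      Nat.card {U : Sub X // Nonempty (Iso U.toRep N) ∧ Nonempty (Iso U.quotient M)} := by
  classical
  rw [mul_apply, Nat.card_eq_fintype_card, Fintype.card_subtype, ← Finset.sum_boole]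
  refine Finset.sum_congr rfl fun U _ => ?_
  simp only [of, IsoClass.mk_eq]
  by_cases h1 : Nonempty (Iso U.toRep N) <;> by_cases h2 : Nonempty (Iso U.quotient M) <;>
    simp [h1, h2]

theorem hall_mul_assoc (f g h : CompletedHall k I) : f * g * h = f * (g * h) := by
  classical
  ext X
  let G : Sub X → Sub X → ℚ := fun U W =>
    f (IsoClass.mk W.quotient) * g (IsoClass.mk (W.restr U).quotient) * h (IsoClass.mk U.toRep)
  have hL : ∀ U : Sub X, (f * g) (IsoClass.mk U.quotient) * h (IsoClass.mk U.toRep) =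
      ∑ W with ∀ i, U.space i ≤ W.space i, G U W := by
    intro U
    rw [mul_apply, Finset.sum_mul]
    refine Finset.sum_bij' (fun W _ => U.pull W) (fun W _ => U.push W) ?_ ?_ ?_ ?_ ?_
    · intro W _
      simpa using U.le_pull W
    · intro W _
      simp
    · intro W _
      exact U.push_pull W
    · intro W hW
      exact U.pull_push W (by simpa using hW)
    · intro W _
      simp only [G]
      rw [IsoClass.mk_eq.2 (U.pull_quotient W), IsoClass.mk_eq.2 (U.pull_restr W)]
  have hR : ∀ W : Sub X, f (IsoClass.mk W.quotient) * (g * h) (IsoClass.mk W.toRep) =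
      ∑ U with ∀ i, U.space i ≤ W.space i, G U W := by
    intro W
    rw [mul_apply, Finset.mul_sum]
    refine Finset.sum_bij' (fun T _ => W.incl T) (fun U _ => W.restr U) ?_ ?_ ?_ ?_ ?_
    · intro T _
      simpa using W.incl_le T
    · intro U _
      simp
    · intro T _
      exact W.restr_incl T
    · intro U hU
      exact W.incl_restr U (by simpa using hU)
    · intro T _
      simp only [G]
      rw [W.restr_incl T, ← IsoClass.mk_eq.2 (W.incl_toRep T), mul_assoc]
  rw [mul_apply, mul_apply, Finset.sum_congr rfl fun U _ => hL U,
    Finset.sum_congr rfl fun W _ => hR W]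
  exact Finset.sum_comm' (by simp)

theorem hall_one_mul (f : CompletedHall k I) : 1 * f = f := by
  classical
  ext X
  rw [mul_apply, Finset.sum_eq_single (Sub.whole X)]
  · rw [one_apply, if_pos ((Sub.quotient_isZero_iff _).2 rfl), one_mul,
      ← IsoClass.mk_eq.2 (Sub.whole_toRep X)]
  · intro U _ hU
    rw [one_apply, if_neg (fun h => hU ((Sub.quotient_isZero_iff _).1 h)), zero_mul]
  · simp

theorem hall_mul_one (f : CompletedHall k I) : f * 1 = f := by
  classical
  ext X
  rw [mul_apply, Finset.sum_eq_single (Sub.zero X)]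
  · rw [one_apply, if_pos ((Sub.toRep_isZero_iff _).2 rfl), mul_one,
      IsoClass.mk_eq.2 (Sub.zero_quotient X)]
  · intro U _ hU
    rw [one_apply, if_neg (fun h => hU ((Sub.toRep_isZero_iff _).1 h)), mul_zero]
  · simp

instance : Ring (CompletedHall k I) :=
  { (inferInstance : AddCommGroup (CompletedHall k I)),
    (inferInstance : Mul (CompletedHall k I)), (inferInstance : One (CompletedHall k I)) with
    mul_assoc := hall_mul_assoc
    one_mul := hall_one_mul
    mul_one := hall_mul_one
    left_distrib := fun f g h => by
      ext X
      simp only [mul_apply, add_apply, mul_add, Finset.sum_add_distrib]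
    right_distrib := fun f g h => by
      ext X
      simp only [mul_apply, add_apply, add_mul, Finset.sum_add_distrib]
    zero_mul := fun f => by
      ext X
      exact Finset.sum_eq_zero fun U _ => zero_mul _
    mul_zero := fun f => by
      ext X
      exact Finset.sum_eq_zero fun U _ => mul_zero _ }

end CompletedHall

section Integral

variable {k : Type u} [Field k] {I : Type w} [Quiver.{v} I]

/-- The integral `∫ [M] = x ^ dim M / #Aut M`.  As a vector space, its target, the completed twisted
polynomial algebra, is the space of power series over the rational numbers. -/
def hallIntegral [Finite I] (f : CompletedHall k I) : MvPowerSeries I ℚ :=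
  fun α => ∑ᶠ c ∈ {c : IsoClass k I | c.dim = α}, f c / (c.cardAut : ℚ)

/-- The element `e_μ`, the sum of the classes of all semistable representations of slope `μ`. -/
def semistableSum [Fintype I] (k : Type u) [Field k] (θ : I → ℤ) (μ : ℚ) : CompletedHall k I := by
  classical
  exact fun c => if ∃ M : QuiverRep k I, IsoClass.mk M = c ∧ M.IsSemistableOfSlope θ μ then 1 else 0

/-- The number of isomorphism classes of absolutely stable representations over `k` of dimension
vector `α`. -/
def absStableCount [Fintype I] (k : Type u) [Field k] (θ : I → ℤ) (α : I →₀ ℕ) : ℕ :=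
  {c : IsoClass k I | ∃ M : QuiverRep k I,
    IsoClass.mk M = c ∧ M.dim = α ∧ M.IsAbsolutelyStable θ}.ncard

end Integral

section Exp

variable {I : Type w}

/-- The Adams operation `f(q) ↦ f(q ^ n)` on rational functions. -/
def ratFuncAdams (n : ℕ) (hn : n ≠ 0) : RatFunc ℚ →+* RatFunc ℚ :=
  RatFunc.mapRingHom (Polynomial.expand ℚ n : Polynomial ℚ →+* Polynomial ℚ)
    (nonZeroDivisors_le_comap_nonZeroDivisors_of_injective _
      (Polynomial.expand_injective (Nat.pos_of_ne_zero hn)))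

/-- The Adams operation `f(q, x) ↦ f(q ^ n, x ^ n)` on power series over the rational functions. -/
def adams (n : ℕ) (hn : n ≠ 0) (f : MvPowerSeries I (RatFunc ℚ)) : MvPowerSeries I (RatFunc ℚ) :=
  MvPowerSeries.expand n hn (MvPowerSeries.map (ratFuncAdams n hn) f)

/-- The series `∑ ψₙ(f) / n` over `n ≥ 1`, for `f` without constant term.  Only the `n` dividing
`α` contribute to the coefficient at `α`, and these are at most the height of `α`. -/
def adamsSum (f : MvPowerSeries I (RatFunc ℚ)) : MvPowerSeries I (RatFunc ℚ) := fun α =>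
  ∑ n ∈ Finset.range α.degree,
    (1 / ((n : RatFunc ℚ) + 1)) * MvPowerSeries.coeff α (adams (n + 1) n.succ_ne_zero f)

/-- The plethystic exponential `Exp(f) = exp (∑ ψₙ(f) / n)` of a series without constant term. -/
def plethysticExp (f : MvPowerSeries I (RatFunc ℚ)) : MvPowerSeries I (RatFunc ℚ) :=
  (PowerSeries.exp (RatFunc ℚ)).subst (adamsSum f)

/-- The generating function `a(q) = ∑ a_α(q) x ^ α` over the nonzero `α` of slope `μ`. -/
def genFun [Fintype I] (θ : I → ℤ) (μ : ℚ) (a : (I →₀ ℕ) → Polynomial ℤ) :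
    MvPowerSeries I (RatFunc ℚ) := by
  classical
  exact fun α => if α ≠ 0 ∧ dimSlope θ α = μ then
    algebraMap (Polynomial ℚ) (RatFunc ℚ) ((a α).map (Int.castRingHom ℚ)) else 0

/-- The coefficients of a series are rational functions without pole at `s`. -/
def RegularAt (s : ℚ) (f : MvPowerSeries I (RatFunc ℚ)) : Prop :=
  ∀ α, (MvPowerSeries.coeff α f).denom.eval s ≠ 0

/-- Specialization of the coefficients at `q = s`. -/
def specialize (s : ℚ) (f : MvPowerSeries I (RatFunc ℚ)) : MvPowerSeries I ℚ :=
  fun α => (MvPowerSeries.coeff α f).eval (RingHom.id ℚ) s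

end Exp

end

set_option linter.unusedSectionVars false

/-! ### Subrepresentations, homomorphisms and direct sums. -/

noncomputable section

namespace QuiverRep

variable {k : Type u} [Field k] {I : Type w} [Quiver.{v} I]

/-! Fix a finite field k with q elements and a slope μ. The semistable representations of slope μ,
together with 0, are cut out by an additive function φ on dimension vectors (`slopeForm`), and the
subobjects of a semistable X with φ = 0 form a sublattice. The equation e·e⁻¹ = 1 says that the
coefficients c of e⁻¹ sum to zero over this sublattice if X ≠ 0, so c behaves like a Möbius
function. It vanishes off the semistables (`semiInv_of_not_semi`), and Weisner's theorem for a
stable A ⊂ X gives c(X) = -#{complements of A}·c(X/A) (`semiInv_eq_of_stable_sub`). Hence only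
direct sums of stables contribute. Counting isomorphisms S ⊕ Y ≅ X turns this into (#Hom(S,X) -
1)·c(X)/#Aut X = -∑ c(Y)/#Aut Y, over the classes Y with S ⊕ Y ≅ X (`homCard_sub_one_mul_semiInv`).
Sorting X by the multiplicity of S then splits off from ∫e⁻¹ the factor ∑ x^(n dim S)/((1-Q)⋯(1-Qⁿ))
with Q = #End S (`partInv_eq`). Over all stable S together, log ∫e⁻¹ = ∑_S ∑_m x^(m dim
S)/(m(1-Q^m)) (`isLog_stableLog`).

The absolutely stable representations are the stable ones with only scalar endomorphisms, the stable
bricks (`isAbsolutelyStable_iff`). For a stable S over k the algebra End S is a field, of degree r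
say; S is a representation over that field, and each of the r embeddings into the extension K of
degree n, for r ∣ n, yields a stable brick over K. Every stable brick over K arises exactly once
(`brickCount_eq`). Rearranging, the logarithm has at β the coefficient ∑ (1/n)·(number of stable
bricks over K of dimension α)/(1-qⁿ), over nα = β (`coeff_stableLog`). This is the shape of the
logarithm of Exp, but the numbers are not yet polynomials in q.

For that, Harder–Narasimhan recursion and point counts of spaces of representations show that the
coefficients of ∫e⁻¹ are values at q of elements, independent of k, of a ring of rational functions
with monic integral denominators that have no zeros at integers from 2 on
(`isUniform_coeff_semiInv`). The plethystic logarithm can be formed inside this ring: a series with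
constant term 1 is a product of geometric series, and their parameters are converted into plethystic
coordinates by Dwork's lemma for the Frobenius lifts q ↦ qⁿ (`ghost_ghostSolution`,
`CountRing.exists_plethysticLog`). Uniqueness of logarithms and induction identify (1-q) times its
coefficients with the numbers of bricks (`brickCount_eq_ev`). An element of the ring with integral
values at arbitrarily large integers is an integral polynomial (`CountRing.exists_eq_ofPoly`); this
gives the a_α. The same logarithm, read in the rational functions, gives the formula for Exp, and
the shape of the denominators gives the absence of poles. -/

theorem Iso.dim_eq [Finite I] {M N : QuiverRep k I} (e : Iso M N) : M.dim = N.dim := by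
  ext i
  exact (e.equiv i).finrank_eq

theorem isZero_iff_dim [Finite I] (M : QuiverRep k I) : M.IsZero ↔ M.dim = 0 := by
  rw [Finsupp.ext_iff]
  exact forall_congr' fun i => (Module.finrank_zero_iff (R := k) (M := M.V i)).symm

theorem not_isZero_iff (M : QuiverRep k I) : ¬ M.IsZero ↔ ∃ i, ∃ x : M.V i, x ≠ 0 := by
  rw [IsZero, not_forall]
  refine exists_congr fun i => ?_
  rw [not_subsingleton_iff_nontrivial]
  exact ⟨fun h => exists_ne 0, fun ⟨x, hx⟩ => ⟨x, 0, hx⟩⟩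

namespace Sub

variable {X : QuiverRep k I}

theorem space_injective : Function.Injective (Sub.space : Sub X → ∀ i, Submodule k (X.V i)) :=
  fun _ _ h => Sub.ext h

instance : Max (Sub X) where
  max U W :=
    { space := fun i => U.space i ⊔ W.space i
      map_mem := by
        intro i j h x hx
        obtain ⟨y, hy, z, hz, rfl⟩ := Submodule.mem_sup.1 hx
        rw [map_add]
        exact Submodule.add_mem_sup (U.map_mem h hy) (W.map_mem h hz) }

instance : Min (Sub X) where
  min U W :=
    { space := fun i => U.space i ⊓ W.space i
      map_mem := fun h _ hx => ⟨U.map_mem h hx.1, W.map_mem h hx.2⟩ }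

instance : LE (Sub X) := ⟨fun U W => U.space ≤ W.space⟩

instance : LT (Sub X) := ⟨fun U W => U.space < W.space⟩

instance : Lattice (Sub X) :=
  Function.Injective.lattice Sub.space space_injective Iff.rfl Iff.rfl (fun _ _ => rfl)
    fun _ _ => rfl

instance : BoundedOrder (Sub X) where
  top := Sub.whole X
  bot := Sub.zero X
  le_top _ _ := le_top
  bot_le _ _ := bot_le

theorem le_iff {U W : Sub X} : U ≤ W ↔ ∀ i, U.space i ≤ W.space i := Iff.rfl

@[simp] theorem sup_space (U W : Sub X) (i : I) : (U ⊔ W).space i = U.space i ⊔ W.space i := rfl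

@[simp] theorem inf_space (U W : Sub X) (i : I) : (U ⊓ W).space i = U.space i ⊓ W.space i := rfl

@[simp] theorem bot_space (i : I) : (⊥ : Sub X).space i = ⊥ := rfl

@[simp] theorem top_space (i : I) : (⊤ : Sub X).space i = ⊤ := rfl

instance : IsModularLattice (Sub X) where
  sup_inf_le_assoc_of_le := by
    intro U W T h i
    exact sup_inf_le_assoc_of_le (W.space i) (h i)

theorem isNonzero_iff (U : Sub X) : U.IsNonzero ↔ U ≠ ⊥ := by
  rw [Ne, Sub.ext_iff, funext_iff, not_forall]
  exact Iff.rfl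

theorem isProper_iff (U : Sub X) : U.IsProper ↔ U ≠ ⊤ := by
  rw [Ne, Sub.ext_iff, funext_iff, not_forall]
  exact Iff.rfl

theorem isCompl_space {U W : Sub X} (h : IsCompl U W) (i : I) :
    IsCompl (U.space i) (W.space i) := by
  refine IsCompl.of_eq ?_ ?_
  · rw [← inf_space, h.inf_eq_bot, bot_space]
  · rw [← sup_space, h.sup_eq_top, top_space]

section Dim

variable [Finite I]

theorem dim_add_dim_quotient (U : Sub X) : U.toRep.dim + U.quotient.dim = X.dim := by
  ext i
  exact (add_comm _ _).trans (Submodule.finrank_quotient_add_finrank (U.space i))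

theorem dim_sup_add_dim_inf (U W : Sub X) :
    (U ⊔ W).toRep.dim + (U ⊓ W).toRep.dim = U.toRep.dim + W.toRep.dim := by
  ext i
  exact Submodule.finrank_sup_add_finrank_inf_eq (U.space i) (W.space i)

theorem dim_mono {U W : Sub X} (h : U ≤ W) : U.toRep.dim ≤ W.toRep.dim :=
  fun i => Submodule.finrank_mono (h i)

theorem dim_le (U : Sub X) : U.toRep.dim ≤ X.dim := fun i => Submodule.finrank_le (U.space i)

theorem eq_of_le_of_dim {U W : Sub X} (h : U ≤ W) (hd : U.toRep.dim = W.toRep.dim) : U = W := by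
  refine Sub.ext (funext fun i => Submodule.eq_of_le_of_finrank_eq (h i) ?_)
  exact DFunLike.congr_fun hd i

@[simp] theorem dim_bot : (⊥ : Sub X).toRep.dim = 0 := by
  ext i
  exact finrank_bot k (X.V i)

@[simp] theorem dim_top : (⊤ : Sub X).toRep.dim = X.dim := by
  ext i
  exact finrank_top k (X.V i)

theorem dim_eq_zero {U : Sub X} : U.toRep.dim = 0 ↔ U = ⊥ := by
  rw [← isZero_iff_dim]
  exact U.toRep_isZero_iff

theorem dim_incl (W : Sub X) (T : Sub W.toRep) : (W.incl T).toRep.dim = T.toRep.dim :=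
  (W.incl_toRep T).some.dim_eq.symm

theorem dim_pull (U : Sub X) (W : Sub U.quotient) :
    (U.pull W).toRep.dim = U.toRep.dim + W.toRep.dim := by
  have h1 := (U.pull W).dim_add_dim_quotient
  have h2 := W.dim_add_dim_quotient
  have h3 := U.dim_add_dim_quotient
  rw [(U.pull_quotient W).some.dim_eq, ← h3, ← h2, ← add_assoc] at h1
  exact add_right_cancel h1

end Dim

end Sub

/-- The space of homomorphisms. -/
def homs (M N : QuiverRep k I) : Submodule k (∀ i, M.V i →ₗ[k] N.V i) where
  carrier := {f | ∀ (i j : I) (h : i ⟶ j) (x : M.V i), f j (M.map h x) = N.map h (f i x)}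
  add_mem' := by
    intro f g hf hg i j h x
    simp [hf i j h x, hg i j h x]
  zero_mem' := by
    intro i j h x
    simp
  smul_mem' := by
    intro c f hf i j h x
    simp [hf i j h x]

/-- Homomorphisms of representations. -/
abbrev Hom (M N : QuiverRep k I) : Type _ := homs M N

namespace Hom

variable {M N P : QuiverRep k I}

theorem comm (f : Hom M N) {i j : I} (h : i ⟶ j) (x : M.V i) :
    f.1 j (M.map h x) = N.map h (f.1 i x) := f.2 i j h x

theorem ext' {f g : Hom M N} (h : ∀ i x, f.1 i x = g.1 i x) : f = g :=
  Subtype.ext (funext fun i => LinearMap.ext (h i))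

theorem ne_zero_iff (f : Hom M N) : f ≠ 0 ↔ ∃ i x, f.1 i x ≠ 0 := by
  constructor
  · intro h
    by_contra! hn
    exact h (ext' hn)
  · rintro ⟨i, x, hx⟩ rfl
    exact hx rfl

def id (M : QuiverRep k I) : Hom M M := ⟨fun _ => LinearMap.id, fun _ _ _ _ => rfl⟩

def comp (g : Hom N P) (f : Hom M N) : Hom M P :=
  ⟨fun i => g.1 i ∘ₗ f.1 i, fun i j h x => by simp [f.comm, g.comm]⟩

@[simp] theorem id_apply (i : I) (x : M.V i) : (id M).1 i x = x := rfl

@[simp] theorem comp_apply (g : Hom N P) (f : Hom M N) (i : I) (x : M.V i) :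
    (g.comp f).1 i x = g.1 i (f.1 i x) := rfl

def ker (f : Hom M N) : Sub M where
  space i := LinearMap.ker (f.1 i)
  map_mem {i j} h x hx := by
    rw [LinearMap.mem_ker] at hx ⊢
    rw [f.comm, hx, map_zero]

def range (f : Hom M N) : Sub N where
  space i := LinearMap.range (f.1 i)
  map_mem {i j} h x hx := by
    obtain ⟨y, rfl⟩ := hx
    exact ⟨M.map h y, f.comm h y⟩

@[simp] theorem mem_range (f : Hom M N) (i : I) (x : N.V i) :
    x ∈ f.range.space i ↔ ∃ y, f.1 i y = x := Iff.rfl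

theorem ker_eq_bot_iff (f : Hom M N) : f.ker = ⊥ ↔ ∀ i, Function.Injective (f.1 i) := by
  rw [Sub.ext_iff, funext_iff]
  exact forall_congr' fun i => LinearMap.ker_eq_bot

theorem range_eq_top_iff (f : Hom M N) : f.range = ⊤ ↔ ∀ i, Function.Surjective (f.1 i) := by
  rw [Sub.ext_iff, funext_iff]
  exact forall_congr' fun i => LinearMap.range_eq_top

theorem range_eq_bot_iff (f : Hom M N) : f.range = ⊥ ↔ f = 0 := by
  rw [Sub.ext_iff, funext_iff, Subtype.ext_iff, funext_iff]
  exact forall_congr' fun i => LinearMap.range_eq_bot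

theorem ker_eq_top_iff (f : Hom M N) : f.ker = ⊤ ↔ f = 0 := by
  rw [Sub.ext_iff, funext_iff, Subtype.ext_iff, funext_iff]
  exact forall_congr' fun i => LinearMap.ker_eq_top

theorem dim_ker_add_dim_range [Finite I] (f : Hom M N) :
    f.ker.toRep.dim + f.range.toRep.dim = M.dim := by
  ext i
  exact (add_comm _ _).trans (LinearMap.finrank_range_add_finrank_ker (f.1 i))

end Hom

namespace Iso

variable {M N : QuiverRep k I}

def toHom (e : Iso M N) : Hom M N :=
  ⟨fun i => (e.equiv i : M.V i →ₗ[k] N.V i), fun _ _ h x => e.comm h x⟩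

@[simp] theorem toHom_apply (e : Iso M N) (i : I) (x : M.V i) : e.toHom.1 i x = e.equiv i x := rfl

@[simp] theorem symm_apply (e : Iso M N) (i : I) (x : N.V i) :
    e.symm.equiv i x = (e.equiv i).symm x := rfl

@[simp] theorem trans_apply {P : QuiverRep k I} (e : Iso M N) (f : Iso N P) (i : I) (x : M.V i) :
    (e.trans f).equiv i x = f.equiv i (e.equiv i x) := rfl

def ofBijective (f : Hom M N) (hf : ∀ i, Function.Bijective (f.1 i)) : Iso M N where
  equiv i := LinearEquiv.ofBijective (f.1 i) (hf i)
  comm h x := f.comm h x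

@[simp] theorem ofBijective_apply (f : Hom M N) (hf : ∀ i, Function.Bijective (f.1 i)) (i : I)
    (x : M.V i) : (ofBijective f hf).equiv i x = f.1 i x := rfl

theorem ext' {e f : Iso M N} (h : ∀ i x, e.equiv i x = f.equiv i x) : e = f :=
  Iso.ext (funext fun i => LinearEquiv.ext (h i))

theorem toHom_injective : Function.Injective (toHom : Iso M N → Hom M N) := fun e f h =>
  ext' fun i x => by rw [← toHom_apply, h, toHom_apply]

end Iso

namespace Sub

variable {X : QuiverRep k I}

/-- The inclusion of a subrepresentation. -/
def inclHom (U : Sub X) : Hom U.toRep X := ⟨U.subtype, fun _ _ h x => U.subtype_map h x⟩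

/-- The projection to a quotient. -/
def mkHom (U : Sub X) : Hom X U.quotient := ⟨U.mkQ, fun _ _ h x => U.mkQ_map h x⟩

theorem inclHom_injective (U : Sub X) (i : I) : Function.Injective (U.inclHom.1 i) :=
  U.subtype_injective i

end Sub

theorem Hom.range_iso {M N : QuiverRep k I} (f : Hom M N) (hf : f.ker = ⊥) :
    Nonempty (Iso M f.range.toRep) :=
  class_sub_eq f.1 (fun h x => f.comm h x) (f.ker_eq_bot_iff.1 hf) f.range fun _ _ => Iff.rfl

/-- Direct sums. -/
def prod (S Y : QuiverRep k I) : QuiverRep k I where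
  V i := S.V i × Y.V i
  map h := (S.map h).prodMap (Y.map h)

section Prod

variable (S Y : QuiverRep k I)

def inl : Hom S (S.prod Y) := ⟨fun _ => LinearMap.inl k _ _, fun _ _ h _ =>
  Prod.ext rfl (map_zero (Y.map h)).symm⟩
def inr : Hom Y (S.prod Y) := ⟨fun _ => LinearMap.inr k _ _, fun _ _ h _ =>
  Prod.ext (map_zero (S.map h)).symm rfl⟩
def fst : Hom (S.prod Y) S := ⟨fun _ => LinearMap.fst k _ _, fun _ _ _ _ => rfl⟩
def snd : Hom (S.prod Y) Y := ⟨fun _ => LinearMap.snd k _ _, fun _ _ _ _ => rfl⟩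

variable {S Y}

@[simp] theorem inl_apply (i : I) (x : S.V i) : (inl S Y).1 i x = (x, 0) := rfl
@[simp] theorem inr_apply (i : I) (x : Y.V i) : (inr S Y).1 i x = (0, x) := rfl
@[simp] theorem snd_apply (i : I) (x : (S.prod Y).V i) : (snd S Y).1 i x = x.2 := rfl

def Hom.coprod {X : QuiverRep k I} (f : Hom S X) (g : Hom Y X) : Hom (S.prod Y) X :=
  f.comp (fst S Y) + g.comp (snd S Y)

@[simp] theorem Hom.coprod_apply {X : QuiverRep k I} (f : Hom S X) (g : Hom Y X) (i : I)
    (x : (S.prod Y).V i) : (f.coprod g).1 i x = f.1 i x.1 + g.1 i x.2 := rfl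

def Hom.prod {X : QuiverRep k I} (f : Hom X S) (g : Hom X Y) : Hom X (S.prod Y) :=
  (inl S Y).comp f + (inr S Y).comp g

@[simp] theorem Hom.prod_apply {X : QuiverRep k I} (f : Hom X S) (g : Hom X Y) (i : I)
    (x : X.V i) : (f.prod g).1 i x = (f.1 i x, g.1 i x) := by
  simp only [Hom.prod, Submodule.coe_add, Pi.add_apply, LinearMap.add_apply, Hom.comp_apply,
    inl_apply, inr_apply]
  exact Prod.ext (add_zero _) (zero_add _)

variable (S Y) in
theorem dim_prod [Finite I] : (S.prod Y).dim = S.dim + Y.dim := by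
  ext i
  exact Module.finrank_prod

def Iso.prod {S' Y' : QuiverRep k I} (e : Iso S S') (f : Iso Y Y') :
    Iso (S.prod Y) (S'.prod Y') where
  equiv i := (e.equiv i).prodCongr (f.equiv i)
  comm h x := Prod.ext (e.comm h x.1) (f.comm h x.2)

variable (S Y) in
/-- Homomorphisms to a direct sum. -/
def homProdEquiv (T : QuiverRep k I) : Hom T (S.prod Y) ≃ Hom T S × Hom T Y where
  toFun f := ((fst S Y).comp f, (snd S Y).comp f)
  invFun p := p.1.prod p.2
  left_inv f := Hom.ext' fun i x => by
    rw [Hom.prod_apply]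
    rfl
  right_inv p := Prod.ext
    (Hom.ext' fun i x => by rw [Hom.comp_apply, Hom.prod_apply]; rfl)
    (Hom.ext' fun i x => by rw [Hom.comp_apply, Hom.prod_apply]; rfl)

end Prod

/-- Composition with an isomorphism. -/
def homCongrRight {M N : QuiverRep k I} (T : QuiverRep k I) (e : Iso M N) : Hom T M ≃ Hom T N where
  toFun f := e.toHom.comp f
  invFun f := e.symm.toHom.comp f
  left_inv f := Hom.ext' fun i x => by simp
  right_inv f := Hom.ext' fun i x => by simp

/-- Composition with an isomorphism. -/
def homCongrLeft {M N : QuiverRep k I} (T : QuiverRep k I) (e : Iso M N) : Hom M T ≃ Hom N T where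
  toFun f := f.comp e.symm.toHom
  invFun f := f.comp e.toHom
  left_inv f := Hom.ext' fun i x => by simp
  right_inv f := Hom.ext' fun i x => by simp

instance finite_hom [Finite k] [Finite I] (M N : QuiverRep k I) : Finite (Hom M N) := by
  have : ∀ i, Finite (M.V i →ₗ[k] N.V i) := fun i => Module.finite_of_finite k
  infer_instance

instance finite_iso [Finite k] [Finite I] (M N : QuiverRep k I) : Finite (Iso M N) :=
  Finite.of_injective _ Iso.toHom_injective

theorem card_aut_pos [Finite k] [Finite I] (M : QuiverRep k I) : 0 < Nat.card (Iso M M) :=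
  Nat.card_pos_iff.2 ⟨⟨Iso.refl M⟩, inferInstance⟩

end QuiverRep

end

/-! ### Stability with respect to an additive function of the dimension vector. -/

noncomputable section

namespace QuiverRep

variable {k : Type u} [Field k] {I : Type w} [Quiver.{v} I] [Finite I]

/-- Semistability with respect to an additive function on dimension vectors, including zero. -/
def SemiFor (φ : (I →₀ ℕ) →+ ℚ) (X : QuiverRep k I) : Prop :=
  φ X.dim = 0 ∧ ∀ U : Sub X, φ U.toRep.dim ≤ 0

/-- Stability with respect to an additive function on dimension vectors. -/
def StableFor (φ : (I →₀ ℕ) →+ ℚ) (X : QuiverRep k I) : Prop :=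
  ¬ X.IsZero ∧ φ X.dim = 0 ∧ ∀ U : Sub X, U ≠ ⊥ → U ≠ ⊤ → φ U.toRep.dim < 0

variable {φ : (I →₀ ℕ) →+ ℚ}

theorem dim_mapIso {X Y : QuiverRep k I} (e : Iso X Y) (U : Sub X) :
    (U.mapIso e).toRep.dim = U.toRep.dim := (U.mapIso_toRep e).some.dim_eq.symm

theorem SemiFor.of_iso {X Y : QuiverRep k I} (h : SemiFor φ X) (e : Iso X Y) : SemiFor φ Y := by
  refine ⟨e.dim_eq ▸ h.1, fun U => ?_⟩
  obtain ⟨U, rfl⟩ := (Sub.mapIso_bijective e).2 U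
  rw [dim_mapIso]
  exact h.2 U

theorem StableFor.of_iso {X Y : QuiverRep k I} (h : StableFor φ X) (e : Iso X Y) :
    StableFor φ Y := by
  refine ⟨fun hY => h.1 (hY.of_iso e.symm), e.dim_eq ▸ h.2.1, fun U hU hU' => ?_⟩
  obtain ⟨U, rfl⟩ := (Sub.mapIso_bijective e).2 U
  have h1 := U.mapIso e |>.dim_add_dim_quotient
  rw [dim_mapIso]
  refine h.2.2 U ?_ ?_
  · rwa [Ne, ← Sub.dim_eq_zero, dim_mapIso, Sub.dim_eq_zero] at hU
  · rintro rfl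
    refine hU' (Sub.eq_of_le_of_dim le_top ?_)
    rw [dim_mapIso, Sub.dim_top, Sub.dim_top, e.dim_eq]

theorem StableFor.semi {X : QuiverRep k I} (h : StableFor φ X) : SemiFor φ X := by
  refine ⟨h.2.1, fun U => ?_⟩
  by_cases h1 : U = ⊥
  · simp [h1]
  by_cases h2 : U = ⊤
  · simp [h2, h.2.1]
  exact (h.2.2 U h1 h2).le

theorem SemiFor.of_isZero {X : QuiverRep k I} (h : X.IsZero) : SemiFor φ X := by
  have h0 := (isZero_iff_dim X).1 h
  refine ⟨by rw [h0, map_zero], fun U => ?_⟩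
  have : U.toRep.dim = 0 := le_antisymm (h0 ▸ U.dim_le) (zero_le)
  rw [this, map_zero]

theorem phi_sup_add_inf {X : QuiverRep k I} (U W : Sub X) :
    φ (U ⊔ W).toRep.dim + φ (U ⊓ W).toRep.dim = φ U.toRep.dim + φ W.toRep.dim := by
  rw [← map_add, Sub.dim_sup_add_dim_inf, map_add]

theorem phi_add_quotient {X : QuiverRep k I} (U : Sub X) :
    φ U.toRep.dim + φ U.quotient.dim = φ X.dim := by
  rw [← map_add, Sub.dim_add_dim_quotient]

/-- The values at join and meet are nonpositive with sum zero, so both vanish. The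
subrepresentations with φ = 0 are therefore a sublattice, the one on which the Möbius argument runs.
-/
theorem SemiFor.phi_sup {X : QuiverRep k I} (h : SemiFor φ X) {U W : Sub X}
    (hU : φ U.toRep.dim = 0) (hW : φ W.toRep.dim = 0) : φ (U ⊔ W).toRep.dim = 0 := by
  have := phi_sup_add_inf (φ := φ) U W
  linarith [h.2 (U ⊔ W), h.2 (U ⊓ W)]

theorem SemiFor.phi_inf {X : QuiverRep k I} (h : SemiFor φ X) {U W : Sub X}
    (hU : φ U.toRep.dim = 0) (hW : φ W.toRep.dim = 0) : φ (U ⊓ W).toRep.dim = 0 := by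
  have := phi_sup_add_inf (φ := φ) U W
  linarith [h.2 (U ⊔ W), h.2 (U ⊓ W)]

theorem SemiFor.sub {X : QuiverRep k I} (h : SemiFor φ X) {U : Sub X}
    (hU : φ U.toRep.dim = 0) : SemiFor φ U.toRep :=
  ⟨hU, fun T => (U.dim_incl T) ▸ h.2 (U.incl T)⟩

theorem SemiFor.quotient {X : QuiverRep k I} (h : SemiFor φ X) {U : Sub X}
    (hU : φ U.toRep.dim = 0) : SemiFor φ U.quotient := by
  refine ⟨?_, fun W => ?_⟩
  · have := phi_add_quotient (φ := φ) U
    rw [h.1] at this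
    linarith
  · have := h.2 (U.pull W)
    rw [U.dim_pull, map_add] at this
    linarith

/-- By modularity φ(W) = φ(U ⊔ W) + φ(U ⊓ W) - φ(U). The join is measured in the quotient, the meet
inside U, and φ(U) = 0. -/
theorem SemiFor.ext {X : QuiverRep k I} {U : Sub X} (hU : SemiFor φ U.toRep)
    (hQ : SemiFor φ U.quotient) : SemiFor φ X := by
  have h1 := phi_add_quotient (φ := φ) U
  refine ⟨by rw [← h1, hU.1, hQ.1, add_zero], fun W => ?_⟩
  have h2 := phi_sup_add_inf (φ := φ) U W
  have h3 : φ (U ⊔ W).toRep.dim ≤ 0 := by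
    rw [← U.pull_push (U ⊔ W) (Sub.le_iff.1 le_sup_left), U.dim_pull, map_add, hU.1, zero_add]
    exact hQ.2 _
  have h4 : φ (U ⊓ W).toRep.dim ≤ 0 := by
    rw [← U.incl_restr (U ⊓ W) (Sub.le_iff.1 inf_le_left), U.dim_incl]
    exact hU.2 _
  linarith [hU.1]

theorem phi_ker_add_range {M N : QuiverRep k I} (f : Hom M N) :
    φ f.ker.toRep.dim + φ f.range.toRep.dim = φ M.dim := by
  rw [← map_add, Hom.dim_ker_add_dim_range]

/-- Kernel and image have nonpositive φ, one as a subobject of M and the other of N, and the two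
values add up to φ(M) = 0. Schur's lemma for stable objects follows from this. -/
theorem SemiFor.phi_ker {M N : QuiverRep k I} (hM : SemiFor φ M) (hN : SemiFor φ N) (f : Hom M N) :
    φ f.ker.toRep.dim = 0 := by
  have := phi_ker_add_range (φ := φ) f
  linarith [hM.1, hM.2 f.ker, hN.2 f.range]

theorem SemiFor.phi_range {M N : QuiverRep k I} (hM : SemiFor φ M) (hN : SemiFor φ N)
    (f : Hom M N) : φ f.range.toRep.dim = 0 := by
  have := phi_ker_add_range (φ := φ) f
  linarith [hM.1, hM.2 f.ker, hN.2 f.range]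

theorem StableFor.eq_bot_or_top {X : QuiverRep k I} (h : StableFor φ X) {U : Sub X}
    (hU : φ U.toRep.dim = 0) : U = ⊥ ∨ U = ⊤ := by
  by_contra! hn
  exact (h.2.2 U hn.1 hn.2).ne hU

theorem StableFor.ker_eq_bot {M N : QuiverRep k I} (hM : StableFor φ M) (hN : SemiFor φ N)
    {f : Hom M N} (hf : f ≠ 0) : f.ker = ⊥ :=
  (hM.eq_bot_or_top (hM.semi.phi_ker hN f)).resolve_right fun h => hf (f.ker_eq_top_iff.1 h)

theorem StableFor.injective {M N : QuiverRep k I} (hM : StableFor φ M) (hN : SemiFor φ N)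
    {f : Hom M N} (hf : f ≠ 0) (i : I) : Function.Injective (f.1 i) :=
  f.ker_eq_bot_iff.1 (hM.ker_eq_bot hN hf) i

theorem StableFor.surjective {M N : QuiverRep k I} (hM : SemiFor φ M) (hN : StableFor φ N)
    {f : Hom M N} (hf : f ≠ 0) (i : I) : Function.Surjective (f.1 i) :=
  f.range_eq_top_iff.1 ((hN.eq_bot_or_top (hM.phi_range hN.semi f)).resolve_left fun h =>
    hf (f.range_eq_bot_iff.1 h)) i

theorem StableFor.bijective {M N : QuiverRep k I} (hM : StableFor φ M) (hN : StableFor φ N)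
    {f : Hom M N} (hf : f ≠ 0) (i : I) : Function.Bijective (f.1 i) :=
  ⟨hM.injective hN.semi hf i, hN.surjective hM.semi hf i⟩

/-- The meet A ⊓ U has φ = 0 and sits inside the stable A, so it is zero or all of A: a stable
subobject is an atom of the sublattice. -/
theorem StableFor.le_or_disjoint {X : QuiverRep k I} (hX : SemiFor φ X) {A : Sub X}
    (hA : StableFor φ A.toRep) {U : Sub X} (hU : φ U.toRep.dim = 0) : A ≤ U ∨ A ⊓ U = ⊥ := by
  have h1 := hX.phi_inf (U := A) hA.2.1 hU
  have h2 := A.incl_restr (A ⊓ U) (Sub.le_iff.1 inf_le_left)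
  have h3 := A.dim_incl (A.restr (A ⊓ U))
  rw [h2] at h3
  rcases hA.eq_bot_or_top (h3 ▸ h1) with h | h
  · right
    rw [← Sub.dim_eq_zero, h3, h, Sub.dim_bot]
  · left
    rw [h, Sub.dim_top] at h3
    exact inf_eq_left.1 (Sub.eq_of_le_of_dim inf_le_left h3)

/-- A minimal nonzero subobject with φ = 0 is stable; one exists because a representation over a
finite field has only finitely many subobjects. -/
theorem SemiFor.exists_stable_sub [Finite k] {X : QuiverRep k I} (hX : SemiFor φ X)
    (h0 : ¬ X.IsZero) : ∃ A : Sub X, StableFor φ A.toRep := by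
  let s : Set (Sub X) := {U | U ≠ ⊥ ∧ φ U.toRep.dim = 0}
  have hs : s.Nonempty := by
    refine ⟨⊤, ?_, by rw [Sub.dim_top, hX.1]⟩
    rw [Ne, ← Sub.dim_eq_zero, Sub.dim_top, ← isZero_iff_dim]
    exact h0
  obtain ⟨A, hA⟩ := (Set.toFinite s).exists_minimal hs
  refine ⟨A, fun h => hA.1.1 (A.toRep_isZero_iff.1 h), hA.1.2, fun T hT hT' => ?_⟩
  refine lt_of_le_of_ne ((hX.sub hA.1.2).2 T) fun h => hT' ?_
  have h1 : A.incl T ∈ s := by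
    refine ⟨?_, by rw [A.dim_incl, h]⟩
    rwa [Ne, ← Sub.dim_eq_zero, A.dim_incl, Sub.dim_eq_zero]
  have h2 := hA.2 h1 (A.incl_le T)
  refine Sub.eq_of_le_of_dim le_top ?_
  rw [Sub.dim_top, ← A.dim_incl]
  exact le_antisymm (Sub.dim_mono (A.incl_le T)) (Sub.dim_mono h2)

/-- A subobject with vanishing `φ` of an object generated by images of a stable object has a
complement. -/
theorem SemiFor.exists_isCompl [Finite k] {X S : QuiverRep k I} (hX : SemiFor φ X)
    (hS : StableFor φ S) (hgen : ∀ U : Sub X, (∀ f : Hom S X, f.range ≤ U) → U = ⊤) {R : Sub X}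
    (hR : φ R.toRep.dim = 0) : ∃ Q : Sub X, φ Q.toRep.dim = 0 ∧ IsCompl R Q := by
  -- A maximal Q disjoint from R works. The image of a nonzero f is stable, so it lies in R ⊔ Q or
  -- is disjoint from it; in the latter case modularity allows adding it to Q, against maximality.
  let s : Set (Sub X) := {U | R ⊓ U = ⊥ ∧ φ U.toRep.dim = 0}
  obtain ⟨Q, hQ⟩ := (Set.toFinite s).exists_maximal ⟨⊥, by simp, by simp⟩
  refine ⟨Q, hQ.1.2, IsCompl.of_eq hQ.1.1 (hgen _ fun f => ?_)⟩
  by_cases hf : f = 0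
  · rw [f.range_eq_bot_iff.2 hf]
    exact bot_le
  have hA : StableFor φ f.range.toRep := hS.of_iso (f.range_iso (hS.ker_eq_bot hX hf)).some
  refine (hA.le_or_disjoint hX (hX.phi_sup hR hQ.1.2)).resolve_right fun hd => ?_
  have h1 : Q ⊔ f.range ∈ s := by
    refine ⟨?_, hX.phi_sup hQ.1.2 hA.2.1⟩
    have hd' : Disjoint (R ⊔ Q) f.range := (disjoint_iff.2 hd).symm
    exact ((disjoint_iff.2 hQ.1.1).disjoint_sup_right_of_disjoint_sup_left hd').eq_bot
  have h2 := hQ.2 h1 le_sup_left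
  have h3 : f.range ≤ Q := le_sup_right.trans h2
  have h4 : f.range = ⊥ := by
    rw [← hd]
    exact (inf_eq_left.2 (h3.trans le_sup_right)).symm
  exact hf (f.range_eq_bot_iff.1 h4)

end QuiverRep

end

/-! ### The inverse of the sum of the semistable classes, and Möbius inversion. -/

noncomputable section


namespace CompletedHall

open QuiverRep

variable {k : Type u} [Field k] {I : Type w} [Quiver.{v} I] [Finite k] [Finite I]

theorem one_apply_of_not_isZero {X : QuiverRep k I} (h : ¬ X.IsZero) :
    (1 : CompletedHall k I) (IsoClass.mk X) = 0 := by
  classical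
  rw [one_apply, if_neg h]

theorem one_apply_of_isZero {X : QuiverRep k I} (h : X.IsZero) :
    (1 : CompletedHall k I) (IsoClass.mk X) = 1 := by
  classical
  rw [one_apply, if_pos h]

theorem sub_apply (f g : CompletedHall k I) (c : IsoClass k I) : (f - g) c = f c - g c := rfl

theorem sum_apply {ι : Type*} (s : Finset ι) (f : ι → CompletedHall k I) (c : IsoClass k I) :
    (∑ i ∈ s, f i) c = ∑ i ∈ s, f i c := by
  classical
  induction s using Finset.induction_on with
  | empty => rfl
  | insert a s ha ih => rw [Finset.sum_insert ha, Finset.sum_insert ha, add_apply, ih]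

theorem _root_.QuiverRep.Sub.degree_lt {X : QuiverRep k I} {U : Sub X} (h : U ≠ ⊤) :
    U.toRep.dim.degree < X.dim.degree := by
  have h1 := congrArg Finsupp.degree U.dim_add_dim_quotient
  rw [map_add] at h1
  have h2 : U.quotient.dim.degree ≠ 0 := by
    rw [Ne, Finsupp.degree_eq_zero_iff, ← isZero_iff_dim, U.quotient_isZero_iff]
    exact h
  omega

theorem _root_.QuiverRep.Sub.degree_le {X : QuiverRep k I} (U : Sub X) :
    U.toRep.dim.degree ≤ X.dim.degree := by
  have h1 := congrArg Finsupp.degree U.dim_add_dim_quotient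
  rw [map_add] at h1
  omega

theorem _root_.QuiverRep.Sub.degree_quotient_le {X : QuiverRep k I} (U : Sub X) :
    U.quotient.dim.degree ≤ X.dim.degree := by
  have h1 := congrArg Finsupp.degree U.dim_add_dim_quotient
  rw [map_add] at h1
  omega

/-- Each factor g has to be fed a nonzero quotient, which lowers the degree of what is left. This
makes the geometric series below finite at every class. -/
theorem pow_apply_eq_zero {g : CompletedHall k I}
    (hg : ∀ X : QuiverRep k I, X.IsZero → g (IsoClass.mk X) = 0) (n : ℕ) (X : QuiverRep k I)
    (hX : X.dim.degree < n) : (g ^ n) (IsoClass.mk X) = 0 := by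
  induction n generalizing X with
  | zero => omega
  | succ n ih =>
    rw [pow_succ', mul_apply]
    refine Finset.sum_eq_zero fun U _ => ?_
    by_cases hU : U = ⊤
    · rw [hg _ (U.quotient_isZero_iff.2 hU), zero_mul]
    · rw [ih _ (by have := Sub.degree_lt hU; omega), mul_zero]

/-- Elements with value one at the zero representation are invertible. -/
theorem isUnit_of_apply_zero {f : CompletedHall k I}
    (hf : ∀ X : QuiverRep k I, X.IsZero → f (IsoClass.mk X) = 1) : IsUnit f := by
  set g : CompletedHall k I := 1 - f with hg
  have hfg : f = 1 - g := by rw [hg]; abel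
  have hg0 : ∀ X : QuiverRep k I, X.IsZero → g (IsoClass.mk X) = 0 := fun X hX => by
    rw [hg, sub_apply, hf X hX, one_apply_of_isZero hX, sub_self]
  -- Partial sums of 1/(1 - g). At a class of degree d the powers beyond the d-th vanish, so the
  -- full series is evaluated at each class by truncating at its own degree.
  let P : ℕ → CompletedHall k I := fun N => ∑ n ∈ Finset.range (N + 1), g ^ n
  let G : CompletedHall k I := fun c => P c.dim.degree c
  have hG : ∀ (X : QuiverRep k I) (N : ℕ), X.dim.degree ≤ N →
      G (IsoClass.mk X) = P N (IsoClass.mk X) := by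
    intro X N hN
    simp only [G, P, sum_apply]
    refine Finset.sum_subset (Finset.range_subset_range.2 (by exact Nat.succ_le_succ hN))
      fun n _ hn => ?_
    refine pow_apply_eq_zero hg0 n X ?_
    have : ¬ n < X.dim.degree + 1 := fun h => hn (Finset.mem_range.2 h)
    omega
  have h1 : f * G = 1 := by
    ext X
    have : (f * G) (IsoClass.mk X) = (f * P X.dim.degree) (IsoClass.mk X) := by
      rw [mul_apply, mul_apply]
      exact Finset.sum_congr rfl fun U _ => by rw [hG _ _ U.degree_le]
    rw [this, hfg, mul_neg_geom_sum, sub_apply, pow_apply_eq_zero hg0 _ X (Nat.lt_succ_self _),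
      sub_zero]
  have h2 : G * f = 1 := by
    ext X
    have : (G * f) (IsoClass.mk X) = (P X.dim.degree * f) (IsoClass.mk X) := by
      rw [mul_apply, mul_apply]
      exact Finset.sum_congr rfl fun U _ => by rw [hG _ _ U.degree_quotient_le]
    rw [this, hfg, geom_sum_mul_neg, sub_apply, pow_apply_eq_zero hg0 _ X (Nat.lt_succ_self _),
      sub_zero]
  exact ⟨⟨f, G, h1, h2⟩, rfl⟩

/-- The sum of all classes of objects which are semistable with respect to `φ`. -/
def semiSum (k : Type u) [Field k] (φ : (I →₀ ℕ) →+ ℚ) : CompletedHall k I := by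
  classical
  exact fun c => if ∃ M : QuiverRep k I, IsoClass.mk M = c ∧ SemiFor φ M then 1 else 0

variable {φ : (I →₀ ℕ) →+ ℚ}

theorem semiSum_apply (X : QuiverRep k I) [Decidable (SemiFor φ X)] :
    semiSum k φ (IsoClass.mk X) = if SemiFor φ X then 1 else 0 := by
  have : (∃ M : QuiverRep k I, IsoClass.mk M = IsoClass.mk X ∧ SemiFor φ M) ↔ SemiFor φ X :=
    ⟨fun ⟨M, h, hM⟩ => hM.of_iso (IsoClass.mk_eq.1 h).some, fun h => ⟨X, rfl, h⟩⟩
  classical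
  exact if_congr this rfl rfl

theorem isUnit_semiSum : IsUnit (semiSum k φ : CompletedHall k I) := by
  classical
  refine isUnit_of_apply_zero fun X hX => ?_
  rw [semiSum_apply, if_pos (SemiFor.of_isZero hX)]

/-- The inverse of the sum of all semistable classes. -/
def semiInv (k : Type u) [Field k] [Finite k] (φ : (I →₀ ℕ) →+ ℚ) : CompletedHall k I :=
  Ring.inverse (semiSum k φ)

theorem semiSum_mul_semiInv : semiSum k φ * semiInv k φ = 1 :=
  Ring.mul_inverse_cancel _ isUnit_semiSum

/-- The inverse, cut off to the semistable classes, is still a right inverse: if an object and its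
quotient are semistable then so is the subobject, and if the object is not semistable then sub and
quotient cannot both be. Uniqueness of inverses then shows that cutting off changed nothing. -/
theorem semiInv_of_not_semi {X : QuiverRep k I} (hX : ¬ SemiFor φ X) :
    semiInv k φ (IsoClass.mk X) = 0 := by
  classical
  let h' : CompletedHall k I := fun c => semiSum k φ c * semiInv k φ c
  have h1 : semiSum k φ * h' = 1 := by
    ext Y
    rw [mul_apply]
    by_cases hY : SemiFor φ Y
    · rw [← semiSum_mul_semiInv (φ := φ), mul_apply]
      refine Finset.sum_congr rfl fun U _ => ?_
      simp only [h', semiSum_apply]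
      by_cases hU : SemiFor φ U.quotient
      · have : φ U.toRep.dim = 0 := by
          have := phi_add_quotient (φ := φ) U
          linarith [hU.1, hY.1]
        rw [if_pos (hY.sub this), one_mul]
      · rw [if_neg hU, zero_mul, zero_mul]
    · rw [one_apply_of_not_isZero fun h => hY (SemiFor.of_isZero h)]
      refine Finset.sum_eq_zero fun U _ => ?_
      simp only [h', semiSum_apply]
      by_cases hU : SemiFor φ U.quotient
      · rw [if_neg fun h => hY (SemiFor.ext h hU), zero_mul, mul_zero]
      · rw [if_neg hU, zero_mul]
  have h2 : h' = semiInv k φ := by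
    rw [← one_mul h', ← Ring.inverse_mul_cancel _ (isUnit_semiSum (k := k) (φ := φ)), mul_assoc, h1,
      mul_one]
    rfl
  rw [← h2]
  simp only [h', semiSum_apply, if_neg hX, zero_mul]

open Classical in
-- This is the coefficient of e·e⁻¹ = 1 at X: the quotient by U is semistable exactly if φ(U) = 0.
-- It is the defining relation of a Möbius function on the sublattice.
theorem sum_semiInv_sub {X : QuiverRep k I} (hX : SemiFor φ X)
    (h0 : ¬ X.IsZero) :
    ∑ U : Sub X with φ U.toRep.dim = 0, semiInv k φ (IsoClass.mk U.toRep) = 0 := by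
  have h := congrFun (semiSum_mul_semiInv (k := k) (φ := φ)) (IsoClass.mk X)
  rw [one_apply_of_not_isZero h0, mul_apply] at h
  refine Eq.trans ?_ h
  rw [Finset.sum_filter]
  refine Finset.sum_congr rfl fun U _ => ?_
  rw [semiSum_apply]
  have : SemiFor φ U.quotient ↔ φ U.toRep.dim = 0 := by
    refine ⟨fun hU => ?_, fun hU => hX.quotient hU⟩
    have := phi_add_quotient (φ := φ) U
    linarith [hU.1, hX.1]
  simp only [this, ite_mul, one_mul, zero_mul]

open Classical in
theorem sum_semiInv_le {X : QuiverRep k I} (hX : SemiFor φ X) {W : Sub X}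
    (hW : φ W.toRep.dim = 0) (h0 : W ≠ ⊥) :
    ∑ U : Sub X with φ U.toRep.dim = 0 ∧ U ≤ W, semiInv k φ (IsoClass.mk U.toRep) = 0 := by
  refine Eq.trans ?_ (sum_semiInv_sub (hX.sub hW) fun h => h0 (W.toRep_isZero_iff.1 h))
  refine Finset.sum_bij' (fun U _ => W.restr U) (fun T _ => W.incl T) ?_ ?_ ?_ ?_ ?_
  · intro U hU
    rw [Finset.mem_filter] at hU ⊢
    refine ⟨Finset.mem_univ _, ?_⟩
    rw [← W.dim_incl, W.incl_restr U (Sub.le_iff.1 hU.2.2), hU.2.1]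
  · intro T hT
    rw [Finset.mem_filter] at hT ⊢
    refine ⟨Finset.mem_univ _, ?_, W.incl_le T⟩
    rw [W.dim_incl, hT.2]
  · intro U hU
    exact W.incl_restr U (Sub.le_iff.1 (Finset.mem_filter.1 hU).2.2)
  · intro T _
    exact W.restr_incl T
  · intro U hU
    have h := IsoClass.mk_eq.2 (W.incl_toRep (W.restr U))
    rw [W.incl_restr U (Sub.le_iff.1 (Finset.mem_filter.1 hU).2.2)] at h
    rw [h]

open Classical in
/-- Weisner's theorem for the lattice of semistable subobjects. -/
theorem sum_semiInv_sup_eq {X : QuiverRep k I} (hX : SemiFor φ X) {A : Sub X} (hA : A ≠ ⊥)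
    (hφA : φ A.toRep.dim = 0) (Y : Sub X) (hAY : A ≤ Y) (hY : φ Y.toRep.dim = 0) :
    ∑ U : Sub X with φ U.toRep.dim = 0 ∧ U ⊔ A = Y, semiInv k φ (IsoClass.mk U.toRep) = 0 := by
  induction Y using WellFoundedLT.induction with
  | ind Y ih =>
  have h1 := sum_semiInv_le hX hY fun h => hA (le_bot_iff.1 (h ▸ hAY))
  -- The sum over all U below Y is sorted by the join Z = U ⊔ A. The fibres with Z < Y vanish by
  -- induction, which leaves the fibre over Y.
  rw [← Finset.sum_fiberwise_of_maps_to
    (t := Finset.univ.filter fun Z : Sub X => φ Z.toRep.dim = 0 ∧ A ≤ Z ∧ Z ≤ Y)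
    (g := fun U : Sub X => U ⊔ A)] at h1
  · rw [Finset.sum_eq_single Y] at h1
    · refine Eq.trans ?_ h1
      rw [Finset.filter_filter]
      refine Finset.sum_congr (Finset.filter_congr fun U _ => ?_) fun _ _ => rfl
      exact ⟨fun h => ⟨⟨h.1, h.2 ▸ le_sup_left⟩, h.2⟩, fun h => ⟨h.1.1, h.2⟩⟩
    · intro Z hZ hZY
      rw [Finset.mem_filter] at hZ
      refine Eq.trans ?_ (ih Z (lt_of_le_of_ne hZ.2.2.2 hZY) hZ.2.2.1 hZ.2.1)
      rw [Finset.filter_filter]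
      refine Finset.sum_congr (Finset.filter_congr fun U _ => ?_) fun _ _ => rfl
      exact ⟨fun h => ⟨h.1.1, h.2⟩,
        fun h => ⟨⟨h.1, (le_sup_left.trans h.2.le).trans hZ.2.2.2⟩, h.2⟩⟩
    · intro h
      exact absurd (Finset.mem_filter.2 ⟨Finset.mem_univ _, hY, hAY, le_rfl⟩) h
  · intro U hU
    rw [Finset.mem_filter] at hU ⊢
    exact ⟨Finset.mem_univ _, hX.phi_sup hU.2.1 hφA, le_sup_right, sup_le hU.2.2 hAY⟩

theorem _root_.QuiverRep.Sub.isCompl_bijective {X : QuiverRep k I} {U A : Sub X} (h : IsCompl U A)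
    (i : I) : Function.Bijective ((A.mkHom.comp U.inclHom).1 i) := by
  have hi := Sub.isCompl_space h i
  constructor
  · rw [← LinearMap.ker_eq_bot, LinearMap.ker_eq_bot']
    intro x hx
    have h1 : U.subtype i x ∈ A.space i := (A.mkQ_eq_zero i _).1 hx
    have h2 : U.subtype i x ∈ U.space i := x.2
    exact Subtype.ext (Submodule.disjoint_def.1 hi.disjoint _ h2 h1)
  · intro y
    obtain ⟨x, rfl⟩ := A.mkQ_surjective i y
    obtain ⟨a, ha, b, hb, hab⟩ := Submodule.mem_sup.1
      (hi.sup_eq_top ▸ Submodule.mem_top : x ∈ U.space i ⊔ A.space i)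
    refine ⟨⟨a, ha⟩, ?_⟩
    rw [← hab, map_add, (A.mkQ_eq_zero i b).2 hb, add_zero]
    rfl

/-- A complement is isomorphic to the quotient. -/
def _root_.QuiverRep.Sub.isoOfIsCompl {X : QuiverRep k I} {U A : Sub X} (h : IsCompl U A) :
    Iso U.toRep A.quotient := Iso.ofBijective (A.mkHom.comp U.inclHom) (Sub.isCompl_bijective h)

/-- Weisner's sum over U ⊔ A = ⊤. As A is an atom, such a U either contains A, and then is
everything, or is a complement of A and hence isomorphic to X/A. -/
theorem semiInv_eq_of_stable_sub {X : QuiverRep k I} (hX : SemiFor φ X) {A : Sub X}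
    (hA : StableFor φ A.toRep) :
    semiInv k φ (IsoClass.mk X) =
      - (Nat.card {U : Sub X // IsCompl U A} : ℚ) * semiInv k φ (IsoClass.mk A.quotient) := by
  classical
  have hA0 : A ≠ ⊥ := fun h => hA.1 (A.toRep_isZero_iff.2 h)
  have h1 := sum_semiInv_sup_eq hX hA0 hA.2.1 ⊤ le_top (by rw [Sub.dim_top, hX.1])
  have h2 : (Finset.univ.filter fun U : Sub X => φ U.toRep.dim = 0 ∧ U ⊔ A = ⊤) =
      insert ⊤ (Finset.univ.filter fun U : Sub X => IsCompl U A) := by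
    ext U
    simp only [Finset.mem_filter, Finset.mem_insert, Finset.mem_univ, true_and]
    constructor
    · rintro ⟨hU, hUA⟩
      rcases hA.le_or_disjoint hX hU with h | h
      · left
        rwa [sup_eq_left.2 h] at hUA
      · right
        exact IsCompl.of_eq (inf_comm A U ▸ h) hUA
    · rintro (rfl | h)
      · exact ⟨by rw [Sub.dim_top, hX.1], by simp⟩
      · refine ⟨?_, h.sup_eq_top⟩
        have := phi_sup_add_inf (φ := φ) U A
        rw [h.sup_eq_top, h.inf_eq_bot, Sub.dim_top, Sub.dim_bot, map_zero, hX.1, hA.2.1] at this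
        linarith
  have h3 : IsoClass.mk (⊤ : Sub X).toRep = IsoClass.mk X :=
    (IsoClass.mk_eq.2 (Sub.whole_toRep X)).symm
  rw [h2, Finset.sum_insert, h3] at h1
  · rw [Nat.card_eq_fintype_card, Fintype.card_subtype, neg_mul, ← nsmul_eq_mul,
      ← Finset.sum_const]
    rw [Finset.sum_congr rfl fun U hU =>
      congrArg (semiInv k φ) (IsoClass.mk_eq.2 ⟨Sub.isoOfIsCompl (Finset.mem_filter.1 hU).2⟩)] at h1
    exact eq_neg_of_add_eq_zero_left h1
  · simp only [Finset.mem_filter, Finset.mem_univ, true_and]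
    intro h
    exact hA0 (by simpa using h.inf_eq_bot)

end CompletedHall

end

/-! ### Isomorphisms from a direct sum, and the recursion for the integral. -/

noncomputable section


namespace IsoClass

open QuiverRep

variable {k : Type u} [Field k] {I : Type w} [Quiver.{v} I]

theorem dim_mk [Finite I] (M : QuiverRep k I) : (mk M).dim = M.dim := rfl

theorem cardAut_mk (M : QuiverRep k I) : (mk M).cardAut = Nat.card (Iso M M) := rfl

/-- Adding a direct summand. -/
def prod (S : QuiverRep k I) (c : IsoClass k I) : IsoClass k I :=
  Quotient.lift (s := isoSetoid k I) (fun Y : QuiverRep k I => mk (S.prod Y))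
    (fun _ _ ⟨e⟩ => mk_eq.2 ⟨Iso.prod (Iso.refl S) e⟩) c

/-- The number of homomorphisms from a fixed representation. -/
def homCard (S : QuiverRep k I) (c : IsoClass k I) : ℕ :=
  Quotient.lift (s := isoSetoid k I) (fun Y : QuiverRep k I => Nat.card (Hom S Y))
    (fun _ _ ⟨e⟩ => Nat.card_congr (homCongrRight S e)) c

theorem homCard_mk (S Y : QuiverRep k I) : homCard S (mk Y) = Nat.card (Hom S Y) := rfl

theorem homCard_prod (T S : QuiverRep k I) (c : IsoClass k I) :
    homCard T (prod S c) = Nat.card (Hom T S) * homCard T c := by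
  induction c using Quotient.inductionOn with
  | h Y => exact (Nat.card_congr (homProdEquiv S Y T)).trans (Nat.card_prod _ _)

theorem dim_prod [Finite I] (S : QuiverRep k I) (c : IsoClass k I) :
    (prod S c).dim = S.dim + c.dim := by
  induction c using Quotient.inductionOn with
  | h Y => exact QuiverRep.dim_prod S Y

theorem cardAut_ne_zero [Finite k] [Finite I] (c : IsoClass k I) : (c.cardAut : ℚ) ≠ 0 := by
  induction c using Quotient.inductionOn with
  | h Y => exact Nat.cast_ne_zero.2 (card_aut_pos Y).ne'

theorem card_iso (M N : QuiverRep k I) [Decidable (mk M = mk N)] :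
    Nat.card (Iso M N) = if mk M = mk N then (mk M).cardAut else 0 := by
  split_ifs with h
  · obtain ⟨e⟩ := mk_eq.1 h
    exact Nat.card_congr
      { toFun := fun f => f.trans e.symm
        invFun := fun f => f.trans e
        left_inv := fun f => Iso.ext' fun i x => by simp
        right_inv := fun f => Iso.ext' fun i x => by simp }
  · have : IsEmpty (Iso M N) := ⟨fun e => h (mk_eq.2 ⟨e⟩)⟩
    exact Nat.card_of_isEmpty

end IsoClass

namespace CompletedHall

open QuiverRep

variable {k : Type u} [Field k] {I : Type w} [Quiver.{v} I] [Finite k] [Finite I]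
variable {φ : (I →₀ ℕ) →+ ℚ}

theorem _root_.QuiverRep.SemiFor.prod {S Y : QuiverRep k I} (hS : SemiFor φ S)
    (hY : SemiFor φ Y) : SemiFor φ (S.prod Y) := by
  have h1 : (inl S Y).ker = ⊥ := (inl S Y).ker_eq_bot_iff.2 fun i => LinearMap.inl_injective
  refine SemiFor.ext (U := (inl S Y).range) (hS.of_iso ((inl S Y).range_iso h1).some) ?_
  refine hY.of_iso (Iso.symm (class_quotient_eq (snd S Y).1 (fun h x => (snd S Y).comm h x)
    (fun i => Prod.snd_surjective) _ fun i x => ?_).some)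
  rw [Hom.mem_range, snd_apply]
  exact ⟨fun h => ⟨x.1, Prod.ext rfl h.symm⟩, fun ⟨y, hy⟩ => hy ▸ rfl⟩

variable {S X Y : QuiverRep k I}

/-- An isomorphism from a direct sum extending a given injection amounts to a complement of the
image together with an isomorphism from the other summand to the quotient. -/
def isoProdToPair (f : Hom S X) (e : {e : Iso (S.prod Y) X // e.toHom.comp (inl S Y) = f}) :
    Sub X × Hom Y f.range.quotient :=
  ((e.1.toHom.comp (inr S Y)).range, f.range.mkHom.comp (e.1.toHom.comp (inr S Y)))

theorem iso_prod_apply (f : Hom S X) (e : {e : Iso (S.prod Y) X // e.toHom.comp (inl S Y) = f})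
    (i : I) (x : (S.prod Y).V i) :
    e.1.equiv i x = f.1 i x.1 + (e.1.toHom.comp (inr S Y)).1 i x.2 := by
  obtain ⟨e, rfl⟩ := e
  refine Eq.trans (congrArg (e.equiv i) ?_) (map_add (e.equiv i) (x.1, 0) (0, x.2))
  exact Prod.ext (add_zero _).symm (zero_add _).symm

theorem isCompl_isoProdToPair (f : Hom S X)
    (e : {e : Iso (S.prod Y) X // e.toHom.comp (inl S Y) = f}) :
    IsCompl (isoProdToPair f e).1 f.range := by
  constructor
  · rw [disjoint_iff]
    refine Sub.ext (funext fun i => (Submodule.eq_bot_iff _).2 ?_)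
    rintro _ ⟨⟨y, rfl⟩, ⟨s, hs⟩⟩
    have h1 := iso_prod_apply f e i (s, -y)
    rw [map_neg, hs, add_neg_cancel] at h1
    have h2 := (e.1.equiv i).map_eq_zero_iff.1 h1
    have h3 : y = 0 := neg_eq_zero.1 (congrArg Prod.snd h2)
    rw [h3, map_zero]
  · rw [codisjoint_iff]
    refine Sub.ext (funext fun i => (Submodule.eq_top_iff').2 fun x => ?_)
    obtain ⟨p, rfl⟩ := (e.1.equiv i).surjective x
    rw [iso_prod_apply f e]
    exact add_mem (Submodule.mem_sup_right ⟨_, rfl⟩) (Submodule.mem_sup_left ⟨_, rfl⟩)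

theorem isoProdToPair_bijective (f : Hom S X)
    (e : {e : Iso (S.prod Y) X // e.toHom.comp (inl S Y) = f}) (i : I) :
    Function.Bijective ((isoProdToPair f e).2.1 i) := by
  constructor
  · rw [← LinearMap.ker_eq_bot, LinearMap.ker_eq_bot']
    intro y hy
    obtain ⟨s, hs⟩ := (f.range.mkQ_eq_zero i _).1 hy
    have h1 := iso_prod_apply f e i (s, -y)
    rw [map_neg, hs, add_neg_cancel] at h1
    exact neg_eq_zero.1 (congrArg Prod.snd ((e.1.equiv i).map_eq_zero_iff.1 h1))
  · intro q
    obtain ⟨x, rfl⟩ := f.range.mkQ_surjective i q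
    obtain ⟨p, rfl⟩ := (e.1.equiv i).surjective x
    refine ⟨p.2, ?_⟩
    rw [iso_prod_apply f e, map_add, (f.range.mkQ_eq_zero i _).2 ⟨_, rfl⟩, zero_add]
    rfl

def isoProdPair (f : Hom S X) (e : {e : Iso (S.prod Y) X // e.toHom.comp (inl S Y) = f}) :
    {U : Sub X // IsCompl U f.range} × Iso Y f.range.quotient :=
  (⟨(isoProdToPair f e).1, isCompl_isoProdToPair f e⟩,
    Iso.ofBijective (isoProdToPair f e).2 (isoProdToPair_bijective f e))

theorem isoProdPair_injective (f : Hom S X) :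
    Function.Injective (isoProdPair (Y := Y) f) := by
  intro e e' h
  have h1 : (isoProdToPair f e).1 = (isoProdToPair f e').1 :=
    congrArg Subtype.val (congrArg Prod.fst h)
  have h2 := congrArg Prod.snd h
  have hc := isCompl_isoProdToPair f e
  refine Subtype.ext (Iso.ext' fun i x => ?_)
  rw [iso_prod_apply f e, iso_prod_apply f e']
  congr 1
  have h3 : f.range.mkQ i ((e.1.toHom.comp (inr S Y)).1 i x.2) =
      f.range.mkQ i ((e'.1.toHom.comp (inr S Y)).1 i x.2) :=
    congrArg (fun g : Iso Y f.range.quotient => g.equiv i x.2) h2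
  rw [← sub_eq_zero, ← map_sub, Sub.mkQ_eq_zero] at h3
  have h4 : (e.1.toHom.comp (inr S Y)).1 i x.2 ∈ (isoProdToPair f e).1.space i := ⟨_, rfl⟩
  have h5 : (e'.1.toHom.comp (inr S Y)).1 i x.2 ∈ (isoProdToPair f e).1.space i := h1 ▸ ⟨_, rfl⟩
  exact sub_eq_zero.1 (Submodule.disjoint_def.1 (Sub.isCompl_space hc i).disjoint _
    (sub_mem h4 h5) h3)

/-- A complement U projects isomorphically to the quotient by the image of f, so ψ embeds Y as U,
and f together with this embedding is the required isomorphism. -/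
theorem isoProdPair_surjective (f : Hom S X) (hf : f.ker = ⊥) :
    Function.Surjective (isoProdPair (Y := Y) f) := by
  rintro ⟨⟨U, hU⟩, ψ⟩
  let p : Iso U.toRep f.range.quotient := Sub.isoOfIsCompl hU
  let j : Hom Y X := U.inclHom.comp (ψ.trans p.symm).toHom
  have hj : ∀ i y, f.range.mkQ i (j.1 i y) = ψ.equiv i y := fun i y =>
    (p.equiv i).apply_symm_apply (ψ.equiv i y)
  have hjU : j.range = U := by
    refine Sub.ext (funext fun i => le_antisymm ?_ fun x hx => ?_)
    · rintro _ ⟨y, rfl⟩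
      exact ((ψ.trans p.symm).equiv i y).2
    · obtain ⟨y, hy⟩ := ((ψ.trans p.symm).equiv i).surjective ⟨x, hx⟩
      exact ⟨y, congrArg Subtype.val hy⟩
  have hb : ∀ i, Function.Bijective ((f.coprod j).1 i) := by
    intro i
    constructor
    · rw [← LinearMap.ker_eq_bot, LinearMap.ker_eq_bot']
      intro x hx
      rw [Hom.coprod_apply] at hx
      have h1 := congrArg (f.range.mkQ i) hx
      rw [map_add, (f.range.mkQ_eq_zero i _).2 ⟨_, rfl⟩, zero_add, map_zero, hj] at h1
      have h2 := (ψ.equiv i).map_eq_zero_iff.1 h1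
      rw [h2, map_zero, add_zero] at hx
      exact Prod.ext (f.ker_eq_bot_iff.1 hf i (hx.trans (map_zero _).symm)) h2
    · intro x
      obtain ⟨y, hy⟩ := (ψ.equiv i).surjective (f.range.mkQ i x)
      have h1 : x - j.1 i y ∈ f.range.space i := by
        rw [← Sub.mkQ_eq_zero, map_sub, hj, hy, sub_self]
      obtain ⟨s, hs⟩ := h1
      refine ⟨(s, y), (Hom.coprod_apply f j i (s, y)).trans ?_⟩
      change f.1 i s + j.1 i y = x
      rw [hs, sub_add_cancel]
  have he : (Iso.ofBijective _ hb).toHom.comp (inl S Y) = f := Hom.ext' fun i x => by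
    rw [Hom.comp_apply, Iso.toHom_apply, Iso.ofBijective_apply, Hom.coprod_apply, inl_apply,
      map_zero, add_zero]
  have hr : (Iso.ofBijective _ hb).toHom.comp (inr S Y) = j := Hom.ext' fun i x => by
    rw [Hom.comp_apply, Iso.toHom_apply, Iso.ofBijective_apply, Hom.coprod_apply, inr_apply,
      map_zero, zero_add]
  refine ⟨⟨Iso.ofBijective _ hb, he⟩, Prod.ext (Subtype.ext ?_) (Iso.ext' fun i y => ?_)⟩
  · exact (congrArg Hom.range hr).trans hjU
  · refine Eq.trans ?_ (hj i y)
    exact congrArg (fun g : Hom Y X => f.range.mkQ i (g.1 i y)) hr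

theorem card_iso_prod_fiber (f : Hom S X) (hf : f.ker = ⊥) :
    Nat.card {e : Iso (S.prod Y) X // e.toHom.comp (inl S Y) = f} =
      Nat.card {U : Sub X // IsCompl U f.range} * Nat.card (Iso Y f.range.quotient) := by
  rw [← Nat.card_prod]
  exact Nat.card_congr (Equiv.ofBijective _ ⟨isoProdPair_injective f, isoProdPair_surjective f hf⟩)

/-- Isomorphisms are sorted by their restriction f to S. The restriction cannot be zero because S is
nonzero, and a nonzero f is injective by Schur's lemma. -/
theorem card_iso_prod [Fintype (Hom S X)] [DecidableEq (Hom S X)] (hS : StableFor φ S)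
    (hX : SemiFor φ X) :
    Nat.card (Iso (S.prod Y) X) = ∑ f : Hom S X with f ≠ 0,
      Nat.card {U : Sub X // IsCompl U f.range} * Nat.card (Iso Y f.range.quotient) := by
  rw [Nat.card_congr (Equiv.sigmaFiberEquiv
    fun e : Iso (S.prod Y) X => e.toHom.comp (inl S Y)).symm, Nat.card_sigma, Finset.sum_filter]
  refine Finset.sum_congr rfl fun f _ => ?_
  split_ifs with hf
  · exact card_iso_prod_fiber f (hS.ker_eq_bot hX hf)
  · have : IsEmpty {e : Iso (S.prod Y) X // e.toHom.comp (inl S Y) = f} := by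
      refine ⟨fun ⟨e, he⟩ => ?_⟩
      obtain ⟨i, x, hx⟩ := (not_isZero_iff S).1 hS.1
      have h1 : e.equiv i (x, 0) = 0 := by
        rw [not_not.1 hf] at he
        exact congrArg (fun g : Hom S X => g.1 i x) he
      exact hx (congrArg Prod.fst ((e.equiv i).map_eq_zero_iff.1 h1))
    exact Nat.card_of_isEmpty

open Classical in
-- For each of the #Hom(S,X) - 1 nonzero f the recursion reads -c(X) = #{complements of
-- f(S)}·c(X/f(S)). Summed over f, the right side counts isomorphisms S ⊕ Y ≅ X, weighted by
-- c(Y)/#Aut Y, and there are #Aut X of them for each suitable Y. The finite set P only has to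
-- contain all such Y.
theorem homCard_sub_one_mul_semiInv (hS : StableFor φ S) (X : QuiverRep k I)
    (P : Finset (IsoClass k I)) (hP : ∀ c, IsoClass.prod S c = IsoClass.mk X → c ∈ P) :
    ((IsoClass.homCard S (IsoClass.mk X) : ℚ) - 1) * semiInv k φ (IsoClass.mk X) =
      - ((IsoClass.mk X).cardAut : ℚ) * ∑ c ∈ P with IsoClass.prod S c = IsoClass.mk X,
        semiInv k φ c / (c.cardAut : ℚ) := by
  by_cases hX : SemiFor φ X
  swap
  · rw [semiInv_of_not_semi hX, mul_zero, Finset.sum_eq_zero, mul_zero]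
    intro c hc
    induction c using Quotient.inductionOn with
    | h Y =>
      have h1 := (Finset.mem_filter.1 hc).2
      have h2 : ¬ SemiFor φ Y := fun hY =>
        hX ((hS.semi.prod hY).of_iso (IsoClass.mk_eq.1 h1).some)
      have h3 : semiInv k φ (⟦Y⟧ : IsoClass k I) = 0 := semiInv_of_not_semi h2
      rw [h3, zero_div]
  have : Fintype (Hom S X) := Fintype.ofFinite _
  have hrange : ∀ f : Hom S X, f ≠ 0 → StableFor φ f.range.toRep := fun f hf =>
    hS.of_iso (f.range_iso (hS.ker_eq_bot hX hf)).some
  have key : ∀ c ∈ P, (if IsoClass.prod S c = IsoClass.mk X then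
      ((IsoClass.mk X).cardAut : ℚ) * (semiInv k φ c / (c.cardAut : ℚ)) else 0) =
      ∑ f : Hom S X with f ≠ 0, if c = IsoClass.mk f.range.quotient then
        (Nat.card {U : Sub X // IsCompl U f.range} : ℚ) * semiInv k φ c else 0 := by
    intro c _
    induction c using Quotient.inductionOn with
    | h Y =>
      have h1 := IsoClass.card_iso (S.prod Y) X
      rw [card_iso_prod hS hX] at h1
      have h2 : ((if IsoClass.mk (S.prod Y) = IsoClass.mk X then
          ((IsoClass.mk X).cardAut : ℚ) else 0)) = ∑ f : Hom S X with f ≠ 0,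
          (Nat.card {U : Sub X // IsCompl U f.range} : ℚ) *
            (if IsoClass.mk Y = IsoClass.mk f.range.quotient then ((IsoClass.mk Y).cardAut : ℚ)
              else 0) := by
        have h3 : (if IsoClass.mk (S.prod Y) = IsoClass.mk X then
          (IsoClass.mk X).cardAut else 0) = if IsoClass.mk (S.prod Y) = IsoClass.mk X then
          (IsoClass.mk (S.prod Y)).cardAut else 0 := by
          split_ifs with h
          · rw [h]
          · rfl
        have h4 := congrArg (Nat.cast : ℕ → ℚ) (h3.trans h1.symm)
        push_cast at h4
        rw [h4]
        refine Finset.sum_congr rfl fun f _ => ?_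
        rw [IsoClass.card_iso]
        push_cast
        rfl
      have h5 := congrArg (fun t : ℚ => t * (semiInv k φ (IsoClass.mk Y) /
        ((IsoClass.mk Y).cardAut : ℚ))) h2
      simp only [ite_mul, zero_mul, Finset.sum_mul] at h5
      refine h5.trans (Finset.sum_congr rfl fun f _ => ?_)
      change _ = if IsoClass.mk Y = _ then _ * semiInv k φ (IsoClass.mk Y) else 0
      split_ifs with h
      · have := IsoClass.cardAut_ne_zero (IsoClass.mk Y)
        field_simp
      · rw [mul_zero, zero_mul]
  rw [Finset.sum_filter, neg_mul, Finset.mul_sum]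
  simp only [mul_ite, mul_zero]
  rw [Finset.sum_congr rfl key, Finset.sum_comm]
  have key2 : ∀ f ∈ Finset.univ.filter (fun f : Hom S X => f ≠ 0),
      (∑ c ∈ P, if c = IsoClass.mk f.range.quotient then
        (Nat.card {U : Sub X // IsCompl U f.range} : ℚ) * semiInv k φ c else 0) =
      - semiInv k φ (IsoClass.mk X) := by
    intro f hf
    have hf := (Finset.mem_filter.1 hf).2
    rw [Finset.sum_ite_eq', semiInv_eq_of_stable_sub hX (hrange f hf), neg_mul, neg_neg]
    split_ifs with h
    · rfl
    -- If X/f(S) is not in P, then f(S) has no complement, since a complement would give S ⊕ X/f(S)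
    -- ≅ X. The term is then zero on its own.
    · have h1 : IsEmpty {U : Sub X // IsCompl U f.range} := by
        refine ⟨fun U => h (hP _ ?_)⟩
        obtain ⟨e, -⟩ := isoProdPair_surjective (Y := f.range.quotient) f (hS.ker_eq_bot hX hf)
          (U, Iso.refl _)
        exact IsoClass.mk_eq.2 ⟨e.1⟩
      rw [Nat.card_of_isEmpty, Nat.cast_zero, zero_mul]
  rw [Finset.sum_congr rfl key2, Finset.sum_const, IsoClass.homCard_mk, Nat.card_eq_fintype_card,
    Finset.filter_ne' , Finset.card_erase_of_mem (Finset.mem_univ _), Finset.card_univ,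
    nsmul_eq_mul, Nat.cast_sub Fintype.card_pos]
  push_cast
  ring

variable [∀ i j : I, Finite (i ⟶ j)]

open Classical in
theorem coeff_hallIntegral (f : CompletedHall k I) (α : I →₀ ℕ) :
    MvPowerSeries.coeff α (hallIntegral f) =
      ∑ c ∈ (IsoClass.finite_dim_eq (k := k) α).toFinset, f c / (c.cardAut : ℚ) :=
  finsum_mem_eq_finite_toFinset_sum _ (IsoClass.finite_dim_eq α)

open Classical in
-- After division by #Aut, summing the pointwise identity over the classes of dimension α reaches
-- every class d of dimension α - dim S exactly once, through S ⊕ d. The extra weight w is what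
-- later restricts attention to a fixed multiplicity of S.
theorem hallIntegral_weight_mul (S : QuiverRep k I) (g w v : IsoClass k I → ℚ)
    (hg : ∀ (c : IsoClass k I) (P : Finset (IsoClass k I)),
      (∀ d, IsoClass.prod S d = c → d ∈ P) → v c * g c =
        - (c.cardAut : ℚ) * ∑ d ∈ P with IsoClass.prod S d = c, g d / (d.cardAut : ℚ)) :
    hallIntegral (fun c => w c * v c * g c) =
      - (MvPowerSeries.monomial S.dim (1 : ℚ) *
        hallIntegral (fun c => w (IsoClass.prod S c) * g c)) := by
  ext α
  rw [map_neg, MvPowerSeries.coeff_monomial_mul, one_mul]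
  refine (coeff_hallIntegral _ α).trans ?_
  let P : Finset (IsoClass k I) :=
    if S.dim ≤ α then (IsoClass.finite_dim_eq (k := k) (α - S.dim)).toFinset else ∅
  have hP : ∀ c, c ∈ P ↔ (IsoClass.prod S c).dim = α := by
    intro c
    rw [IsoClass.dim_prod]
    by_cases h : S.dim ≤ α
    · simp only [P, if_pos h, Set.Finite.mem_toFinset, Set.mem_ofPred_eq]
      exact ⟨fun h1 => by rw [h1, add_tsub_cancel_of_le h], fun h1 => by
        rw [← h1, add_tsub_cancel_left]⟩
    · simp only [P, if_neg h, Finset.notMem_empty, false_iff]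
      exact fun h1 => h (h1 ▸ le_self_add)
  have h1 : ∀ c ∈ (IsoClass.finite_dim_eq (k := k) α).toFinset,
      w c * v c * g c / (c.cardAut : ℚ) =
        - ∑ d ∈ P with IsoClass.prod S d = c,
          w (IsoClass.prod S d) * g d / (d.cardAut : ℚ) := by
    intro c hc
    have hc' : c.dim = α := by simpa using hc
    have h2 := hg c P fun d hd => (hP d).2 (hd ▸ hc')
    have h3 := IsoClass.cardAut_ne_zero c
    have h4 : ∑ d ∈ P with IsoClass.prod S d = c,
        w (IsoClass.prod S d) * g d / (d.cardAut : ℚ) =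
        w c * ∑ d ∈ P with IsoClass.prod S d = c, g d / (d.cardAut : ℚ) := by
      rw [Finset.mul_sum]
      refine Finset.sum_congr rfl fun d hd => ?_
      rw [(Finset.mem_filter.1 hd).2, mul_div_assoc]
    rw [mul_assoc, h2, h4]
    field_simp
  refine (Finset.sum_congr rfl h1).trans ?_
  have h5 := Finset.sum_fiberwise_of_maps_to (s := P)
    (t := (IsoClass.finite_dim_eq (k := k) α).toFinset) (g := IsoClass.prod S)
    (fun d hd => by simpa using (hP d).1 hd)
    (fun d => w (IsoClass.prod S d) * g d / (d.cardAut : ℚ))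
  rw [Finset.sum_neg_distrib]
  refine congrArg Neg.neg (h5.trans ?_)
  by_cases h : S.dim ≤ α
  · rw [if_pos h]
    simp only [P, if_pos h]
    exact (coeff_hallIntegral _ _).symm
  · simp only [P, if_neg h, Finset.sum_empty]

theorem hallIntegral_homCard_sub_one (hS : StableFor φ S) (w : IsoClass k I → ℚ) :
    hallIntegral (fun c => w c * ((IsoClass.homCard S c : ℚ) - 1) * semiInv k φ c) =
      - (MvPowerSeries.monomial S.dim (1 : ℚ) *
        hallIntegral (fun c => w (IsoClass.prod S c) * semiInv k φ c)) := by
  refine hallIntegral_weight_mul S (semiInv k φ) w _ fun c P hP => ?_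
  induction c using Quotient.inductionOn with
  | h X => exact homCard_sub_one_mul_semiInv hS X P hP

end CompletedHall

end

/-! ### Logarithms of power series in several variables by way of the Euler operator. -/

noncomputable section

namespace MvPowerSeries

variable {σ : Type*} {F : Type*} [Field F]

/-- The Euler operator, multiplying a monomial by its degree. -/
def euler (f : MvPowerSeries σ F) : MvPowerSeries σ F := fun α => (α.degree : F) * coeff α f

theorem coeff_euler (f : MvPowerSeries σ F) (α : σ →₀ ℕ) :
    coeff α (euler f) = (α.degree : F) * coeff α f := rfl

theorem euler_add (f g : MvPowerSeries σ F) : euler (f + g) = euler f + euler g := by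
  ext α
  simp only [coeff_euler, map_add, mul_add]

theorem euler_zero : euler (0 : MvPowerSeries σ F) = 0 := by
  ext α
  simp only [coeff_euler, map_zero, mul_zero]

theorem euler_one : euler (1 : MvPowerSeries σ F) = 0 := by
  classical
  ext α
  rw [coeff_euler, coeff_one]
  split_ifs with h <;> simp [h]

theorem euler_mul (f g : MvPowerSeries σ F) : euler (f * g) = euler f * g + f * euler g := by
  classical
  ext α
  rw [coeff_euler, map_add, coeff_mul, coeff_mul, coeff_mul, Finset.mul_sum,
    ← Finset.sum_add_distrib]
  refine Finset.sum_congr rfl fun p hp => ?_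
  rw [← Finset.HasAntidiagonal.mem_antidiagonal.1 hp, map_add, coeff_euler, coeff_euler]
  push_cast
  ring

theorem euler_pow_succ (f : MvPowerSeries σ F) (n : ℕ) :
    euler (f ^ (n + 1)) = ((n : F) + 1) • (euler f * f ^ n) := by
  induction n with
  | zero => simp
  | succ n ih =>
    rw [pow_succ, euler_mul, ih, Nat.cast_succ, add_smul ((n : F) + 1), one_smul, smul_mul_assoc]
    ring_nf

theorem coeff_pow_eq_zero {a : MvPowerSeries σ F} (ha : constantCoeff a = 0) {α : σ →₀ ℕ} {n : ℕ}
    (h : α.degree < n) : coeff α (a ^ n) = 0 :=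
  coeff_of_lt_order ((Nat.cast_lt.2 h).trans_le (le_order_pow_of_constantCoeff_eq_zero n ha))

theorem coeff_subst_eq_sum {a : MvPowerSeries σ F} (ha : constantCoeff a = 0) (f : PowerSeries F)
    {α : σ →₀ ℕ} {N : ℕ} (h : α.degree < N) :
    coeff α (f.subst a) = ∑ n ∈ Finset.range N, PowerSeries.coeff n f * coeff α (a ^ n) := by
  rw [PowerSeries.coeff_subst (PowerSeries.HasSubst.of_constantCoeff_zero ha)]
  refine finsum_eq_finsetSum_of_support_subset _ fun n hn => ?_
  rw [Finset.mem_coe, Finset.mem_range]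
  by_contra hN
  exact hn (by
    change _ • _ = _
    rw [coeff_pow_eq_zero ha (h.trans_le (not_lt.1 hN)), smul_zero])

theorem coeff_subst_mul_eq_sum {a : MvPowerSeries σ F} (ha : constantCoeff a = 0)
    (f : PowerSeries F) (g : MvPowerSeries σ F) {α : σ →₀ ℕ} {N : ℕ} (h : α.degree < N) :
    coeff α (f.subst a * g) =
      ∑ n ∈ Finset.range N, PowerSeries.coeff n f * coeff α (a ^ n * g) := by
  classical
  simp only [coeff_mul, Finset.mul_sum]
  rw [Finset.sum_comm]
  refine Finset.sum_congr rfl fun p hp => ?_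
  rw [coeff_subst_eq_sum ha f (N := N), Finset.sum_mul]
  · exact Finset.sum_congr rfl fun n _ => by ring
  · have := congrArg Finsupp.degree (Finset.HasAntidiagonal.mem_antidiagonal.1 hp)
    rw [map_add] at this
    omega

/-- The chain rule. At a given exponent only finitely many powers of a contribute, so it reduces to
the rule for powers. -/
theorem euler_subst {a : MvPowerSeries σ F} (ha : constantCoeff a = 0) (f : PowerSeries F) :
    euler (f.subst a) = (PowerSeries.derivative F f).subst a * euler a := by
  ext α
  rw [coeff_euler, coeff_subst_eq_sum ha f (Nat.lt_add_of_pos_right Nat.two_pos),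
    coeff_subst_mul_eq_sum ha _ _ (Nat.lt_succ_self _), Finset.mul_sum, Finset.sum_range_succ']
  have h0 : (α.degree : F) * (PowerSeries.coeff 0 f * coeff α (a ^ 0)) = 0 := by
    rw [mul_left_comm, ← coeff_euler, pow_zero, euler_one, map_zero, mul_zero]
  rw [h0, add_zero]
  refine Finset.sum_congr rfl fun n _ => ?_
  rw [mul_left_comm, ← coeff_euler, euler_pow_succ, PowerSeries.coeff_derivative, coeff_smul,
    mul_comm (euler a)]
  ring

/-- `G` is the exponential of `L`, up to the constant coefficient of `L`. -/
structure IsLog (L G : MvPowerSeries σ F) : Prop where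
  coeff_zero : coeff 0 G = 1
  euler_eq : euler G = euler L * G

namespace IsLog

theorem one : IsLog (0 : MvPowerSeries σ F) 1 :=
  ⟨coeff_zero_one, by rw [euler_one, euler_zero, zero_mul]⟩

theorem mul {L L' G G' : MvPowerSeries σ F} (h : IsLog L G) (h' : IsLog L' G') :
    IsLog (L + L') (G * G') := by
  classical
  refine ⟨?_, ?_⟩
  · have h1 := h.coeff_zero
    have h2 := h'.coeff_zero
    rw [coeff_zero_eq_constantCoeff_apply] at *
    rw [map_mul, h1, h2, one_mul]
  · rw [euler_mul, h.euler_eq, h'.euler_eq, euler_add]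
    ring

theorem prod {ι : Type*} (s : Finset ι) {L G : ι → MvPowerSeries σ F}
    (h : ∀ i ∈ s, IsLog (L i) (G i)) : IsLog (∑ i ∈ s, L i) (∏ i ∈ s, G i) := by
  classical
  induction s using Finset.induction_on with
  | empty => exact one
  | insert a s ha ih =>
    rw [Finset.sum_insert ha, Finset.prod_insert ha]
    exact (h a (Finset.mem_insert_self _ _)).mul
      (ih fun i hi => h i (Finset.mem_insert_of_mem hi))

open scoped Classical in
theorem degree_mul_coeff {L G : MvPowerSeries σ F} (h : IsLog L G) (α : σ →₀ ℕ) :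
    (α.degree : F) * coeff α G =
      ∑ p ∈ Finset.HasAntidiagonal.antidiagonal α,
        (p.1.degree : F) * coeff p.1 L * coeff p.2 G := by
  rw [← coeff_euler, h.euler_eq, coeff_mul]
  rfl

variable [CharZero F]

/-- In the coefficient at α of the Euler relation, L at α is multiplied by the constant term 1 of G,
and everything else involves smaller exponents, where the two sides agree. Existence of the
logarithm plays no role; both uniqueness statements below come from here. -/
theorem coeff_sub_coeff {L L' G G' : MvPowerSeries σ F} (h : IsLog L G) (h' : IsLog L' G')
    {α : σ →₀ ℕ} (hα : α ≠ 0) (hL : ∀ β < α, β ≠ 0 → coeff β L = coeff β L')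
    (hG : ∀ β < α, coeff β G = coeff β G') :
    coeff α G - coeff α G' = coeff α L - coeff α L' := by
  classical
  have hd : (α.degree : F) ≠ 0 := by
    rwa [Nat.cast_ne_zero, Ne, Finsupp.degree_eq_zero_iff]
  refine mul_left_cancel₀ hd ?_
  rw [mul_sub, h.degree_mul_coeff, h'.degree_mul_coeff, ← Finset.sum_sub_distrib,
    Finset.sum_eq_single (α, 0)]
  · rw [h.coeff_zero, h'.coeff_zero]
    ring
  · rintro ⟨β, γ⟩ hp hne
    rw [Finset.HasAntidiagonal.mem_antidiagonal] at hp
    have hγ : γ ≠ 0 := by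
      rintro rfl
      exact hne (Prod.ext ((add_zero _).symm.trans hp) rfl)
    have hβ : β < α := by
      rw [← hp]
      exact lt_add_of_pos_right _ (pos_iff_ne_zero.2 hγ)
    by_cases hβ0 : β = 0
    -- The constant term of a logarithm is killed by the degree factor, so nothing is assumed about
    -- it.
    · simp [hβ0]
    · have hγ' : γ < α := by
        rw [← hp]
        exact lt_add_of_pos_left _ (pos_iff_ne_zero.2 hβ0)
      rw [hL β hβ hβ0, hG γ hγ', sub_self]
  · intro hn
    exact absurd (Finset.HasAntidiagonal.mem_antidiagonal.2 (add_zero α)) hn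

theorem degree_lt_of_lt {β α : σ →₀ ℕ} (h : β < α) : β.degree < α.degree := by
  obtain ⟨γ, rfl⟩ := exists_add_of_le h.le
  have : γ ≠ 0 := by
    rintro rfl
    simp at h
  rw [map_add]
  have := (Finsupp.degree_eq_zero_iff γ).not.2 this
  omega

theorem coeff_eq {L L' G G' : MvPowerSeries σ F} (h : IsLog L G) (h' : IsLog L' G')
    {α : σ →₀ ℕ} (hL : ∀ β ≤ α, β ≠ 0 → coeff β L = coeff β L') : coeff α G = coeff α G' := by
  induction hn : α.degree using Nat.strong_induction_on generalizing α with
  | h n ih =>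
  by_cases hα : α = 0
  · rw [hα, h.coeff_zero, h'.coeff_zero]
  have h1 := h.coeff_sub_coeff h' hα (fun β hβ => hL β hβ.le) fun β hβ =>
    ih β.degree (hn ▸ degree_lt_of_lt hβ) (fun γ hγ => hL γ (hγ.trans hβ.le)) rfl
  rw [hL α le_rfl hα, sub_self, sub_eq_zero] at h1
  exact h1

theorem eq_of {L L' G : MvPowerSeries σ F} (h : IsLog L G) (h' : IsLog L' G) {α : σ →₀ ℕ}
    (hα : α ≠ 0) : coeff α L = coeff α L' := by
  induction hn : α.degree using Nat.strong_induction_on generalizing α with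
  | h n ih =>
  have h1 := h.coeff_sub_coeff h' hα (fun β hβ hβ0 => ih β.degree (hn ▸ degree_lt_of_lt hβ) hβ0 rfl)
    fun β _ => rfl
  rw [sub_self] at h1
  exact sub_eq_zero.1 h1.symm

end IsLog

theorem isLog_exp [CharZero F] [Algebra ℚ F] {f : MvPowerSeries σ F} (hf : constantCoeff f = 0) :
    IsLog f ((PowerSeries.exp F).subst f) := by
  refine ⟨?_, ?_⟩
  · rw [coeff_subst_eq_sum hf _ (N := 1) (by simp)]
    simp
  · rw [euler_subst hf, PowerSeries.derivative_exp, mul_comm]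

/-- Substitution of a monomial. -/
theorem isLog_subst_monomial {β : σ →₀ ℕ} (hβ : β ≠ 0) {e l : PowerSeries F}
    (he : PowerSeries.coeff 0 e = 1)
    (hel : PowerSeries.derivative F e = PowerSeries.derivative F l * e) :
    IsLog (l.subst (monomial β (1 : F))) (e.subst (monomial β (1 : F))) := by
  classical
  have ha : constantCoeff (monomial β (1 : F)) = 0 := by
    rw [← coeff_zero_eq_constantCoeff_apply, coeff_monomial, if_neg hβ.symm]
  refine ⟨?_, ?_⟩
  · rw [coeff_subst_eq_sum ha _ (N := 1) (by simp)]
    simp [he]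
  · rw [euler_subst ha, euler_subst ha, hel,
      PowerSeries.subst_mul (PowerSeries.HasSubst.of_constantCoeff_zero ha)]
    ring

theorem constantCoeff_monomial_eq_zero {β : σ →₀ ℕ} (hβ : β ≠ 0) (c : F) :
    constantCoeff (monomial β c) = 0 := by
  classical
  rw [← coeff_zero_eq_constantCoeff_apply, coeff_monomial, if_neg hβ.symm]

open scoped Classical in
theorem coeff_subst_monomial {β : σ →₀ ℕ} (hβ : β ≠ 0) (f : PowerSeries F) {α : σ →₀ ℕ} {N : ℕ}
    (h : α.degree < N) : coeff α (f.subst (monomial β (1 : F))) =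
      ∑ n ∈ Finset.range N, if n • β = α then PowerSeries.coeff n f else 0 := by
  rw [coeff_subst_eq_sum (constantCoeff_monomial_eq_zero hβ 1) f h]
  refine Finset.sum_congr rfl fun n _ => ?_
  rw [monomial_pow, one_pow, coeff_monomial]
  simp only [eq_comm, mul_ite, mul_one, mul_zero]

end MvPowerSeries

/-! ### The q-exponential and its logarithm. -/

section QExponential

open PowerSeries

variable {F : Type*} [Field F]

/-- The series `∑ tⁿ / ((1 - Q) ⋯ (1 - Qⁿ))`. -/
def qExp (Q : F) : PowerSeries F :=
  PowerSeries.mk fun n => ∏ i ∈ Finset.range n, (1 - Q ^ (i + 1))⁻¹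

/-- The logarithm `∑ tᵐ / (m (1 - Qᵐ))` of `qExp`. -/
def qLog (Q : F) : PowerSeries F := PowerSeries.mk fun m => (m : F)⁻¹ * (1 - Q ^ m)⁻¹

theorem coeff_qExp_succ (Q : F) (n : ℕ) :
    coeff (n + 1) (qExp Q) = coeff n (qExp Q) * (1 - Q ^ (n + 1))⁻¹ := by
  simp only [qExp, coeff_mk, Finset.prod_range_succ]

/-- The functional equation e(Qt) = (1 - t)e(t) is the recursion (1 - Qⁿ)eₙ = eₙ₋₁ of the
coefficients. -/
theorem rescale_qExp {Q : F} (hQ : ∀ n ≠ 0, Q ^ n ≠ 1) :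
    rescale Q (qExp Q) = (1 - X) * qExp Q := by
  ext n
  rw [coeff_rescale, sub_mul, one_mul, map_sub]
  cases n with
  | zero => simp
  | succ n =>
    have h : 1 - Q ^ (n + 1) ≠ 0 := sub_ne_zero.2 (hQ _ n.succ_ne_zero).symm
    rw [coeff_succ_X_mul, coeff_qExp_succ]
    field_simp
    ring

theorem coeff_X_mul_derivative (f : PowerSeries F) (n : ℕ) :
    coeff n (X * derivative F f) = n * coeff n f := by
  cases n with
  | zero => simp
  | succ n =>
    rw [coeff_succ_X_mul, coeff_derivative]
    push_cast
    ring

theorem rescale_X_mul_derivative (Q : F) (f : PowerSeries F) :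
    rescale Q (X * derivative F f) = X * derivative F (rescale Q f) := by
  ext n
  rw [coeff_rescale, coeff_X_mul_derivative, coeff_X_mul_derivative, coeff_rescale]
  ring

theorem rescale_qLog [CharZero F] {Q : F} (hQ : ∀ n ≠ 0, Q ^ n ≠ 1) :
    rescale Q (X * derivative F (qLog Q)) * (1 - X) =
      X * derivative F (qLog Q) * (1 - X) - X := by
  have h : rescale Q (X * derivative F (qLog Q)) =
      X * derivative F (qLog Q) - X * (PowerSeries.mk 1 : PowerSeries F) := by
    ext n
    rw [coeff_rescale, map_sub, coeff_X_mul_derivative]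
    cases n with
    | zero => simp
    | succ n =>
      have h : 1 - Q ^ (n + 1) ≠ 0 := sub_ne_zero.2 (hQ _ n.succ_ne_zero).symm
      have h' : ((n + 1 : ℕ) : F) ≠ 0 := Nat.cast_ne_zero.2 n.succ_ne_zero
      rw [coeff_succ_X_mul, coeff_mk, qLog, coeff_mk, Pi.one_apply]
      field_simp
      ring
  rw [h, sub_mul, mul_assoc X (PowerSeries.mk 1), PowerSeries.mk_one_mul_one_sub_eq_one, mul_one]

/-- The defect D = t·e' - t·l'·e inherits the functional equation D(Qt) = (1 - t)D(t) and has no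
constant term. Comparing coefficients gives (Qⁿ - 1)Dₙ = -Dₙ₋₁, so D = 0 because Q is not a root of
unity. -/
theorem derivative_qExp [CharZero F] {Q : F} (hQ : ∀ n ≠ 0, Q ^ n ≠ 1) :
    derivative F (qExp Q) = derivative F (qLog Q) * qExp Q := by
  obtain ⟨D, hD⟩ : ∃ D, D = X * derivative F (qExp Q) - X * derivative F (qLog Q) * qExp Q :=
    ⟨_, rfl⟩
  have h1 : rescale Q D = (1 - X) * D := by
    rw [hD, map_sub, rescale_X_mul_derivative, map_mul _ (_ * _), rescale_qExp hQ,
      Derivation.leibniz, ← mul_assoc, rescale_qLog hQ, map_sub, Derivation.map_one_eq_zero,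
      derivative_X]
    simp only [smul_eq_mul]
    ring
  have h2 : D = 0 := by
    ext n
    rw [map_zero]
    induction n with
    | zero => simp [hD]
    | succ n ih =>
      have h3 := congrArg (coeff (n + 1)) h1
      rw [coeff_rescale, sub_mul, one_mul, map_sub, coeff_succ_X_mul, ih, sub_zero] at h3
      have h4 : (Q ^ (n + 1) - 1) * coeff (n + 1) D = 0 := by
        rw [sub_mul, h3, one_mul, sub_self]
      exact (mul_eq_zero.1 h4).resolve_left (sub_ne_zero.2 (hQ _ n.succ_ne_zero))
  refine mul_left_cancel₀ (X_ne_zero (R := F)) ?_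
  rw [← mul_assoc]
  exact sub_eq_zero.1 (hD ▸ h2)

theorem isLog_qExp [CharZero F] {σ : Type*} {Q : F} (hQ : ∀ n ≠ 0, Q ^ n ≠ 1) {β : σ →₀ ℕ}
    (hβ : β ≠ 0) : MvPowerSeries.IsLog ((qLog Q).subst (MvPowerSeries.monomial β (1 : F)))
      ((qExp Q).subst (MvPowerSeries.monomial β (1 : F))) :=
  MvPowerSeries.isLog_subst_monomial hβ (by simp [qExp]) (derivative_qExp hQ)

end QExponential

end

/-! ### The integral of the inverse as a product over the stable classes. -/

noncomputable section


namespace IsoClass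

open QuiverRep

variable {k : Type u} [Field k] {I : Type w} [Quiver.{v} I]

/-- A representation in the given class. -/
def rep (c : IsoClass k I) : QuiverRep k I := Quotient.out (s := isoSetoid k I) c

@[simp] theorem mk_rep (c : IsoClass k I) : mk c.rep = c := Quotient.out_eq (s := isoSetoid k I) c

theorem dim_rep [Finite I] (c : IsoClass k I) : c.rep.dim = c.dim := by
  rw [← dim_mk, mk_rep]

theorem homCard_congr_left {S T : QuiverRep k I} (e : Iso S T) (c : IsoClass k I) :
    homCard S c = homCard T c := by
  induction c using Quotient.inductionOn with
  | h X => exact Nat.card_congr (homCongrLeft X e)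

end IsoClass

namespace CompletedHall

open QuiverRep

variable {k : Type u} [Field k] {I : Type w} [Quiver.{v} I] [Finite k] [Finite I]
variable {φ : (I →₀ ℕ) →+ ℚ} {S X Y : QuiverRep k I}

theorem card_hom_eq_one_iff : Nat.card (Hom S X) = 1 ↔ ∀ f : Hom S X, f = 0 := by
  rw [Nat.card_eq_one_iff_unique]
  exact ⟨fun h f => h.1.elim _ _, fun h => ⟨⟨fun f g => (h f).trans (h g).symm⟩, ⟨0⟩⟩⟩

theorem one_lt_card_hom_self (hS : StableFor φ S) : 1 < Nat.card (Hom S S) := by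
  obtain ⟨i, x, hx⟩ := (not_isZero_iff S).1 hS.1
  have : Nontrivial (Hom S S) := ⟨Hom.id S, 0, (Hom.ne_zero_iff _).2 ⟨i, x, hx⟩⟩
  exact Finite.one_lt_card

theorem iso_of_hom_ne_zero (hS : StableFor φ S) (hX : StableFor φ X) {f : Hom S X} (hf : f ≠ 0) :
    Nonempty (Iso S X) := ⟨Iso.ofBijective f (hS.bijective hX hf)⟩

/-- A nonzero value of the recursion forces the image of f to have at least one complement, and
forces the quotient to have a nonzero coefficient again. -/
theorem exists_iso_prod_of_semiInv_ne_zero (hS : StableFor φ S)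
    (hX : semiInv k φ (IsoClass.mk X) ≠ 0) {f : Hom S X} (hf : f ≠ 0) :
    ∃ Y : QuiverRep k I, Nonempty (Iso (S.prod Y) X) ∧ semiInv k φ (IsoClass.mk Y) ≠ 0 := by
  have hs : SemiFor φ X := by
    by_contra h
    exact hX (semiInv_of_not_semi h)
  have hker := hS.ker_eq_bot hs hf
  rw [semiInv_eq_of_stable_sub hs (hS.of_iso (f.range_iso hker).some)] at hX
  refine ⟨f.range.quotient, ?_, right_ne_zero_of_mul hX⟩
  have h1 : Nat.card {U : Sub X // IsCompl U f.range} ≠ 0 := fun h => by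
    rw [h] at hX
    simp at hX
  obtain ⟨U⟩ : Nonempty {U : Sub X // IsCompl U f.range} := by
    by_contra h
    rw [not_nonempty_iff] at h
    exact h1 Nat.card_of_isEmpty
  obtain ⟨e, -⟩ := isoProdPair_surjective (Y := f.range.quotient) f hker (U, Iso.refl _)
  exact ⟨e.1⟩

/-- As long as there is a nonzero map from S, a copy of S splits off and multiplies the number of
homomorphisms by #End S. The exponent is the multiplicity of S, bounded by the degree. -/
theorem exists_homCard_eq_pow (hS : StableFor φ S) (c : IsoClass k I)
    (hc : semiInv k φ c ≠ 0) :
    ∃ n ≤ c.dim.degree, IsoClass.homCard S c = Nat.card (Hom S S) ^ n := by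
  induction hn : c.dim.degree using Nat.strong_induction_on generalizing c with
  | h n ih =>
  induction c using Quotient.inductionOn with
  | h X =>
  by_cases h : ∀ f : Hom S X, f = 0
  · refine ⟨0, Nat.zero_le _, ?_⟩
    rw [pow_zero]
    exact card_hom_eq_one_iff.2 h
  push Not at h
  obtain ⟨f, hf⟩ := h
  obtain ⟨Y, ⟨e⟩, hY⟩ := exists_iso_prod_of_semiInv_ne_zero hS hc hf
  have h1 : (⟦X⟧ : IsoClass k I) = IsoClass.prod S (IsoClass.mk Y) := (IsoClass.mk_eq.2 ⟨e⟩).symm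
  have h2 : S.dim.degree ≠ 0 := by
    rw [Ne, Finsupp.degree_eq_zero_iff, ← isZero_iff_dim]
    exact hS.1
  rw [h1, IsoClass.dim_prod, map_add] at hn
  obtain ⟨m, hm, hm'⟩ := ih _ (by omega) (IsoClass.mk Y) hY rfl
  refine ⟨m + 1, by omega, ?_⟩
  rw [h1, IsoClass.homCard_prod, hm', pow_succ']

variable [∀ i j : I, Finite (i ⟶ j)]

open Classical in
/-- The contribution to the integral of the inverse of all classes without homomorphisms from the
given representations. -/
def partInv (k : Type u) [Field k] [Finite k] (φ : (I →₀ ℕ) →+ ℚ)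
    (T : Finset (IsoClass k I)) : MvPowerSeries I ℚ :=
  hallIntegral fun c : IsoClass k I =>
    (if ∀ t ∈ T, IsoClass.homCard t.rep c = 1 then (1 : ℚ) else 0) * semiInv k φ c

theorem pow_natCast_ne_one {Q : ℕ} (hQ : 1 < Q) (n : ℕ) (hn : n ≠ 0) : (Q : ℚ) ^ n ≠ 1 := by
  have : 1 < Q ^ n := Nat.one_lt_pow hn hQ
  exact_mod_cast this.ne'

open Classical in
-- Let J n be the part in which S has multiplicity n. The weighted identity gives (Qⁿ⁺¹ - 1)·J(n+1)
-- = -x^(dim S)·J n, so J n is the n-th term of the q-exponential at x^(dim S) times J 0, and J 0 is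
-- the part without S. The conditions for T do not notice an added S, as there are no nonzero maps
-- between non-isomorphic stables.
theorem partInv_eq (T : Finset (IsoClass k I)) (hT : ∀ t ∈ T, StableFor φ t.rep)
    {s : IsoClass k I} (hs : StableFor φ s.rep) (hsT : s ∉ T) :
    partInv k φ T = (qExp (Nat.card (Hom s.rep s.rep) : ℚ)).subst
      (MvPowerSeries.monomial s.dim (1 : ℚ)) * partInv k φ (insert s T) := by
  set S := s.rep with hS
  set Q := Nat.card (Hom S S) with hQ
  have hQ1 : 1 < Q := one_lt_card_hom_self hs
  let w : ℕ → IsoClass k I → ℚ := fun n c =>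
    if (∀ t ∈ T, IsoClass.homCard t.rep c = 1) ∧ IsoClass.homCard S c = Q ^ n then 1 else 0
  let J : ℕ → MvPowerSeries I ℚ := fun n => hallIntegral fun c => w n c * semiInv k φ c
  have hw : ∀ n c, w (n + 1) (IsoClass.prod S c) = w n c := by
    intro n c
    have h1 : ∀ t ∈ T, IsoClass.homCard t.rep (IsoClass.prod S c) = IsoClass.homCard t.rep c := by
      intro t ht
      rw [IsoClass.homCard_prod]
      have : Nat.card (Hom t.rep S) = 1 := by
        refine card_hom_eq_one_iff.2 fun f => ?_
        by_contra hf
        have h2 := IsoClass.mk_eq.2 (iso_of_hom_ne_zero (hT t ht) hs hf)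
        rw [IsoClass.mk_rep, hS, IsoClass.mk_rep] at h2
        exact hsT (h2 ▸ ht)
      rw [this, one_mul]
    have h2 : IsoClass.homCard S (IsoClass.prod S c) = Q ^ (n + 1) ↔
        IsoClass.homCard S c = Q ^ n := by
      rw [IsoClass.homCard_prod, pow_succ']
      exact Nat.mul_right_inj (by omega)
    simp only [w]
    refine if_congr (and_congr (forall₂_congr fun t ht => ?_) h2) rfl rfl
    rw [h1 t ht]
  have hJ : ∀ n, J (n + 1) =
      (1 - (Q : ℚ) ^ (n + 1))⁻¹ • (MvPowerSeries.monomial s.dim (1 : ℚ) * J n) := by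
    intro n
    have h1 := hallIntegral_homCard_sub_one hs (w (n + 1))
    simp only [hw] at h1
    have h2 : (hallIntegral fun c => w (n + 1) c * ((IsoClass.homCard S c : ℚ) - 1) *
        semiInv k φ c) = ((Q : ℚ) ^ (n + 1) - 1) • J (n + 1) := by
      ext α
      rw [MvPowerSeries.coeff_smul]
      refine (coeff_hallIntegral _ _).trans (Eq.trans ?_
        (congrArg (((Q : ℚ) ^ (n + 1) - 1) * ·) (coeff_hallIntegral _ _).symm))
      rw [Finset.mul_sum]
      refine Finset.sum_congr rfl fun c _ => ?_
      by_cases hc : (∀ t ∈ T, IsoClass.homCard t.rep c = 1) ∧ IsoClass.homCard S c = Q ^ (n + 1)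
      · simp only [w, if_pos hc]
        rw [hc.2]
        push_cast
        ring
      · simp only [w, if_neg hc]
        ring
    have h3 : (1 - (Q : ℚ) ^ (n + 1)) ≠ 0 :=
      sub_ne_zero.2 (pow_natCast_ne_one hQ1 _ n.succ_ne_zero).symm
    have h4 : (1 - (Q : ℚ) ^ (n + 1)) • J (n + 1) = MvPowerSeries.monomial s.dim (1 : ℚ) * J n := by
      rw [← neg_sub, neg_smul, ← h2]
      refine (congrArg Neg.neg h1).trans ?_
      rw [neg_neg, ← IsoClass.dim_rep]
    rw [← h4, inv_smul_smul₀ h3]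
  have hJ' : ∀ n, J n = PowerSeries.coeff n (qExp (Q : ℚ)) •
      (MvPowerSeries.monomial s.dim (1 : ℚ) ^ n * J 0) := by
    intro n
    induction n with
    | zero => simp [qExp]
    | succ n ih =>
      rw [hJ, ih, coeff_qExp_succ, mul_smul_comm, smul_smul, ← mul_assoc, ← pow_succ',
        mul_comm (_⁻¹)]
  have hJ0 : J 0 = partInv k φ (insert s T) := by
    simp only [J, partInv, w]
    congr 1
    funext c
    congr 1
    refine if_congr ?_ rfl rfl
    rw [Finset.forall_mem_insert, pow_zero, and_comm]
  have hdim : s.dim ≠ 0 := by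
    rw [← IsoClass.dim_rep, Ne, ← isZero_iff_dim]
    exact hs.1
  ext α
  rw [MvPowerSeries.coeff_subst_mul_eq_sum
    (MvPowerSeries.constantCoeff_monomial_eq_zero hdim 1) _ _ (Nat.lt_succ_self _)]
  have h1 : ∀ n ∈ Finset.range (α.degree + 1), PowerSeries.coeff n (qExp (Q : ℚ)) *
      MvPowerSeries.coeff α (MvPowerSeries.monomial s.dim (1 : ℚ) ^ n * partInv k φ (insert s T)) =
      ∑ c ∈ (IsoClass.finite_dim_eq (k := k) α).toFinset,
        w n c * semiInv k φ c / (c.cardAut : ℚ) := by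
    intro n _
    refine Eq.trans ?_ ((congrArg (MvPowerSeries.coeff α) (hJ' n)).symm.trans
      (coeff_hallIntegral _ _))
    rw [hJ0, MvPowerSeries.coeff_smul]
  rw [Finset.sum_congr rfl h1, Finset.sum_comm]
  refine (coeff_hallIntegral _ _).trans (Finset.sum_congr rfl fun c hc => ?_)
  rw [← Finset.sum_div, ← Finset.sum_mul]
  congr 1
  -- Only where the coefficient is nonzero is the number of homomorphisms known to be a power of Q;
  -- elsewhere both sides are zero anyway.
  by_cases h0 : semiInv k φ c = 0
  · exact (mul_eq_zero_of_right _ h0).trans (mul_eq_zero_of_right _ h0).symm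
  congr 1
  obtain ⟨m, hm, hm'⟩ := exists_homCard_eq_pow hs c h0
  have hcα : c.dim = α := by simpa using hc
  rw [Finset.sum_eq_single m]
  · simp only [w]
    exact if_congr (by rw [hm']; simp [hQ]) rfl rfl
  · intro n _ hn
    refine if_neg fun h => hn ?_
    rw [h.2, ← hQ] at hm'
    exact Nat.pow_right_injective hQ1 hm'
  · intro h
    rw [Finset.mem_range, ← hcα] at h
    omega

theorem stable_degree_finite (N : ℕ) :
    {c : IsoClass k I | StableFor φ c.rep ∧ c.dim.degree ≤ N}.Finite := by
  refine ((Finsupp.finite_of_degree_le (σ := I) N).biUnion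
    fun α _ => IsoClass.finite_dim_eq (k := k) α).subset fun c hc => ?_
  simp only [Set.mem_iUnion]
  exact ⟨c.dim, hc.2, rfl⟩

/-- The stable classes of bounded degree. -/
def stableClasses (k : Type u) [Field k] [Finite k] (φ : (I →₀ ℕ) →+ ℚ) (N : ℕ) :
    Finset (IsoClass k I) := (stable_degree_finite (k := k) (φ := φ) N).toFinset

theorem mem_stableClasses {N : ℕ} {c : IsoClass k I} :
    c ∈ stableClasses k φ N ↔ StableFor φ c.rep ∧ c.dim.degree ≤ N := by
  simp [stableClasses]

theorem dim_ne_zero_of_stable {c : IsoClass k I} (hc : StableFor φ c.rep) : c.dim ≠ 0 := by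
  rw [← IsoClass.dim_rep, Ne, ← isZero_iff_dim]
  exact hc.1

theorem hallIntegral_semiInv_eq_prod (T : Finset (IsoClass k I))
    (hT : ∀ t ∈ T, StableFor φ t.rep) :
    hallIntegral (semiInv k φ) = (∏ t ∈ T, (qExp (Nat.card (Hom t.rep t.rep) : ℚ)).subst
      (MvPowerSeries.monomial t.dim (1 : ℚ))) * partInv k φ T := by
  classical
  induction T using Finset.induction_on with
  | empty =>
    rw [Finset.prod_empty, one_mul, partInv]
    congr 1
    funext c
    rw [if_pos (by simp)]
    exact (one_mul _).symm
  | insert s T hsT ih =>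
    rw [Finset.prod_insert hsT, ih fun t ht => hT t (Finset.mem_insert_of_mem ht),
      partInv_eq T (fun t ht => hT t (Finset.mem_insert_of_mem ht))
        (hT s (Finset.mem_insert_self _ _)) hsT]
    ring

theorem semiInv_of_isZero (hX : X.IsZero) : semiInv k φ (IsoClass.mk X) = 1 := by
  classical
  have h := congrFun (semiSum_mul_semiInv (k := k) (φ := φ)) (IsoClass.mk X)
  rw [one_apply_of_isZero hX, mul_apply, Finset.sum_eq_single ⊤] at h
  · have h1 : (⊤ : Sub X).quotient.IsZero := (Sub.quotient_isZero_iff _).2 rfl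
    have h2 : IsoClass.mk (⊤ : Sub X).toRep = IsoClass.mk X :=
      (IsoClass.mk_eq.2 (Sub.whole_toRep X)).symm
    rw [semiSum_apply, if_pos (SemiFor.of_isZero h1), one_mul, h2] at h
    exact h
  · intro U _ hU
    refine absurd (Sub.eq_of_le_of_dim le_top ?_) hU
    have h1 := (isZero_iff_dim X).1 hX
    have h2 : U.toRep.dim ≤ 0 := h1 ▸ U.dim_le
    rw [le_antisymm h2 zero_le, Sub.dim_top, h1]
  · simp

/-- A nonzero semistable object of degree at most N contains a stable one, again of degree at most
N, whose inclusion is a nonzero map that the weight forbids. After all stable factors up to degree N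
are split off, nothing but 1 is left in these degrees. -/
theorem coeff_partInv_stableClasses {N : ℕ} {α : I →₀ ℕ} (hα : α.degree ≤ N) (h0 : α ≠ 0) :
    MvPowerSeries.coeff α (partInv k φ (stableClasses k φ N)) = 0 := by
  classical
  refine (coeff_hallIntegral _ _).trans (Finset.sum_eq_zero fun c hc => ?_)
  have hcα : c.dim = α := by simpa using hc
  have : (if ∀ t ∈ stableClasses k φ N, IsoClass.homCard t.rep c = 1 then (1 : ℚ) else 0) *
      semiInv k φ c = 0 := by
    rw [mul_eq_zero]
    by_contra! h
    have h1 : ∀ t ∈ stableClasses k φ N, IsoClass.homCard t.rep c = 1 := by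
      by_contra h2
      exact h.1 (if_neg h2)
    obtain ⟨X, rfl⟩ : ∃ X, IsoClass.mk X = c := ⟨c.rep, c.mk_rep⟩
    have hX : SemiFor φ X := by
      by_contra h3
      exact h.2 (semiInv_of_not_semi h3)
    obtain ⟨A, hA⟩ := hX.exists_stable_sub fun h3 => h0 (hcα ▸ (isZero_iff_dim X).1 h3)
    obtain ⟨e⟩ : Nonempty (Iso (IsoClass.mk A.toRep).rep A.toRep) :=
      IsoClass.mk_eq.1 (IsoClass.mk_rep _)
    have h4 := h1 (IsoClass.mk A.toRep) (mem_stableClasses.2 ⟨hA.of_iso e.symm, by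
      rw [IsoClass.dim_mk] at hcα ⊢
      exact (A.degree_le).trans (hcα ▸ hα)⟩)
    rw [IsoClass.homCard_congr_left e, IsoClass.homCard_mk, card_hom_eq_one_iff] at h4
    obtain ⟨i, x, hx⟩ := (not_isZero_iff _).1 hA.1
    exact (Hom.ne_zero_iff _).2 ⟨i, x, fun h5 => hx (Subtype.ext h5)⟩ (h4 A.inclHom)
  exact (congrArg (· / (c.cardAut : ℚ)) this).trans (zero_div _)

/-- The logarithm of the integral of the inverse of the sum of all semistable classes. -/
def stableLog (k : Type u) [Field k] [Finite k] (φ : (I →₀ ℕ) →+ ℚ) : MvPowerSeries I ℚ :=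
  fun β => ∑ t ∈ stableClasses k φ β.degree, MvPowerSeries.coeff β
    ((qLog (Nat.card (Hom t.rep t.rep) : ℚ)).subst (MvPowerSeries.monomial t.dim (1 : ℚ)))

theorem coeff_sum_qLog {N : ℕ} {β : I →₀ ℕ} (h : β.degree ≤ N) (hβ : β ≠ 0) :
    MvPowerSeries.coeff β (∑ t ∈ stableClasses k φ N,
      (qLog (Nat.card (Hom t.rep t.rep) : ℚ)).subst (MvPowerSeries.monomial t.dim (1 : ℚ))) =
    MvPowerSeries.coeff β (stableLog k φ) := by
  classical
  rw [map_sum]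
  symm
  refine Finset.sum_subset (fun t ht => ?_) fun t ht ht' => ?_
  · rw [mem_stableClasses] at ht ⊢
    exact ⟨ht.1, ht.2.trans h⟩
  · rw [mem_stableClasses] at ht ht'
    rw [MvPowerSeries.coeff_subst_monomial (dim_ne_zero_of_stable ht.1) _ (Nat.lt_succ_self _)]
    refine Finset.sum_eq_zero fun n _ => if_neg ?_
    rintro rfl
    refine ht' ⟨ht.1, ?_⟩
    have : n ≠ 0 := by
      rintro rfl
      exact hβ (zero_smul _ _)
    rw [map_nsmul, smul_eq_mul]
    exact Nat.le_mul_of_pos_left _ (Nat.pos_of_ne_zero this)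

theorem coeff_partInv_zero (T : Finset (IsoClass k I)) (hT : ∀ t ∈ T, StableFor φ t.rep) :
    MvPowerSeries.coeff 0 (partInv k φ T) = MvPowerSeries.coeff 0 (hallIntegral (semiInv k φ)) := by
  classical
  have h1 := (MvPowerSeries.IsLog.prod T fun t ht => isLog_qExp (F := ℚ) (σ := I)
    (pow_natCast_ne_one (one_lt_card_hom_self (hT t ht)))
    (dim_ne_zero_of_stable (hT t ht))).coeff_zero
  rw [hallIntegral_semiInv_eq_prod T hT]
  simp only [MvPowerSeries.coeff_zero_eq_constantCoeff_apply] at h1 ⊢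
  rw [map_mul, h1, one_mul]

theorem coeff_zero_hallIntegral_semiInv :
    MvPowerSeries.coeff 0 (hallIntegral (semiInv k φ : CompletedHall k I)) = 1 := by
  classical
  let Z : QuiverRep k I := { V := fun _ => PUnit, map := fun _ => 0 }
  have hZ : Z.IsZero := fun i => (inferInstance : Subsingleton PUnit)
  have h1 : (IsoClass.finite_dim_eq (k := k) (0 : I →₀ ℕ)).toFinset = {IsoClass.mk Z} := by
    ext c
    obtain ⟨X, rfl⟩ : ∃ X, IsoClass.mk X = c := ⟨c.rep, c.mk_rep⟩
    simp only [Set.Finite.mem_toFinset, Set.mem_ofPred_eq, Finset.mem_singleton, IsoClass.dim_mk,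
      ← isZero_iff_dim]
    rw [IsoClass.mk_eq]
    constructor
    · intro hX
      refine ⟨Iso.ofBijective 0 fun i => ?_⟩
      have := hX i
      have := hZ i
      exact ⟨fun x y _ => Subsingleton.elim _ _, fun y => ⟨0, Subsingleton.elim _ _⟩⟩
    · rintro ⟨e⟩
      exact hZ.of_iso e.symm
  have h2 : Nat.card (Iso Z Z) = 1 := by
    rw [Nat.card_eq_one_iff_unique]
    exact ⟨⟨fun e f => Iso.ext' fun i x => Subsingleton.elim (α := PUnit) _ _⟩, ⟨Iso.refl _⟩⟩
  rw [coeff_hallIntegral, h1, Finset.sum_singleton, semiInv_of_isZero hZ, IsoClass.cardAut_mk, h2,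
    Nat.cast_one, div_one]

/-- Up to degree deg α the integral agrees with the finite product over stable classes of degree at
most deg α, and the Euler relation at α sees no more than that. -/
theorem isLog_stableLog :
    MvPowerSeries.IsLog (stableLog k φ) (hallIntegral (semiInv k φ : CompletedHall k I)) := by
  classical
  refine ⟨coeff_zero_hallIntegral_semiInv, ?_⟩
  ext α
  let T := stableClasses k φ α.degree
  have hT : ∀ t ∈ T, StableFor φ t.rep := fun t ht => (mem_stableClasses.1 ht).1
  have h1 := MvPowerSeries.IsLog.prod T fun t ht => isLog_qExp (F := ℚ) (σ := I)
    (pow_natCast_ne_one (one_lt_card_hom_self (hT t ht))) (dim_ne_zero_of_stable (hT t ht))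
  set L := ∑ t ∈ T, (qLog (Nat.card (Hom t.rep t.rep) : ℚ)).subst
    (MvPowerSeries.monomial t.dim (1 : ℚ))
  set G := ∏ t ∈ T, (qExp (Nat.card (Hom t.rep t.rep) : ℚ)).subst
    (MvPowerSeries.monomial t.dim (1 : ℚ)) with hG
  have h2 : ∀ β ≤ α, MvPowerSeries.coeff β (hallIntegral (semiInv k φ)) =
      MvPowerSeries.coeff β G := by
    intro β hβ
    rw [hallIntegral_semiInv_eq_prod T hT, ← hG, MvPowerSeries.coeff_mul,
      Finset.sum_eq_single (β, 0)]
    · rw [coeff_partInv_zero T hT, coeff_zero_hallIntegral_semiInv, mul_one]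
    · rintro ⟨γ, δ⟩ hp hne
      rw [Finset.HasAntidiagonal.mem_antidiagonal] at hp
      have hδ : δ ≠ 0 := by
        rintro rfl
        exact hne (Prod.ext ((add_zero _).symm.trans hp) rfl)
      refine mul_eq_zero_of_right _ (coeff_partInv_stableClasses ?_ hδ)
      exact Finsupp.degree_mono ((le_add_self.trans hp.le).trans hβ)
    · intro hn
      exact absurd (Finset.HasAntidiagonal.mem_antidiagonal.2 (add_zero β)) hn
  have h3 := h1.degree_mul_coeff α
  rw [MvPowerSeries.coeff_euler, h2 α le_rfl, MvPowerSeries.coeff_mul, h3]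
  refine Finset.sum_congr rfl fun p hp => ?_
  rw [Finset.HasAntidiagonal.mem_antidiagonal] at hp
  rw [MvPowerSeries.coeff_euler, h2 p.2 (hp ▸ le_add_self)]
  by_cases h0 : p.1 = 0
  · simp [h0]
  · rw [coeff_sum_qLog (Finsupp.degree_mono (hp ▸ le_self_add)) h0]

end CompletedHall

end

/-! ### Restriction and extension of scalars along a finite extension. -/

noncomputable section


namespace QuiverRep

variable {k : Type u} [Field k] {I : Type w} [Quiver.{v} I]
variable {K : Type u} [Field K] [Algebra k K] [FiniteDimensional k K]

/-- Restriction of scalars. -/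
def restrict (k : Type u) [Field k] {K : Type u} [Field K] [Algebra k K] [FiniteDimensional k K]
    (N : QuiverRep K I) : QuiverRep k I :=
  letI : ∀ i, Module k (N.V i) := fun i => Module.compHom (N.V i) (algebraMap k K)
  haveI : ∀ i, IsScalarTower k K (N.V i) := fun _ => IsScalarTower.of_algebraMap_smul fun _ _ => rfl
  { V := N.V
    addCommGroup := N.addCommGroup
    module := fun i => Module.compHom (N.V i) (algebraMap k K)
    finiteDimensional := fun i => Module.Finite.trans K (N.V i)
    map := fun h => (N.map h).restrictScalars k }

instance restrictModule (N : QuiverRep K I) (i : I) : Module K ((restrict k N).V i) := N.module i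

instance restrict_isScalarTower (N : QuiverRep K I) (i : I) :
    IsScalarTower k K ((restrict k N).V i) := IsScalarTower.of_algebraMap_smul fun _ _ => rfl

theorem restrict_smul (N : QuiverRep K I) (i : I) (c : k) (x : (restrict k N).V i) :
    c • x = algebraMap k K c • x := rfl

theorem restrict_map_smul (N : QuiverRep K I) {i j : I} (h : i ⟶ j) (c : K)
    (x : (restrict k N).V i) : (restrict k N).map h (c • x) = c • (restrict k N).map h x :=
  (N.map h).map_smul c x

theorem restrict_dim [Finite I] (N : QuiverRep K I) :
    (restrict k N).dim = Module.finrank k K • N.dim := by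
  ext i
  exact (Module.finrank_mul_finrank k K ((restrict k N).V i)).symm

/-- Multiplication by a scalar of the larger field. -/
def smulHom (k : Type u) [Field k] [Algebra k K] [FiniteDimensional k K] (N : QuiverRep K I)
    (c : K) : Hom (restrict k N) (restrict k N) :=
  ⟨fun _ =>
    { toFun := fun x => c • x
      map_add' := fun x y => smul_add c x y
      map_smul' := fun a x => smul_comm c a x },
    fun _ _ h x => (restrict_map_smul N h c x).symm⟩

@[simp] theorem smulHom_apply (N : QuiverRep K I) (c : K) (i : I) (x : (restrict k N).V i) :
    (smulHom k N c).1 i x = c • x := rfl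

/-- A homomorphism over the larger field as a homomorphism over the smaller one. -/
def Hom.restrict (k : Type u) [Field k] [Algebra k K] [FiniteDimensional k K] {M N : QuiverRep K I}
    (f : Hom M N) : Hom (restrict k M) (restrict k N) :=
  ⟨fun i =>
    { toFun := fun x => f.1 i x
      map_add' := fun x y => (f.1 i).map_add x y
      map_smul' := fun a x => (f.1 i).map_smul (algebraMap k K a) x },
    fun _ _ h x => f.comm h x⟩

/-- A homomorphism over the smaller field which commutes with the larger field. -/
def Hom.ofRestrict {M N : QuiverRep K I} (f : Hom (QuiverRep.restrict k M) (QuiverRep.restrict k N))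
    (hf : ∀ (c : K) (i : I) (x : (QuiverRep.restrict k M).V i), f.1 i (c • x) = c • f.1 i x) :
    Hom M N :=
  ⟨fun i =>
    { toFun := fun x => f.1 i x
      map_add' := fun x y => (f.1 i).map_add x y
      map_smul' := fun a x => hf a i x },
    fun _ _ h x => f.comm h x⟩

/-- A subrepresentation over the larger field as a subrepresentation over the smaller one. -/
def Sub.restrict (k : Type u) [Field k] [Algebra k K] [FiniteDimensional k K] {N : QuiverRep K I}
    (U : Sub N) : Sub (restrict k N) where
  space i :=
    { carrier := {x | x ∈ U.space i}
      add_mem' := fun hx hy => (U.space i).add_mem hx hy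
      zero_mem' := (U.space i).zero_mem
      smul_mem' := fun c _ hx => (U.space i).smul_mem (algebraMap k K c) hx }
  map_mem h _ hx := U.map_mem h hx

/-- A subrepresentation over the smaller field which is stable under the larger field. -/
def Sub.ofRestrict {N : QuiverRep K I} (U : Sub (QuiverRep.restrict k N))
    (hU : ∀ (c : K) (i : I) (x : (QuiverRep.restrict k N).V i),
      x ∈ U.space i → c • x ∈ U.space i) : Sub N where
  space i :=
    { carrier := {x | x ∈ U.space i}
      add_mem' := fun hx hy => (U.space i).add_mem hx hy
      zero_mem' := (U.space i).zero_mem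
      smul_mem' := fun c x hx => hU c i x hx }
  map_mem h _ hx := U.map_mem h hx

theorem Sub.restrict_ofRestrict {N : QuiverRep K I} (U : Sub (QuiverRep.restrict k N))
    (hU : ∀ (c : K) (i : I) (x : (QuiverRep.restrict k N).V i),
      x ∈ U.space i → c • x ∈ U.space i) : (U.ofRestrict hU).restrict k = U := rfl

def Sub.restrictIso {N : QuiverRep K I} (U : Sub N) :
    Iso (QuiverRep.restrict k U.toRep) (U.restrict k).toRep where
  equiv _ :=
    { toFun := fun x => ⟨x.1, x.2⟩
      invFun := fun x => ⟨x.1, x.2⟩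
      map_add' := fun _ _ => rfl
      map_smul' := fun _ _ => rfl
      left_inv := fun _ => rfl
      right_inv := fun _ => rfl }
  comm _ _ := rfl

theorem Sub.dim_restrict [Finite I] {N : QuiverRep K I} (U : Sub N) :
    (U.restrict k).toRep.dim = Module.finrank k K • U.toRep.dim := by
  rw [← restrict_dim, (U.restrictIso (k := k)).dim_eq]

theorem Sub.restrict_injective {N : QuiverRep K I} :
    Function.Injective (Sub.restrict k : Sub N → _) := by
  intro U W h
  refine Sub.ext (funext fun i => Submodule.ext fun x => ?_)
  exact SetLike.ext_iff.1 (congrFun (congrArg Sub.space h) i) x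

variable [Finite I] {φ : (I →₀ ℕ) →+ ℚ}

theorem phi_restrict (N : QuiverRep K I) :
    φ (restrict k N).dim = Module.finrank k K * φ N.dim := by
  rw [restrict_dim, map_nsmul, nsmul_eq_mul]

theorem phi_sub_restrict {N : QuiverRep K I} (U : Sub N) :
    φ (U.restrict k).toRep.dim = Module.finrank k K * φ U.toRep.dim := by
  rw [Sub.dim_restrict, map_nsmul, nsmul_eq_mul]

variable (k K) in
theorem finrank_pos_rat : (0 : ℚ) < Module.finrank k K := Nat.cast_pos.2 Module.finrank_pos

theorem SemiFor.of_restrict {N : QuiverRep K I} (h : SemiFor φ (restrict k N)) : SemiFor φ N := by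
  have hn := finrank_pos_rat k K
  refine ⟨?_, fun U => ?_⟩
  · have := h.1
    rw [phi_restrict] at this
    exact (mul_eq_zero.1 this).resolve_left hn.ne'
  · have := h.2 (U.restrict k)
    rw [phi_sub_restrict] at this
    exact nonpos_of_mul_nonpos_right this hn

theorem StableFor.of_restrict {N : QuiverRep K I} (h : StableFor φ (restrict k N)) :
    StableFor φ N := by
  have hn := finrank_pos_rat k K
  refine ⟨h.1, h.semi.of_restrict.1, fun U hU hU' => ?_⟩
  have := h.2.2 (U.restrict k)
    (fun h1 => hU (Sub.restrict_injective (k := k) h1))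
    (fun h1 => hU' (Sub.restrict_injective (k := k) h1))
  rw [phi_sub_restrict] at this
  exact (pos_iff_neg_of_mul_neg this).1 hn

/-- A semistable representation stays semistable after restriction of scalars. -/
theorem SemiFor.restrict [Finite k] {N : QuiverRep K I} (h : SemiFor φ N) :
    SemiFor φ (restrict k N) := by
  have hn := finrank_pos_rat k K
  have h0 : φ (QuiverRep.restrict k N).dim = 0 := by rw [phi_restrict, h.1, mul_zero]
  refine ⟨h0, ?_⟩
  -- The subobjects of maximal φ are closed under joins, so there is a largest one. It is preserved
  -- by all automorphisms, in particular by the nonzero scalars of K; hence it is defined over K,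
  -- where semistability bounds its φ.
  obtain ⟨U₀, hU₀⟩ := Finite.exists_max fun U : Sub (QuiverRep.restrict k N) => φ U.toRep.dim
  let s : Set (Sub (QuiverRep.restrict k N)) := {U | φ U.toRep.dim = φ U₀.toRep.dim}
  obtain ⟨U, hU⟩ := (Set.toFinite s).exists_maximal ⟨U₀, rfl⟩
  have hle : ∀ W ∈ s, W ≤ U := by
    intro W hW
    have h1 := phi_sup_add_inf (φ := φ) U W
    have h2 : U ⊔ W ∈ s := by
      have h3 : φ U.toRep.dim = φ U₀.toRep.dim := hU.1
      have h4 : φ W.toRep.dim = φ U₀.toRep.dim := hW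
      refine le_antisymm (hU₀ _) ?_
      linarith [hU₀ (U ⊓ W)]
    exact le_sup_right.trans (hU.2 h2 le_sup_left)
  have hK : ∀ (c : K) (i : I) (x : (QuiverRep.restrict k N).V i),
      x ∈ U.space i → c • x ∈ U.space i := by
    intro c i x hx
    by_cases hc : c = 0
    · rw [hc, zero_smul]
      exact (U.space i).zero_mem
    let e : Iso (QuiverRep.restrict k N) (QuiverRep.restrict k N) :=
      Iso.ofBijective (smulHom k N c) fun i =>
        ⟨fun x y hxy => by
          rw [smulHom_apply, smulHom_apply] at hxy
          rw [← inv_smul_smul₀ hc x, hxy, inv_smul_smul₀ hc],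
        fun x => ⟨c⁻¹ • x, by rw [smulHom_apply, smul_inv_smul₀ hc]⟩⟩
    have h1 : U.mapIso e ∈ s := by
      change φ (U.mapIso e).toRep.dim = _
      rw [dim_mapIso]
      exact hU.1
    exact hle _ h1 i ⟨x, hx, rfl⟩
  intro W
  refine (hU₀ W).trans ?_
  have h1 : φ U.toRep.dim = φ U₀.toRep.dim := hU.1
  rw [← h1, ← U.restrict_ofRestrict hK, phi_sub_restrict]
  exact mul_nonpos_of_nonneg_of_nonpos hn.le (h.2 _)

/-- A subrepresentation on which finitely many homomorphisms to a semistable representation are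
jointly injective. -/
theorem phi_nonpos_of_jointly_injective {X S : QuiverRep k I} (hS : SemiFor φ S)
    (s : Finset (Hom X S)) (U : Sub X)
    (hU : ∀ i, ∀ x ∈ U.space i, (∀ p ∈ s, p.1 i x = 0) → x = 0) : φ U.toRep.dim ≤ 0 := by
  classical
  induction s using Finset.induction_on generalizing U with
  | empty =>
    have : U = ⊥ := Sub.ext (funext fun i => (Submodule.eq_bot_iff _).2 fun x hx =>
      hU i x hx (by simp))
    rw [this, Sub.dim_bot, map_zero]
  | insert p s hp ih =>
    -- U is an extension of its image under p, a subobject of the semistable S, by its part in the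
    -- kernel of p, on which the remaining homomorphisms are jointly injective.
    have h1 := ih (U ⊓ p.ker) fun i x hx hs => hU i x hx.1 fun q hq => by
      rcases Finset.mem_insert.1 hq with rfl | hq
      · exact hx.2
      · exact hs q hq
    have h2 := phi_ker_add_range (φ := φ) (p.comp U.inclHom)
    have h3 : U.incl (p.comp U.inclHom).ker = U ⊓ p.ker := by
      refine Sub.ext (funext fun i => Submodule.ext fun x => ?_)
      exact ⟨fun ⟨y, hy, hyx⟩ => hyx ▸ ⟨y.2, hy⟩, fun hx => ⟨⟨x, hx.1⟩, hx.2, rfl⟩⟩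
    rw [← h3, U.dim_incl] at h1
    linarith [hS.2 (p.comp U.inclHom).range]

section BaseChange

variable (K) in
/-- The homomorphism `s ↦ c ⊗ s`. -/
def tmulHom (S : QuiverRep k I) (c : K) : Hom S (restrict k (S.baseChange K)) :=
  ⟨fun i =>
    { toFun := fun x => (c ⊗ₜ[k] x : K ⊗[k] S.V i)
      map_add' := fun x y => TensorProduct.tmul_add c x y
      map_smul' := fun a x => by
        change c ⊗ₜ[k] (a • x) = (algebraMap k K a) • (c ⊗ₜ[k] x)
        rw [algebraMap_smul, TensorProduct.tmul_smul] },
    fun _ _ _ _ => rfl⟩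

@[simp] theorem tmulHom_apply (S : QuiverRep k I) (c : K) (i : I) (x : S.V i) :
    (tmulHom K S c).1 i x = c ⊗ₜ[k] x := rfl

theorem coord_algebraMap_smul {V : Type u} [AddCommGroup V] [Module k V]
    (j : Fin (Module.finrank k K)) (a : k) (x : K ⊗[k] V) :
    TensorProduct.equivFinsuppOfBasisLeft (N := V) (Module.finBasis k K) (algebraMap k K a • x) j =
      a • TensorProduct.equivFinsuppOfBasisLeft (N := V) (Module.finBasis k K) x j := by
  rw [algebraMap_smul, map_smul, Finsupp.smul_apply]

variable (K) in
/-- The coordinates with respect to a basis of the larger field. -/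
def coordHom (S : QuiverRep k I) (j : Fin (Module.finrank k K)) :
    Hom (restrict k (S.baseChange K)) S :=
  ⟨fun i =>
    { toFun := fun x => TensorProduct.equivFinsuppOfBasisLeft (N := S.V i) (Module.finBasis k K) x j
      map_add' := fun x y => DFunLike.congr_fun (map_add
        (TensorProduct.equivFinsuppOfBasisLeft (N := S.V i) (Module.finBasis k K))
        (x : K ⊗[k] S.V i) y) j
      map_smul' := fun a x => coord_algebraMap_smul j a x },
    fun i i' h x => by
      change TensorProduct.equivFinsuppOfBasisLeft (Module.finBasis k K)
        ((S.map h).baseChange K x) j = S.map h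
          (TensorProduct.equivFinsuppOfBasisLeft (N := S.V i) (Module.finBasis k K) x j)
      generalize (x : K ⊗[k] S.V i) = y
      induction y using TensorProduct.induction_on with
      | zero => simp
      | tmul a s =>
        rw [LinearMap.baseChange_tmul, TensorProduct.equivFinsuppOfBasisLeft_apply_tmul_apply,
          TensorProduct.equivFinsuppOfBasisLeft_apply_tmul_apply, map_smul]
      | add y z hy hz =>
        rw [map_add, map_add, map_add, Finsupp.add_apply, Finsupp.add_apply, map_add, hy, hz]⟩

theorem sum_coordHom (S : QuiverRep k I) (i : I) (x : (restrict k (S.baseChange K)).V i) :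
    x = (∑ j, (Module.finBasis k K j ⊗ₜ[k] (coordHom K S j).1 i x) : K ⊗[k] S.V i) := by
  have h := (TensorProduct.equivFinsuppOfBasisLeft (N := S.V i)
    (Module.finBasis k K)).symm_apply_apply x
  rw [TensorProduct.equivFinsuppOfBasisLeft_symm_apply, Finsupp.sum_fintype] at h
  · exact h.symm
  · simp

theorem eq_zero_of_coordHom (S : QuiverRep k I) (i : I) (x : (restrict k (S.baseChange K)).V i)
    (h : ∀ j, (coordHom K S j).1 i x = 0) : x = 0 := by
  rw [sum_coordHom S i x]
  exact Finset.sum_eq_zero fun j _ => by rw [h, TensorProduct.tmul_zero]; rfl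

theorem baseChange_dim (S : QuiverRep k I) : (S.baseChange K).dim = S.dim := by
  ext i
  exact Module.finrank_baseChange

/-- The coordinates for a k-basis of K are finitely many, jointly injective homomorphisms to S. -/
theorem SemiFor.restrict_baseChange {S : QuiverRep k I} (hS : SemiFor φ S) :
    SemiFor φ (QuiverRep.restrict k (S.baseChange K)) := by
  classical
  refine ⟨by rw [phi_restrict, baseChange_dim, hS.1, mul_zero], fun U => ?_⟩
  refine phi_nonpos_of_jointly_injective hS (Finset.univ.image (coordHom K S)) U fun i x _ h => ?_
  exact eq_zero_of_coordHom S i x fun j => h _ (Finset.mem_image_of_mem _ (Finset.mem_univ j))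

/-- All endomorphisms are scalar. -/
def IsBrick (S : QuiverRep k I) : Prop := ∀ f : Hom S S, ∃ c : k, f = c • Hom.id S

theorem IsBrick.of_iso {S T : QuiverRep k I} (h : IsBrick S) (e : Iso S T) : IsBrick T := by
  intro f
  obtain ⟨c, hc⟩ := h (e.symm.toHom.comp (f.comp e.toHom))
  refine ⟨c, Hom.ext' fun i x => ?_⟩
  have h1 := congrArg (fun g : Hom S S => e.equiv i (g.1 i ((e.equiv i).symm x))) hc
  simpa using h1

/-- Each coordinate of f is an endomorphism of S, hence a scalar; the scalars are the coordinates of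
the element l of K. -/
theorem IsBrick.exists_eq_tmul {S : QuiverRep k I} (hS : IsBrick S)
    (f : Hom S (restrict k (S.baseChange K))) : ∃ l : K, f = tmulHom K S l := by
  choose c hc using fun j => hS ((coordHom K S j).comp f)
  refine ⟨∑ j, c j • Module.finBasis k K j, Hom.ext' fun i x => ?_⟩
  rw [sum_coordHom S i (f.1 i x), tmulHom_apply, TensorProduct.sum_tmul]
  refine Finset.sum_congr rfl fun j _ => ?_
  have h1 : (coordHom K S j).1 i (f.1 i x) = c j • x :=
    congrArg (fun g : Hom S S => g.1 i x) (hc j)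
  rw [h1, TensorProduct.tmul_smul, TensorProduct.smul_tmul']

theorem IsBrick.baseChange {S : QuiverRep k I} (hS : IsBrick S) : IsBrick (S.baseChange K) := by
  intro g
  obtain ⟨l, hl⟩ := hS.exists_eq_tmul ((g.restrict k).comp (tmulHom K S 1))
  refine ⟨l, Hom.ext' fun i x => ?_⟩
  change g.1 i x = l • x
  induction (x : K ⊗[k] S.V i) using TensorProduct.induction_on with
  | zero => exact (map_zero (g.1 i)).trans (smul_zero l).symm
  | tmul a s =>
    have h1 : g.1 i ((1 : K) ⊗ₜ[k] s) = l ⊗ₜ[k] s :=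
      congrArg (fun g : Hom S (QuiverRep.restrict k (S.baseChange K)) => g.1 i s) hl
    have h2 : (a ⊗ₜ[k] s : K ⊗[k] S.V i) = a • ((1 : K) ⊗ₜ[k] s) := by
      rw [TensorProduct.smul_tmul', smul_eq_mul, mul_one]
    rw [h2]
    refine ((g.1 i).map_smul a _).trans ?_
    rw [h1]
    have h3 : (a • (l ⊗ₜ[k] s) : K ⊗[k] S.V i) = l • (a • ((1 : K) ⊗ₜ[k] s)) := by
      rw [TensorProduct.smul_tmul', TensorProduct.smul_tmul', TensorProduct.smul_tmul',
        smul_eq_mul, smul_eq_mul, smul_eq_mul, mul_one, mul_comm]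
    exact h3
  | add y z hy hz =>
    refine ((g.1 i).map_add y z).trans ?_
    rw [hy, hz]
    exact (smul_add l y z).symm

theorem baseChange_isZero {S : QuiverRep k I} : (S.baseChange K).IsZero ↔ S.IsZero := by
  rw [isZero_iff_dim, isZero_iff_dim, baseChange_dim]

/-- A stable representation whose endomorphisms are scalar stays stable after extension of
scalars. -/
theorem StableFor.baseChange [Finite k] {S : QuiverRep k I} (hS : StableFor φ S) (hb : IsBrick S) :
    StableFor φ (S.baseChange K) := by
  have hX : SemiFor φ (QuiverRep.restrict k (S.baseChange K)) := hS.semi.restrict_baseChange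
  have hX' := hX.of_restrict
  refine ⟨fun h => hS.1 (baseChange_isZero.1 h), hX'.1, fun U hU hU' => ?_⟩
  refine lt_of_le_of_ne (hX'.2 U) fun h0 => hU' ?_
  have hU0 : φ (U.restrict k).toRep.dim = 0 := by rw [phi_sub_restrict, h0, mul_zero]
  -- A nonzero K-subobject U with φ = 0 contains a k-stable A. Some coordinate maps A nontrivially
  -- to S, so A ≅ S, and the embedding of S is s ↦ l ⊗ s for a nonzero l in K. Dividing by l, the
  -- K-subobject U contains all pure tensors.
  obtain ⟨A, hA⟩ := (hX.sub hU0).exists_stable_sub fun h =>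
    hU (Sub.restrict_injective (k := k) ((U.restrict k).toRep_isZero_iff.1 h))
  let ι : Hom A.toRep (QuiverRep.restrict k (S.baseChange K)) :=
    (U.restrict k).inclHom.comp A.inclHom
  have hι : ∀ i x, ι.1 i x ∈ (U.restrict k).space i := fun i x => (A.inclHom.1 i x).2
  have hιi : ∀ i, Function.Injective (ι.1 i) := fun i =>
    ((U.restrict k).inclHom_injective i).comp (A.inclHom_injective i)
  obtain ⟨i₀, x₀, hx₀⟩ := (not_isZero_iff _).1 hA.1
  obtain ⟨j, hj⟩ : ∃ j, (coordHom K S j).comp ι ≠ 0 := by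
    by_contra! h
    refine hx₀ (hιi i₀ ?_)
    rw [map_zero]
    exact eq_zero_of_coordHom S i₀ _ fun j =>
      congrArg (fun g : Hom A.toRep S => g.1 i₀ x₀) (h j)
  let e : Iso A.toRep S := Iso.ofBijective _ (hA.bijective hS hj)
  obtain ⟨l, hl⟩ := hb.exists_eq_tmul (ι.comp e.symm.toHom)
  have hlU : ∀ i s, (l ⊗ₜ[k] s : K ⊗[k] S.V i) ∈ U.space i := by
    intro i s
    have h1 : ι.1 i ((e.equiv i).symm s) = l ⊗ₜ[k] s :=
      congrArg (fun g : Hom S (QuiverRep.restrict k (S.baseChange K)) => g.1 i s) hl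
    rw [← h1]
    exact hι i _
  have hl0 : l ≠ 0 := by
    rintro rfl
    refine hx₀ (hιi i₀ ?_)
    have h1 : ι.1 i₀ ((e.equiv i₀).symm (e.equiv i₀ x₀)) = (0 : K) ⊗ₜ[k] (e.equiv i₀ x₀) :=
      congrArg (fun g : Hom S (QuiverRep.restrict k (S.baseChange K)) => g.1 i₀ (e.equiv i₀ x₀)) hl
    rw [LinearEquiv.symm_apply_apply, TensorProduct.zero_tmul] at h1
    rw [h1, map_zero]
    rfl
  refine Sub.ext (funext fun i => (Submodule.eq_top_iff').2 fun x => ?_)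
  induction (x : K ⊗[k] S.V i) using TensorProduct.induction_on with
  | zero => exact (U.space i).zero_mem
  | tmul a s =>
    have h1 : (a ⊗ₜ[k] s : K ⊗[k] S.V i) = (a * l⁻¹) • (l ⊗ₜ[k] s) := by
      rw [TensorProduct.smul_tmul', smul_eq_mul, inv_mul_cancel_right₀ hl0]
    rw [h1]
    exact (U.space i).smul_mem _ (hlU i s)
  | add y z hy hz => exact (U.space i).add_mem hy hz

end BaseChange

end QuiverRep

end

/-! ### The field of endomorphisms of a stable representation, and bricks over extension fields. -/

noncomputable section


namespace QuiverRep

variable {k : Type u} [Field k] {I : Type w} [Quiver.{v} I]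

/-- The endomorphism algebra of a representation. -/
def endAlg (S : QuiverRep k I) : Subalgebra k (∀ i, Module.End k (S.V i)) where
  carrier := {f | f ∈ homs S S}
  mul_mem' := fun {f g} hf hg => (Hom.comp (⟨f, hf⟩ : Hom S S) (⟨g, hg⟩ : Hom S S)).2
  add_mem' := fun hf hg => (homs S S).add_mem hf hg
  algebraMap_mem' := fun c => ((homs S S).smul_mem c (Hom.id S).2)

/-- A field acting on `S` by all endomorphisms of `S`. -/
structure EndField (S : QuiverRep k I) where
  E : Type u
  [field : Field E]
  [algebra : Algebra k E]
  [finite : FiniteDimensional k E]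
  ρ : E →ₐ[k] (∀ i, Module.End k (S.V i))
  mem_homs : ∀ e, ρ e ∈ homs S S
  exists_eq : ∀ f : Hom S S, ∃ e, ρ e = f.1

attribute [instance] EndField.field EndField.algebra EndField.finite

/-- By Schur's lemma nonzero endomorphisms are injective, so the endomorphism algebra is a finite
domain, hence a field by Wedderburn. `Shrink` merely moves it to the universe of k, where
representations over it live. -/
theorem StableFor.nonempty_endField [Finite k] [Finite I] {φ : (I →₀ ℕ) →+ ℚ} {S : QuiverRep k I}
    (hS : StableFor φ S) : Nonempty (EndField S) := by
  obtain ⟨i₀, x₀, hx₀⟩ := (not_isZero_iff S).1 hS.1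
  have hfin : Finite (endAlg S) := finite_hom S S
  have : Nontrivial (endAlg S) := by
    refine ⟨0, 1, fun h => hx₀ ?_⟩
    have h1 : (0 : Module.End k (S.V i₀)) = 1 := congrFun (congrArg Subtype.val h) i₀
    exact (LinearMap.congr_fun h1 x₀).symm
  have : NoZeroDivisors (endAlg S) := by
    refine ⟨fun {f g} h => ?_⟩
    by_contra! hn
    let F : Hom S S := ⟨f.1, f.2⟩
    let G : Hom S S := ⟨g.1, g.2⟩
    have hF : F ≠ 0 := fun h0 => hn.1 (Subtype.ext (congrArg Subtype.val h0))
    have hG : G ≠ 0 := fun h0 => hn.2 (Subtype.ext (congrArg Subtype.val h0))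
    have h1 : F.1 i₀ (G.1 i₀ x₀) = 0 :=
      LinearMap.congr_fun (congrFun (congrArg Subtype.val h) i₀) x₀
    refine hx₀ (hS.injective hS.semi hG i₀ (hS.injective hS.semi hF i₀ ?_))
    rw [h1, map_zero, map_zero]
  have : IsDomain (endAlg S) := NoZeroDivisors.to_isDomain _
  have hsm : Small.{u} (endAlg S) := Countable.toSmall _
  have hfld : IsField (Shrink.{u} (endAlg S)) :=
    MulEquiv.isField (Finite.isDomain_to_isField (endAlg S))
      (Shrink.algEquiv.{u} k (endAlg S)).toMulEquiv
  have hmf : Module.Finite k (endAlg S) :=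
    Module.Finite.of_finite
  exact ⟨{
    E := Shrink.{u} (endAlg S)
    field := IsField.toField hfld
    algebra := (inferInstance : Algebra k (Shrink.{u} (endAlg S)))
    finite := Module.Finite.equiv (Shrink.algEquiv.{u} k (endAlg S)).symm.toLinearEquiv
    ρ := (endAlg S).val.comp (Shrink.algEquiv.{u} k (endAlg S)).toAlgHom
    mem_homs := fun e => (Shrink.algEquiv.{u} k (endAlg S) e).2
    exists_eq := fun f => by
      refine ⟨(Shrink.algEquiv.{u} k (endAlg S)).symm ⟨f.1, f.2⟩, ?_⟩
      exact congrArg Subtype.val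
        ((Shrink.algEquiv.{u} k (endAlg S)).apply_symm_apply ⟨f.1, f.2⟩) }⟩

namespace EndField

variable {S : QuiverRep k I} (D : EndField S)

/-- The action of an element of the field. -/
def hom (e : D.E) : Hom S S := ⟨D.ρ e, D.mem_homs e⟩

theorem hom_apply (e : D.E) (i : I) (x : S.V i) : (D.hom e).1 i x = D.ρ e i x := rfl

theorem exists_hom_eq (f : Hom S S) : ∃ e, D.hom e = f := by
  obtain ⟨e, he⟩ := D.exists_eq f
  exact ⟨e, Subtype.ext he⟩

theorem hom_comm (f : Hom S S) (e : D.E) (i : I) (x : S.V i) :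
    f.1 i (D.ρ e i x) = D.ρ e i (f.1 i x) := by
  obtain ⟨e', rfl⟩ := D.exists_hom_eq f
  have h : D.ρ (e' * e) i x = D.ρ (e * e') i x := by rw [mul_comm]
  rw [map_mul, map_mul] at h
  exact h

theorem hom_injective (h0 : ¬ S.IsZero) : Function.Injective D.hom := by
  obtain ⟨i₀, x₀, hx₀⟩ := (not_isZero_iff S).1 h0
  have : Nontrivial (∀ i, Module.End k (S.V i)) := by
    refine ⟨0, 1, fun h => hx₀ ?_⟩
    exact (LinearMap.congr_fun (congrFun h i₀) x₀).symm
  intro e f h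
  exact D.ρ.toRingHom.injective (congrArg Subtype.val h)

theorem card_eq (h0 : ¬ S.IsZero) : Nat.card D.E = Nat.card (Hom S S) :=
  Nat.card_congr (Equiv.ofBijective D.hom ⟨D.hom_injective h0, D.exists_hom_eq⟩)

/-- The representation over the field of endomorphisms. -/
def rep : QuiverRep D.E I :=
  letI : ∀ i, Module D.E (S.V i) := fun i =>
    Module.compHom (S.V i) ((Pi.evalRingHom (fun i => Module.End k (S.V i)) i).comp D.ρ.toRingHom)
  haveI : ∀ i, IsScalarTower k D.E (S.V i) := fun i =>
    IsScalarTower.of_algebraMap_smul fun c x => by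
      change D.ρ (algebraMap k D.E c) i x = c • x
      rw [AlgHom.commutes]
      rfl
  { V := S.V
    addCommGroup := S.addCommGroup
    module := fun i => Module.compHom (S.V i)
      ((Pi.evalRingHom (fun i => Module.End k (S.V i)) i).comp D.ρ.toRingHom)
    finiteDimensional := fun i => Module.Finite.of_restrictScalars_finite k D.E (S.V i)
    map := fun {i j} h =>
      { toFun := S.map h
        map_add' := (S.map h).map_add
        map_smul' := fun e x => ((D.hom e).comm h x).symm } }

theorem smul_def (e : D.E) (i : I) (x : D.rep.V i) : e • x = D.ρ e i (x : S.V i) := rfl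

theorem algebraMap_smul_rep (c : k) (i : I) (x : D.rep.V i) :
    algebraMap k D.E c • x = @HSMul.hSMul k (S.V i) (S.V i) _ c x := by
  rw [smul_def, AlgHom.commutes]
  rfl

/-- Restriction of scalars gives the original representation back. -/
def restrictIso : Iso (restrict k D.rep) S where
  equiv i :=
    { toFun := fun x => x
      invFun := fun x => x
      map_add' := fun _ _ => rfl
      map_smul' := fun c x => by
        change D.ρ (algebraMap k D.E c) i x = @HSMul.hSMul k (S.V i) (S.V i) _ c x
        rw [AlgHom.commutes]
        rfl
      left_inv := fun _ => rfl
      right_inv := fun _ => rfl }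
  comm _ _ := rfl

variable [Finite I] {φ : (I →₀ ℕ) →+ ℚ}

theorem dim_rep : S.dim = Module.finrank k D.E • D.rep.dim := by
  rw [← restrict_dim, D.restrictIso.dim_eq]

theorem stable_rep (hS : StableFor φ S) : StableFor φ D.rep :=
  (hS.of_iso D.restrictIso.symm).of_restrict

/-- An endomorphism over the field E of endomorphisms is one over k, hence given by an element of E,
which by now is a scalar. -/
theorem isBrick_rep : IsBrick D.rep := by
  intro f
  obtain ⟨e, he⟩ := D.exists_hom_eq
    (D.restrictIso.toHom.comp ((f.restrict k).comp D.restrictIso.symm.toHom))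
  refine ⟨e, Hom.ext' fun i x => ?_⟩
  exact (congrArg (fun g : Hom S S => g.1 i (x : S.V i)) he).symm

variable {K : Type u} [Field K] [Algebra k K] [FiniteDimensional k K]

/-- The representation over an extension field that an embedding of the field of endomorphisms
gives rise to. -/
def ofAlgHom (σ : D.E →ₐ[k] K) : QuiverRep K I :=
  letI := σ.toRingHom.toAlgebra
  D.rep.baseChange K

variable (σ : D.E →ₐ[k] K)

theorem dim_ofAlgHom : (D.ofAlgHom σ).dim = D.rep.dim := by
  let _ := σ.toRingHom.toAlgebra
  have : IsScalarTower k D.E K := IsScalarTower.of_algebraMap_eq fun c => (σ.commutes c).symm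
  have : FiniteDimensional D.E K := Module.Finite.of_restrictScalars_finite k D.E K
  exact baseChange_dim (K := K) D.rep

theorem stable_ofAlgHom [Finite k] (hS : StableFor φ S) : StableFor φ (D.ofAlgHom σ) := by
  let _ := σ.toRingHom.toAlgebra
  have : IsScalarTower k D.E K := IsScalarTower.of_algebraMap_eq fun c => (σ.commutes c).symm
  have : FiniteDimensional D.E K := Module.Finite.of_restrictScalars_finite k D.E K
  have : Finite D.E := Module.finite_of_finite k
  exact (D.stable_rep hS).baseChange D.isBrick_rep

theorem isBrick_ofAlgHom : IsBrick (D.ofAlgHom σ) := by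
  let _ := σ.toRingHom.toAlgebra
  have : IsScalarTower k D.E K := IsScalarTower.of_algebraMap_eq fun c => (σ.commutes c).symm
  have : FiniteDimensional D.E K := Module.Finite.of_restrictScalars_finite k D.E K
  exact D.isBrick_rep.baseChange

/-- The canonical homomorphism `s ↦ 1 ⊗ s`. -/
theorem exists_hom_ofAlgHom (h0 : ¬ S.IsZero) : ∃ f : Hom S (restrict k (D.ofAlgHom σ)), f ≠ 0 ∧
    ∀ e i (s : S.V i), f.1 i (D.ρ e i s) = σ e • f.1 i s := by
  let _ := σ.toRingHom.toAlgebra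
  have : IsScalarTower k D.E K := IsScalarTower.of_algebraMap_eq fun c => (σ.commutes c).symm
  have : FiniteDimensional D.E K := Module.Finite.of_restrictScalars_finite k D.E K
  let F := tmulHom K D.rep 1
  let b := Module.finBasis D.E K
  have hinj : ∀ i (s : D.rep.V i), (1 : K) ⊗ₜ[D.E] s = 0 → s = 0 := by
    intro i s h1
    have h2 : ∀ j, b.repr 1 j • s = 0 := fun j => by
      rw [← TensorProduct.equivFinsuppOfBasisLeft_apply_tmul_apply b, h1, map_zero]
      rfl
    obtain ⟨j, hj⟩ : ∃ j, b.repr 1 j ≠ 0 := by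
      by_contra! hn
      have : b.repr 1 = 0 := Finsupp.ext hn
      exact one_ne_zero (b.repr.map_eq_zero_iff.1 this)
    exact (smul_eq_zero.1 (h2 j)).resolve_left hj
  have hF : ∀ (e : D.E) i (s : D.rep.V i), F.1 i (e • s) = σ e • F.1 i s := fun e i s =>
    (F.1 i).map_smul e s
  let f : Hom S (restrict k (D.ofAlgHom σ)) :=
    ⟨fun i =>
      { toFun := fun s => F.1 i s
        map_add' := fun x y => (F.1 i).map_add x y
        map_smul' := fun c s => (congrArg (F.1 i) (D.algebraMap_smul_rep c i s).symm).trans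
          ((hF (algebraMap k D.E c) i s).trans (congrArg (· • F.1 i s) (σ.commutes c))) },
      fun i j h s => F.comm h s⟩
  refine ⟨f, ?_, fun e i s => hF e i s⟩
  obtain ⟨i, s, hs⟩ := (not_isZero_iff S).1 h0
  refine (Hom.ne_zero_iff f).2 ⟨i, s, fun h => hs ?_⟩
  exact hinj i s h

/-- The coordinates for a basis of K over E, read as homomorphisms over k. They show that K ⊗_E S,
seen over k, embeds in a power of S, and they are compatible with E acting on K through σ; so the
brick remembers both S and σ. -/
theorem exists_coord : ∃ p : Fin (@Module.finrank D.E K _ _ σ.toRingHom.toAlgebra.toModule) →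
      Hom (restrict k (D.ofAlgHom σ)) S,
    (∀ i x, (∀ j, (p j).1 i x = 0) → x = 0) ∧
    ∀ j e i x, (p j).1 i (σ e • x) = D.ρ e i ((p j).1 i x) := by
  let _ := σ.toRingHom.toAlgebra
  have : IsScalarTower k D.E K := IsScalarTower.of_algebraMap_eq fun c => (σ.commutes c).symm
  have : FiniteDimensional D.E K := Module.Finite.of_restrictScalars_finite k D.E K
  have hE : ∀ j (e : D.E) i (x : (restrict D.E (D.rep.baseChange K)).V i),
      (coordHom K D.rep j).1 i (e • x) = e • (coordHom K D.rep j).1 i x :=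
    fun j e i x => ((coordHom K D.rep j).1 i).map_smul e x
  refine ⟨fun j => ⟨fun i =>
    { toFun := fun x => (coordHom K D.rep j).1 i x
      map_add' := fun x y => ((coordHom K D.rep j).1 i).map_add x y
      map_smul' := fun c x => ?_ }, fun i i' h x => (coordHom K D.rep j).comm h x⟩, ?_, ?_⟩
  · have h1 := hE j (algebraMap k D.E c) i x
    have h2 : ∀ y : K ⊗[D.E] D.rep.V i, algebraMap D.E K (algebraMap k D.E c) • y =
        algebraMap k K c • y := fun y => congrArg (· • y) (σ.commutes c)
    rw [algebraMap_smul_rep] at h1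
    exact (congrArg ((coordHom K D.rep j).1 i) (h2 x).symm).trans h1
  · exact fun i x h => eq_zero_of_coordHom D.rep i x h
  · exact fun j e i x => hE j e i x

theorem iso_of_hom_ofAlgHom (hS : StableFor φ S) {S' : QuiverRep k I} (hS' : StableFor φ S')
    {f : Hom S' (restrict k (D.ofAlgHom σ))} (hf : f ≠ 0) : Nonempty (Iso S' S) := by
  obtain ⟨p, hp, -⟩ := D.exists_coord σ
  obtain ⟨i, x, hx⟩ := (Hom.ne_zero_iff f).1 hf
  obtain ⟨j, hj⟩ : ∃ j, (p j).comp f ≠ 0 := by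
    by_contra! h
    exact hx (hp i _ fun j => congrArg (fun g : Hom S' S => g.1 i x) (h j))
  exact ⟨Iso.ofBijective _ (hS'.bijective hS hj)⟩

/-- Every coordinate of f is an endomorphism of S, which commutes with E since E is commutative.
Therefore τ(e) and σ(e) act alike on a nonzero vector. -/
theorem eq_of_hom_ofAlgHom {τ : D.E →ₐ[k] K} {f : Hom S (restrict k (D.ofAlgHom σ))} (hf : f ≠ 0)
    (hτ : ∀ e i (s : S.V i), f.1 i (D.ρ e i s) = τ e • f.1 i s) : τ = σ := by
  obtain ⟨p, hp, hp'⟩ := D.exists_coord σ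
  obtain ⟨i, x, hx⟩ := (Hom.ne_zero_iff f).1 hf
  ext e
  have h1 : τ e • f.1 i x - σ e • f.1 i x = 0 := hp i _ fun j => by
    rw [map_sub, ← hτ, hp']
    exact sub_eq_zero.2 (D.hom_comm ((p j).comp f) e i x)
  rw [← sub_smul] at h1
  exact sub_eq_zero.1 ((smul_eq_zero.1 h1).resolve_right hx)

end EndField

variable {K : Type u} [Field K] [Algebra k K] [FiniteDimensional k K]

/-- The linear maps underlying `liftHom`. -/
def liftMap {S : QuiverRep k I} {N : QuiverRep K I} (f : Hom S (restrict k N)) (i : I) :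
    K ⊗[k] S.V i →ₗ[K] (restrict k N).V i := LinearMap.liftBaseChange K (f.1 i)

/-- A homomorphism to a restriction of scalars gives one from the extension of scalars. -/
def liftHom {S : QuiverRep k I} {N : QuiverRep K I} (f : Hom S (restrict k N)) :
    Hom (S.baseChange K) N :=
  ⟨fun i => liftMap f i, fun i j h x => by
    change LinearMap.liftBaseChange K (f.1 j) ((S.map h).baseChange K x) =
      (restrict k N).map h (LinearMap.liftBaseChange K (f.1 i) x)
    generalize (x : K ⊗[k] S.V i) = y
    induction y using TensorProduct.induction_on with
    | zero => rw [map_zero, map_zero, map_zero, map_zero]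
    | tmul a s =>
      rw [LinearMap.baseChange_tmul, LinearMap.liftBaseChange_tmul, LinearMap.liftBaseChange_tmul,
        restrict_map_smul, f.comm]
    | add y z hy hz => rw [map_add, map_add, map_add, map_add, hy, hz]⟩

theorem liftHom_tmul {S : QuiverRep k I} {N : QuiverRep K I} (f : Hom S (restrict k N)) (i : I)
    (a : K) (s : S.V i) : (liftHom f).1 i (a ⊗ₜ[k] s) = (a • f.1 i s : (restrict k N).V i) :=
  LinearMap.liftBaseChange_tmul K (f.1 i) a s

theorem liftHom_ne_zero {S : QuiverRep k I} {N : QuiverRep K I} {f : Hom S (restrict k N)}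
    (hf : f ≠ 0) : liftHom f ≠ 0 := by
  obtain ⟨i, s, hs⟩ := (Hom.ne_zero_iff f).1 hf
  refine (Hom.ne_zero_iff _).2 ⟨i, (1 : K) ⊗ₜ[k] s, ?_⟩
  rw [liftHom_tmul, one_smul]
  exact hs

/-- Extension of scalars of a homomorphism. -/
def Hom.baseChange (K : Type u) [Field K] [Algebra k K] {S T : QuiverRep k I} (f : Hom S T) :
    Hom (S.baseChange K) (T.baseChange K) :=
  ⟨fun i => (f.1 i).baseChange K, fun i j h x => by
    change (f.1 j).baseChange K ((S.map h).baseChange K x) =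
      (T.map h).baseChange K ((f.1 i).baseChange K x)
    generalize (x : K ⊗[k] S.V i) = y
    induction y using TensorProduct.induction_on with
    | zero => rw [map_zero, map_zero, map_zero, map_zero]
    | tmul a s => simp only [LinearMap.baseChange_tmul, f.comm]
    | add y z hy hz => rw [map_add, map_add, map_add, map_add, hy, hz]⟩

theorem coordHom_baseChange [Finite I] {S : QuiverRep k I} (f : Hom S S)
    (j : Fin (Module.finrank k K)) (i : I) (x : (restrict k (S.baseChange K)).V i) :
    (coordHom K S j).1 i ((f.baseChange K).1 i x) = f.1 i ((coordHom K S j).1 i x) := by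
  change TensorProduct.equivFinsuppOfBasisLeft (Module.finBasis k K)
    ((f.1 i).baseChange K x) j = f.1 i
      (TensorProduct.equivFinsuppOfBasisLeft (N := S.V i) (Module.finBasis k K) x j)
  generalize (x : K ⊗[k] S.V i) = y
  induction y using TensorProduct.induction_on with
  | zero => simp
  | tmul a s =>
    rw [LinearMap.baseChange_tmul, TensorProduct.equivFinsuppOfBasisLeft_apply_tmul_apply,
      TensorProduct.equivFinsuppOfBasisLeft_apply_tmul_apply, map_smul]
  | add y z hy hz =>
    rw [map_add, map_add, map_add, Finsupp.add_apply, Finsupp.add_apply, map_add, hy, hz]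

variable [Finite I] {φ : (I →₀ ℕ) →+ ℚ}

theorem tmulHom_generate {S : QuiverRep k I} (U : Sub (restrict k (S.baseChange K)))
    (hU : ∀ f : Hom S (restrict k (S.baseChange K)), f.range ≤ U) : U = ⊤ := by
  refine Sub.ext (funext fun i => (Submodule.eq_top_iff').2 fun x => ?_)
  induction (x : K ⊗[k] S.V i) using TensorProduct.induction_on with
  | zero => exact (U.space i).zero_mem
  | tmul a s => exact hU (tmulHom K S a) i ⟨s, rfl⟩
  | add y z hy hz => exact (U.space i).add_mem hy hz

/-- The condition on f makes it linear over E, so it extends to a nonzero K-homomorphism from K ⊗_E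
S to N, and both of these are stable. -/
theorem EndField.iso_of_hom [Finite k] {S : QuiverRep k I} (D : EndField S) (hS : StableFor φ S)
    {N : QuiverRep K I} (hN : StableFor φ N) {f : Hom S (restrict k N)} (hf : f ≠ 0)
    {σ : D.E →ₐ[k] K} (hσ : ∀ e i (s : S.V i), f.1 i (D.ρ e i s) = σ e • f.1 i s) :
    Nonempty (Iso (D.ofAlgHom σ) N) := by
  have h1 := D.stable_ofAlgHom σ hS
  let _ := σ.toRingHom.toAlgebra
  have : IsScalarTower k D.E K := IsScalarTower.of_algebraMap_eq fun c => (σ.commutes c).symm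
  have : FiniteDimensional D.E K := Module.Finite.of_restrictScalars_finite k D.E K
  let F : Hom D.rep (restrict D.E N) :=
    ⟨fun i =>
      { toFun := fun s => f.1 i s
        map_add' := fun x y => (f.1 i).map_add x y
        map_smul' := fun e s => hσ e i s }, fun i j h s => f.comm h s⟩
  have hF : F ≠ 0 := by
    obtain ⟨i, s, hs⟩ := (Hom.ne_zero_iff f).1 hf
    exact (Hom.ne_zero_iff F).2 ⟨i, s, hs⟩
  exact ⟨Iso.ofBijective (M := D.ofAlgHom σ) (liftHom F)
    (StableFor.bijective h1 hN (liftHom_ne_zero hF))⟩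

/-- The stable N is a quotient π of K ⊗_k S, and over k this quotient has a section J, as K ⊗_k S is
generated by images of S. For e in E the composite T e = π ∘ (1 ⊗ e) ∘ J sends g(s) to g(es) for
every g : S → N. This property makes T e linear over K, hence a scalar σ(e) because N is a brick. -/
theorem EndField.exists_algHom [Finite k] {S : QuiverRep k I} (D : EndField S)
    (hS : StableFor φ S) {N : QuiverRep K I} (hN : StableFor φ N) (hb : IsBrick N)
    {f : Hom S (restrict k N)} (hf : f ≠ 0) :
    ∃ σ : D.E →ₐ[k] K, ∀ e i (s : S.V i), f.1 i (D.ρ e i s) = σ e • f.1 i s := by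
  have hX : SemiFor φ (restrict k (S.baseChange K)) := hS.semi.restrict_baseChange
  have hsurj := hN.surjective hX.of_restrict (liftHom_ne_zero hf)
  let π : Hom (restrict k (S.baseChange K)) (restrict k N) := (liftHom f).restrict k
  obtain ⟨Q, -, hQ⟩ := hX.exists_isCompl hS (fun U hU => tmulHom_generate U hU)
    (hX.phi_ker hN.semi.restrict π)
  have hbij : ∀ i, Function.Bijective ((π.comp Q.inclHom).1 i) := by
    intro i
    have hi := Sub.isCompl_space hQ i
    constructor
    · refine (injective_iff_map_eq_zero _).2 fun x hx => Subtype.ext ?_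
      exact (Submodule.disjoint_def.1 hi.disjoint) x.1 hx x.2
    · intro y
      obtain ⟨x, rfl⟩ : ∃ x : (restrict k (S.baseChange K)).V i, π.1 i x = y := hsurj i y
      have hx : x ∈ π.ker.space i ⊔ Q.space i := by
        rw [hi.sup_eq_top]
        exact Submodule.mem_top
      obtain ⟨r, hr, q, hq, rfl⟩ := Submodule.mem_sup.1 hx
      refine ⟨⟨q, hq⟩, ?_⟩
      change π.1 i q = π.1 i (r + q)
      rw [map_add, (show π.1 i r = 0 from hr), zero_add]
  let ε := Iso.ofBijective _ hbij
  let J : Hom (restrict k N) (restrict k (S.baseChange K)) := Q.inclHom.comp ε.symm.toHom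
  have hJ : ∀ i y, π.1 i (J.1 i y) = y := fun i y => (ε.equiv i).apply_symm_apply y
  let T : D.E → Hom (restrict k N) (restrict k N) := fun e =>
    π.comp ((((D.hom e).baseChange K).restrict k).comp J)
  have hT : ∀ e (g : Hom S (restrict k N)) i s, (T e).1 i (g.1 i s) = g.1 i (D.ρ e i s) := by
    intro e g i s
    have h1 : ((D.hom e).baseChange K).1 i (J.1 i (g.1 i s)) = J.1 i (g.1 i (D.ρ e i s)) := by
      refine sub_eq_zero.1 (eq_zero_of_coordHom S i _ fun j => ?_)
      refine ((coordHom K S j).1 i).map_sub _ _ |>.trans (sub_eq_zero.2 ?_)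
      rw [coordHom_baseChange]
      exact (D.hom_comm ((coordHom K S j).comp (J.comp g)) e i s).symm
    exact (congrArg (π.1 i) h1).trans (hJ i _)
  have hTK : ∀ e (c : K) i x, (T e).1 i (c • x) = c • (T e).1 i x := by
    intro e c i x
    obtain ⟨y, rfl⟩ := hsurj i x
    induction (y : K ⊗[k] S.V i) using TensorProduct.induction_on with
    | zero =>
      have h0 : (liftHom f).1 i (0 : K ⊗[k] S.V i) = 0 := map_zero ((liftHom f).1 i)
      rw [h0]
      have h1 : (T e).1 i 0 = 0 := map_zero _
      have h2 : (c • (0 : (restrict k N).V i)) = 0 := smul_zero c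
      exact (congrArg _ h2).trans (h1.trans ((congrArg (c • ·) h1).trans h2).symm)
    | tmul a s =>
      rw [liftHom_tmul]
      have h1 : (T e).1 i ((c * a) • f.1 i s) = (c * a) • f.1 i (D.ρ e i s) :=
        hT e ((smulHom k N (c * a)).comp f) i s
      have h2 : (T e).1 i (a • f.1 i s) = a • f.1 i (D.ρ e i s) :=
        hT e ((smulHom k N a).comp f) i s
      refine (congrArg ((T e).1 i) (smul_smul c a (f.1 i s))).trans (h1.trans ?_)
      refine Eq.trans ?_ (congrArg (c • ·) h2).symm
      exact (smul_smul c a _).symm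
    | add y z hy hz =>
      have h0 : (liftHom f).1 i (y + z : K ⊗[k] S.V i) =
        (liftHom f).1 i y + (liftHom f).1 i z := map_add ((liftHom f).1 i) _ _
      rw [h0]
      have h1 : ∀ a b : (restrict k N).V i, (T e).1 i (a + b) = (T e).1 i a + (T e).1 i b :=
        fun a b => map_add _ a b
      have h2 : ∀ a b : (restrict k N).V i, c • (a + b) = c • a + c • b := fun a b => smul_add c a b
      exact (congrArg _ (h2 _ _)).trans ((h1 _ _).trans ((congrArg₂ (· + ·) hy hz).trans
        ((congrArg (c • ·) (h1 _ _)).trans (h2 _ _)).symm))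
  choose σ hσ using fun e => hb (Hom.ofRestrict (T e) (hTK e))
  have hσ' : ∀ e i (s : S.V i), f.1 i (D.ρ e i s) = σ e • f.1 i s := by
    intro e i s
    rw [← hT e f i s]
    exact congrArg (fun g : Hom N N => g.1 i (f.1 i s)) (hσ e)
  obtain ⟨i, s, hs⟩ := (Hom.ne_zero_iff f).1 hf
  -- A scalar is determined by its effect on one nonzero vector of the image of f, where the
  -- identities for σ become those for the action of E on S.
  have huniq : ∀ a b : K, a • f.1 i s = b • f.1 i s → a = b := fun a b h => by
    rw [← sub_eq_zero, ← sub_smul] at h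
    exact sub_eq_zero.1 ((smul_eq_zero.1 h).resolve_right hs)
  refine ⟨{ toFun := σ, map_one' := ?_, map_mul' := ?_, map_zero' := ?_, map_add' := ?_,
            commutes' := ?_ }, hσ'⟩
  · refine huniq _ _ ?_
    rw [← hσ', map_one, one_smul]
    rfl
  · intro a b
    refine huniq _ _ ?_
    rw [← hσ', map_mul, mul_smul, ← hσ', ← hσ']
    rfl
  · refine huniq _ _ ?_
    rw [← hσ', map_zero, zero_smul]
    exact map_zero (f.1 i)
  · intro a b
    refine huniq _ _ ?_
    rw [← hσ', map_add, add_smul, ← hσ', ← hσ']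
    exact map_add (f.1 i) _ _
  · intro c
    refine huniq _ _ ?_
    rw [← hσ', AlgHom.commutes, ← restrict_smul, ← map_smul]
    rfl

end QuiverRep

end

/-! ### Counting stable bricks over extension fields. -/

noncomputable section


/-- The pairs `(n, α)` with `n • α = β`. -/
def divisorPairs {I : Type w} (β : I →₀ ℕ) : Finset (ℕ × (I →₀ ℕ)) := by
  classical
  exact (Finset.Icc 1 β.degree ×ˢ Finset.Icc 0 β).filter fun p => p.1 • p.2 = β

theorem mem_divisorPairs {I : Type w} {β : I →₀ ℕ} (hβ : β ≠ 0) {p : ℕ × (I →₀ ℕ)} :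
    p ∈ divisorPairs β ↔ p.1 • p.2 = β := by
  classical
  rw [divisorPairs, Finset.mem_filter, Finset.mem_product, Finset.mem_Icc, Finset.mem_Icc,
    and_iff_right_iff_imp]
  rintro rfl
  have h1 : p.1 ≠ 0 := fun h => hβ (by rw [h, zero_smul])
  have h2 : p.2 ≠ 0 := fun h => hβ (by rw [h, smul_zero])
  have h3 : p.2.degree ≠ 0 := fun h => h2 ((Finsupp.degree_eq_zero_iff _).1 h)
  refine ⟨⟨Nat.one_le_iff_ne_zero.2 h1, ?_⟩, zero_le, fun i => ?_⟩
  · rw [map_nsmul, smul_eq_mul]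
    exact Nat.le_mul_of_pos_right _ (Nat.pos_of_ne_zero h3)
  · rw [Finsupp.smul_apply, smul_eq_mul]
    exact Nat.le_mul_of_pos_left _ (Nat.pos_of_ne_zero h1)

namespace QuiverRep

section Count

variable {k : Type u} [Field k] {I : Type w} [Quiver.{v} I] [Finite I]

/-- The number of stable bricks of a given dimension vector. -/
def brickCount (k : Type u) [Field k] (φ : (I →₀ ℕ) →+ ℚ) (α : I →₀ ℕ) : ℕ :=
  Nat.card {c : IsoClass k I // StableFor φ c.rep ∧ IsBrick c.rep ∧ c.dim = α}

/-- The dimension of the endomorphism ring. -/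
def endDim (c : IsoClass k I) : ℕ := Module.finrank k (Hom c.rep c.rep)

theorem card_end [Finite k] (c : IsoClass k I) :
    Nat.card (Hom c.rep c.rep) = Nat.card k ^ endDim c := by
  have : Module.Finite k (Hom c.rep c.rep) := Module.Finite.of_finite
  exact Module.natCard_eq_pow_finrank

theorem EndField.finrank_eq [Finite k] {c : IsoClass k I} (D : EndField c.rep)
    (h0 : ¬ c.rep.IsZero) : Module.finrank k D.E = endDim c := by
  have h := D.card_eq h0
  rw [card_end, Module.natCard_eq_pow_finrank (K := k)] at h
  exact Nat.pow_right_injective Finite.one_lt_card h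

variable {φ : (I →₀ ℕ) →+ ℚ}

theorem exists_dim_eq_endDim_smul [Finite k] {c : IsoClass k I} (hc : StableFor φ c.rep) :
    endDim c ≠ 0 ∧ ∃ γ, c.dim = endDim c • γ := by
  obtain ⟨D⟩ := hc.nonempty_endField
  rw [← D.finrank_eq hc.1]
  exact ⟨Module.finrank_pos.ne', D.rep.dim, by rw [← IsoClass.dim_rep, D.dim_rep]⟩

variable {K : Type u} [Field K] [Algebra k K] [FiniteDimensional k K]

/-- Stable bricks over K correspond to pairs of a stable class t over k and an embedding σ of its
endomorphism field E into K, by K ⊗_E t. The canonical map from t recovers t and then σ. Conversely,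
a brick restricted to k has a k-stable subobject t, whose inclusion determines σ. An E of degree r
embeds exactly if r divides [K : k], and then in r ways; the bound N only keeps the index set
finite. -/
theorem brickCount_eq [Finite k] [∀ i j : I, Finite (i ⟶ j)] {α : I →₀ ℕ} {N : ℕ}
    (hN : Module.finrank k K * α.degree ≤ N) [DecidableEq (I →₀ ℕ)] :
    brickCount K φ α = ∑ t ∈ CompletedHall.stableClasses k φ N with
      t.dim = endDim t • α ∧ endDim t ∣ Module.finrank k K, endDim t := by
  set T := {t ∈ CompletedHall.stableClasses k φ N |
    t.dim = endDim t • α ∧ endDim t ∣ Module.finrank k K} with hT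
  have hTs : ∀ t : T, StableFor φ t.1.rep := fun t =>
    (CompletedHall.mem_stableClasses.1 (Finset.mem_filter.1 t.2).1).1
  let D : ∀ t : T, EndField t.1.rep := fun t => (hTs t).nonempty_endField.some
  have hr : ∀ t : T, Module.finrank k (D t).E = endDim t.1 := fun t => (D t).finrank_eq (hTs t).1
  have hE : ∀ t : T, Finite (D t).E := fun t => Module.finite_of_finite k
  have hKf : Finite K := Module.finite_of_finite k
  have hfin : ∀ t : T, Finite ((D t).E →ₐ[k] K) := fun t => DFunLike.finite _
  have hst : ∀ (t : T) (σ : (D t).E →ₐ[k] K),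
      StableFor φ (IsoClass.mk ((D t).ofAlgHom σ)).rep ∧
      IsBrick (IsoClass.mk ((D t).ofAlgHom σ)).rep ∧
      (IsoClass.mk ((D t).ofAlgHom σ)).dim = α := by
    intro t σ
    obtain ⟨e⟩ : Nonempty (Iso (IsoClass.mk ((D t).ofAlgHom σ)).rep ((D t).ofAlgHom σ)) :=
      IsoClass.mk_eq.1 (IsoClass.mk_rep _)
    refine ⟨((D t).stable_ofAlgHom σ (hTs t)).of_iso e.symm,
      ((D t).isBrick_ofAlgHom σ).of_iso e.symm, ?_⟩
    rw [IsoClass.dim_mk, (D t).dim_ofAlgHom]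
    have h1 := (D t).dim_rep
    have h2 := (Finset.mem_filter.1 t.2).2.1
    rw [IsoClass.dim_rep, h2, hr] at h1
    have h3 : endDim t.1 ≠ 0 := (exists_dim_eq_endDim_smul (hTs t)).1
    ext i
    have h4 := DFunLike.congr_fun h1 i
    rw [Finsupp.smul_apply, Finsupp.smul_apply, smul_eq_mul, smul_eq_mul] at h4
    exact (Nat.eq_of_mul_eq_mul_left (Nat.pos_of_ne_zero h3) h4).symm
  let Ψ : (Σ t : T, (D t).E →ₐ[k] K) →
      {c : IsoClass K I // StableFor φ c.rep ∧ IsBrick c.rep ∧ c.dim = α} :=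
    fun p => ⟨IsoClass.mk ((D p.1).ofAlgHom p.2), hst p.1 p.2⟩
  have hΨ : Function.Bijective Ψ := by
    constructor
    · rintro ⟨t, σ⟩ ⟨s, τ⟩ h
      obtain ⟨e⟩ := IsoClass.mk_eq.1 (congrArg Subtype.val h)
      obtain ⟨f, hf, hfσ⟩ := (D t).exists_hom_ofAlgHom σ (hTs t).1
      let g := (e.toHom.restrict k).comp f
      have hg : g ≠ 0 := by
        obtain ⟨i, x, hx⟩ := (Hom.ne_zero_iff f).1 hf
        exact (Hom.ne_zero_iff g).2 ⟨i, x, fun h0 => hx ((e.equiv i).map_eq_zero_iff.1 h0)⟩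
      have hgσ : ∀ a i (x : t.1.rep.V i), g.1 i ((D t).ρ a i x) = σ a • g.1 i x := by
        intro a i x
        exact (congrArg (e.equiv i) (hfσ a i x)).trans ((e.equiv i).map_smul _ _)
      have hts : t = s := by
        have h1 := IsoClass.mk_eq.2 ((D s).iso_of_hom_ofAlgHom τ (hTs s) (hTs t) hg)
        rw [IsoClass.mk_rep, IsoClass.mk_rep] at h1
        exact Subtype.ext h1
      subst hts
      rw [(D t).eq_of_hom_ofAlgHom τ hg hgσ]
    · rintro ⟨c, hc, hb, hα⟩
      have hss := hc.semi.restrict (k := k)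
      obtain ⟨A, hA⟩ := hss.exists_stable_sub hc.1
      let t := IsoClass.mk A.toRep
      obtain ⟨e⟩ : Nonempty (Iso t.rep A.toRep) := IsoClass.mk_eq.1 (IsoClass.mk_rep _)
      have ht : StableFor φ t.rep := hA.of_iso e.symm
      let f : Hom t.rep (restrict k c.rep) := A.inclHom.comp e.toHom
      have hf : f ≠ 0 := by
        obtain ⟨i, x, hx⟩ := (not_isZero_iff _).1 ht.1
        refine (Hom.ne_zero_iff f).2 ⟨i, x, fun h0 => hx ?_⟩
        refine (e.equiv i).map_eq_zero_iff.1 (A.inclHom_injective i ?_)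
        exact h0.trans (map_zero (A.inclHom.1 i)).symm
      obtain ⟨D'⟩ := ht.nonempty_endField
      obtain ⟨σ', hσ'⟩ := D'.exists_algHom ht hc hb hf
      obtain ⟨e'⟩ := D'.iso_of_hom ht hc hf hσ'
      have hdvd : endDim t ∣ Module.finrank k K := by
        rw [← D'.finrank_eq ht.1]
        exact FiniteField.nonempty_algHom_iff_finrank_dvd.1 ⟨σ'⟩
      have hdim : t.dim = endDim t • α := by
        rw [← IsoClass.dim_rep, D'.dim_rep, D'.finrank_eq ht.1, ← D'.dim_ofAlgHom σ', e'.dim_eq,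
          IsoClass.dim_rep, hα]
      have htT : t ∈ T := by
        refine Finset.mem_filter.2 ⟨CompletedHall.mem_stableClasses.2 ⟨ht, ?_⟩, hdim, hdvd⟩
        rw [hdim, map_nsmul, smul_eq_mul]
        exact (Nat.mul_le_mul_right _ (Nat.le_of_dvd Module.finrank_pos hdvd)).trans hN
      -- The auxiliary field D' was needed to see that t is in T; only now is the field chosen for t
      -- in the bijection available.
      obtain ⟨σ, hσ⟩ := (D ⟨t, htT⟩).exists_algHom ht hc hb hf
      refine ⟨⟨⟨t, htT⟩, σ⟩, Subtype.ext ?_⟩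
      refine (IsoClass.mk_eq.2 ((D ⟨t, htT⟩).iso_of_hom ht hc hf hσ)).trans c.mk_rep
  rw [brickCount, ← Nat.card_congr (Equiv.ofBijective Ψ hΨ), Nat.card_sigma,
    ← Finset.sum_coe_sort T]
  refine Finset.sum_congr rfl fun t _ => ?_
  rw [FiniteField.natCard_algHom_of_finrank_dvd, hr]
  rw [hr]
  exact (Finset.mem_filter.1 t.2).2.2

/-- A stable class of endomorphism degree r and dimension rγ contributes r/(n(1 - qⁿ)) for the pair
(n, γ) with r ∣ n. Putting n = rm, this is 1/(m(1 - Q^m)) with Q = q^r, the m-th coefficient of the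
logarithm of its q-exponential. -/
theorem coeff_stableLog [Finite k] [∀ i j : I, Finite (i ⟶ j)] {β : I →₀ ℕ} (hβ : β ≠ 0)
    (K : ℕ → Type u) [∀ n, Field (K n)] [∀ n, Algebra k (K n)] [∀ n, FiniteDimensional k (K n)]
    (hK : ∀ n ≠ 0, Module.finrank k (K n) = n) :
    MvPowerSeries.coeff β (CompletedHall.stableLog k φ) = ∑ p ∈ divisorPairs β,
      (p.1 : ℚ)⁻¹ * ((brickCount (K p.1) φ p.2 : ℚ) * (1 - (Nat.card k : ℚ) ^ p.1)⁻¹) := by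
  classical
  have h1 : ∀ p ∈ divisorPairs β, (p.1 : ℚ)⁻¹ *
      ((brickCount (K p.1) φ p.2 : ℚ) * (1 - (Nat.card k : ℚ) ^ p.1)⁻¹) =
      ∑ t ∈ CompletedHall.stableClasses k φ β.degree,
        if t.dim = endDim t • p.2 ∧ endDim t ∣ p.1 then
          (p.1 : ℚ)⁻¹ * ((endDim t : ℚ) * (1 - (Nat.card k : ℚ) ^ p.1)⁻¹) else 0 := by
    intro p hp
    rw [mem_divisorPairs hβ] at hp
    have hp0 : p.1 ≠ 0 := fun h => hβ (by rw [← hp, h, zero_smul])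
    rw [brickCount_eq (k := k) (N := β.degree) (by
      rw [hK _ hp0, ← smul_eq_mul, ← map_nsmul, hp]), hK _ hp0, ← Finset.sum_filter,
      Nat.cast_sum, Finset.sum_mul, Finset.mul_sum]
  rw [Finset.sum_congr rfl h1, Finset.sum_comm]
  refine Finset.sum_congr rfl fun t ht => ?_
  rw [CompletedHall.mem_stableClasses] at ht
  obtain ⟨hr, γ, hγ⟩ := exists_dim_eq_endDim_smul ht.1
  rw [MvPowerSeries.coeff_subst_monomial (CompletedHall.dim_ne_zero_of_stable ht.1) _
    (Nat.lt_succ_self _), ← Finset.sum_filter, ← Finset.sum_filter]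
  refine Finset.sum_bij' (fun m _ => (endDim t * m, γ)) (fun p _ => p.1 / endDim t) ?_ ?_ ?_ ?_ ?_
  · intro m hm
    rw [Finset.mem_filter] at hm ⊢
    rw [mem_divisorPairs hβ]
    refine ⟨?_, hγ, dvd_mul_right _ _⟩
    rw [← hm.2, hγ, smul_smul, mul_comm]
  · intro p hp
    rw [Finset.mem_filter, mem_divisorPairs hβ] at hp
    obtain ⟨hp, hd, m, hm⟩ := hp
    rw [hm, Nat.mul_div_cancel_left _ (Nat.pos_of_ne_zero hr), Finset.mem_filter]
    have h2 : m • t.dim = β := by rw [← hp, hm, hd, smul_smul, mul_comm]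
    refine ⟨Finset.mem_range.2 (Nat.lt_succ_of_le ?_), h2⟩
    rw [← h2, map_nsmul, smul_eq_mul]
    refine Nat.le_mul_of_pos_right _ (Nat.pos_of_ne_zero fun h => ?_)
    exact CompletedHall.dim_ne_zero_of_stable ht.1 ((Finsupp.degree_eq_zero_iff _).1 h)
  · intro m _
    exact Nat.mul_div_cancel_left _ (Nat.pos_of_ne_zero hr)
  · intro p hp
    rw [Finset.mem_filter, mem_divisorPairs hβ] at hp
    obtain ⟨hp, hd, hdvd⟩ := hp
    refine Prod.ext (Nat.mul_div_cancel' hdvd) ?_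
    ext i
    have h4 := DFunLike.congr_fun (hγ.symm.trans hd) i
    rw [Finsupp.smul_apply, Finsupp.smul_apply, smul_eq_mul, smul_eq_mul] at h4
    exact Nat.eq_of_mul_eq_mul_left (Nat.pos_of_ne_zero hr) h4
  · intro m hm
    have hr' : (endDim t : ℚ) ≠ 0 := Nat.cast_ne_zero.2 hr
    rw [qLog, PowerSeries.coeff_mk, card_end, Nat.cast_pow, ← pow_mul, Nat.cast_mul, mul_inv]
    field_simp

end Count

/-! ### Translation between slopes and additive functions. -/

section Slope

variable {I : Type w} [Fintype I]

/-- The additive function on dimension vectors whose sign compares the slope with `μ`. -/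
def slopeForm (θ : I → ℤ) (μ : ℚ) : (I →₀ ℕ) →+ ℚ where
  toFun α := ∑ i, ((θ i : ℚ) - μ) * (α i : ℚ)
  map_zero' := by simp
  map_add' α β := by
    rw [← Finset.sum_add_distrib]
    exact Finset.sum_congr rfl fun i _ => by push_cast [Finsupp.add_apply]; ring

theorem slopeForm_eq (θ : I → ℤ) (μ : ℚ) {α : I →₀ ℕ} (hα : α ≠ 0) :
    (0 : ℚ) < (∑ i, α i : ℕ) ∧
      slopeForm θ μ α = (dimSlope θ α - μ) * (∑ i, α i : ℕ) := by
  have h0 : (0 : ℚ) < (∑ i, α i : ℕ) := by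
    rw [Nat.cast_pos]
    obtain ⟨i, hi⟩ := Finsupp.ne_iff.1 hα
    exact (Nat.pos_of_ne_zero hi).trans_le (Finset.single_le_sum (f := fun i => α i)
      (fun _ _ => Nat.zero_le _) (Finset.mem_univ i))
  refine ⟨h0, ?_⟩
  rw [dimSlope, sub_mul, div_mul_cancel₀ _ h0.ne']
  change ∑ i, ((θ i : ℚ) - μ) * (α i : ℚ) = _
  push_cast
  rw [Finset.mul_sum, ← Finset.sum_sub_distrib]
  exact Finset.sum_congr rfl fun i _ => by ring

theorem slopeForm_eq_zero {θ : I → ℤ} {μ : ℚ} {α : I →₀ ℕ} (hα : α ≠ 0) :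
    slopeForm θ μ α = 0 ↔ dimSlope θ α = μ := by
  obtain ⟨h0, h1⟩ := slopeForm_eq θ μ hα
  rw [h1, mul_eq_zero, or_iff_left h0.ne', sub_eq_zero]

theorem slopeForm_neg {θ : I → ℤ} {μ : ℚ} {α : I →₀ ℕ} (hα : α ≠ 0) :
    slopeForm θ μ α < 0 ↔ dimSlope θ α < μ := by
  obtain ⟨h0, h1⟩ := slopeForm_eq θ μ hα
  rw [h1, mul_neg_iff, ← sub_neg (a := dimSlope θ α)]
  constructor
  · rintro (h | h)
    · exact absurd h.2 h0.le.not_gt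
    · exact h.1
  · exact fun h => Or.inr ⟨h, h0⟩

theorem slopeForm_nonpos {θ : I → ℤ} {μ : ℚ} {α : I →₀ ℕ} (hα : α ≠ 0) :
    slopeForm θ μ α ≤ 0 ↔ dimSlope θ α ≤ μ := by
  rw [le_iff_lt_or_eq, le_iff_lt_or_eq, slopeForm_neg hα, slopeForm_eq_zero hα]

variable {k : Type u} [Field k] [Quiver.{v} I] {θ : I → ℤ} {μ : ℚ} {M : QuiverRep k I}

theorem Sub.dim_ne_zero {U : Sub M} (hU : U.IsNonzero) : U.toRep.dim ≠ 0 := by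
  rw [Ne, Sub.dim_eq_zero]
  exact U.isNonzero_iff.1 hU

theorem stableFor_slopeForm_iff :
    StableFor (slopeForm θ μ) M ↔ M.IsStable θ ∧ dimSlope θ M.dim = μ := by
  constructor
  · rintro ⟨h0, h1, h2⟩
    have hM : M.dim ≠ 0 := fun h => h0 ((isZero_iff_dim M).2 h)
    have h3 := (slopeForm_eq_zero hM).1 h1
    refine ⟨⟨h0, fun U hU hU' => ?_⟩, h3⟩
    rw [h3, ← slopeForm_neg (Sub.dim_ne_zero hU)]
    exact h2 U (U.isNonzero_iff.1 hU) (U.isProper_iff.1 hU')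
  · rintro ⟨⟨h0, h2⟩, h3⟩
    have hM : M.dim ≠ 0 := fun h => h0 ((isZero_iff_dim M).2 h)
    refine ⟨h0, (slopeForm_eq_zero hM).2 h3, fun U hU hU' => ?_⟩
    have hU1 := U.isNonzero_iff.2 hU
    rw [slopeForm_neg (Sub.dim_ne_zero hU1), ← h3]
    exact h2 U hU1 (U.isProper_iff.2 hU')

theorem semiFor_slopeForm_iff : SemiFor (slopeForm θ μ) M ↔ M.IsSemistableOfSlope θ μ := by
  constructor
  · rintro ⟨h1, h2⟩
    by_cases h0 : M.IsZero
    · exact Or.inl h0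
    have hM : M.dim ≠ 0 := fun h => h0 ((isZero_iff_dim M).2 h)
    have h3 := (slopeForm_eq_zero hM).1 h1
    refine Or.inr ⟨⟨h0, fun U hU _ => ?_⟩, h3⟩
    rw [h3, ← slopeForm_nonpos (Sub.dim_ne_zero hU)]
    exact h2 U
  · rintro (h0 | ⟨⟨h0, h2⟩, h3⟩)
    · exact SemiFor.of_isZero h0
    have hM : M.dim ≠ 0 := fun h => h0 ((isZero_iff_dim M).2 h)
    refine ⟨(slopeForm_eq_zero hM).2 h3, fun U => ?_⟩
    by_cases hU : U = ⊥
    · simp [hU]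
    by_cases hU' : U = ⊤
    · rw [hU', Sub.dim_top]
      exact ((slopeForm_eq_zero hM).2 h3).le
    have hU1 := U.isNonzero_iff.2 hU
    rw [slopeForm_nonpos (Sub.dim_ne_zero hU1), ← h3]
    exact h2 U hU1 (U.isProper_iff.2 hU')

theorem semistableSum_eq [Finite k] :
    semistableSum k θ μ = CompletedHall.semiSum k (slopeForm θ μ) := by
  classical
  ext X
  rw [CompletedHall.semiSum_apply]
  refine if_congr ⟨?_, fun h => ⟨X, rfl, semiFor_slopeForm_iff.1 h⟩⟩ rfl rfl
  rintro ⟨N, hN, h⟩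
  obtain ⟨e⟩ := IsoClass.mk_eq.1 hN
  exact (semiFor_slopeForm_iff.2 h).of_iso e

/-- Let E be the endomorphism field of an absolutely stable M, of degree r. The canonical map from E
⊗_k M to M as a representation over E is a nonzero map of stables, hence an isomorphism; comparing
dimensions gives r = 1. The converse is the stability of bricks under extension of scalars. -/
theorem isAbsolutelyStable_iff [Finite k] (hμ : dimSlope θ M.dim = μ) :
    M.IsAbsolutelyStable θ ↔ StableFor (slopeForm θ μ) M ∧ IsBrick M := by
  constructor
  · rintro ⟨h1, h2⟩
    have hM : StableFor (slopeForm θ μ) M := stableFor_slopeForm_iff.2 ⟨h1, hμ⟩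
    refine ⟨hM, fun f => ?_⟩
    obtain ⟨D⟩ := hM.nonempty_endField
    have h3 : StableFor (slopeForm θ μ) (M.baseChange D.E) :=
      stableFor_slopeForm_iff.2 ⟨h2 D.E, by rw [baseChange_dim, hμ]⟩
    have h4 : D.restrictIso.symm.toHom ≠ 0 := by
      obtain ⟨i, x, hx⟩ := (not_isZero_iff M).1 hM.1
      exact (Hom.ne_zero_iff _).2 ⟨i, x, hx⟩
    let e : Iso (M.baseChange D.E) D.rep :=
      Iso.ofBijective _ (h3.bijective (D.stable_rep hM) (liftHom_ne_zero h4))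
    have h5 := e.dim_eq
    rw [baseChange_dim, D.dim_rep] at h5
    have h6 : Module.finrank k D.E = 1 := by
      obtain ⟨i, hi⟩ := Finsupp.ne_iff.1 fun h => (D.stable_rep hM).1 ((isZero_iff_dim _).2 h)
      have h7 := DFunLike.congr_fun h5 i
      rw [Finsupp.smul_apply, smul_eq_mul] at h7
      exact Nat.eq_of_mul_eq_mul_right (Nat.pos_of_ne_zero hi) (h7.trans (one_mul _).symm)
    obtain ⟨a, rfl⟩ := D.exists_hom_eq f
    obtain ⟨c, rfl⟩ := (finrank_eq_one_iff_of_nonzero' (1 : D.E) one_ne_zero).1 h6 a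
    refine ⟨c, Hom.ext' fun i x => ?_⟩
    rw [D.hom_apply, map_smul, map_one]
    rfl
  · rintro ⟨h1, h2⟩
    exact ⟨(stableFor_slopeForm_iff.1 h1).1, fun L _ _ _ =>
      (stableFor_slopeForm_iff.1 (h1.baseChange (K := L) h2)).1⟩

theorem absStableCount_eq_brickCount [Finite k] {α : I →₀ ℕ} (hμ : dimSlope θ α = μ) :
    absStableCount k θ α = brickCount k (slopeForm θ μ) α := by
  rw [absStableCount, brickCount, ← Nat.card_coe_set_eq]
  refine Nat.card_congr (Equiv.subtypeEquivRight fun c => ?_)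
  constructor
  · rintro ⟨M, rfl, hM, hs⟩
    obtain ⟨e⟩ : Nonempty (Iso (IsoClass.mk M).rep M) := IsoClass.mk_eq.1 (IsoClass.mk_rep _)
    obtain ⟨h1, h2⟩ := (isAbsolutelyStable_iff (hM ▸ hμ)).1 hs
    exact ⟨h1.of_iso e.symm, h2.of_iso e.symm, by rw [IsoClass.dim_mk, hM]⟩
  · rintro ⟨h1, h2, h3⟩
    have h4 : c.rep.dim = α := by rw [IsoClass.dim_rep, h3]
    exact ⟨c.rep, c.mk_rep, h4, (isAbsolutelyStable_iff (h4 ▸ hμ)).2 ⟨h1, h2⟩⟩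

end Slope

end QuiverRep

end

/-! ### Point counts of spaces of representations over a finite field. -/

noncomputable section


section FiniteLinearAlgebra

/-- The sum of a function which factors through a surjective linear map. -/
theorem sum_comp_of_surjective {k M N : Type*} [Field k] [AddCommGroup M] [Module k M]
    [AddCommGroup N] [Module k N] [Fintype M] [Fintype N] (L : M →ₗ[k] N)
    (hL : Function.Surjective L) (F : N → ℚ) :
    ∑ m, F (L m) = (Nat.card (LinearMap.ker L) : ℚ) * ∑ n, F n := by
  classical
  obtain ⟨s, hs⟩ := L.exists_rightInverse_of_surjective (LinearMap.range_eq_top.2 hL)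
  have hs' : ∀ n, L (s n) = n := fun n => LinearMap.congr_fun hs n
  have : Fintype (LinearMap.ker L) := Fintype.ofFinite _
  let e : M ≃ LinearMap.ker L × N :=
    { toFun := fun m => (⟨m - s (L m), by rw [LinearMap.mem_ker, map_sub, hs', sub_self]⟩, L m)
      invFun := fun p => p.1.1 + s p.2
      left_inv := fun m => sub_add_cancel _ _
      right_inv := fun p => by
        have h : L (p.1.1 + s p.2) = p.2 := by
          rw [map_add, hs', LinearMap.mem_ker.1 p.1.2, zero_add]
        refine Prod.ext (Subtype.ext ?_) h
        change p.1.1 + s p.2 - s (L (p.1.1 + s p.2)) = p.1.1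
        rw [h, add_sub_cancel_right] }
  rw [Fintype.sum_equiv e (fun m => F (L m)) (fun p => F p.2) fun _ => rfl, Fintype.sum_prod_type]
  change ∑ _x : LinearMap.ker L, ∑ n, F n = _
  rw [Finset.sum_const, nsmul_eq_mul, Finset.card_univ, Nat.card_eq_fintype_card]

variable {k : Type*} [Field k] [Finite k]

/-- The number of linearly independent families of `d` vectors in a space of dimension `n`. -/
def frameCount (q n d : ℕ) : ℕ := ∏ i ∈ Finset.range d, (q ^ n - q ^ i)

theorem frameCount_ne_zero {q : ℕ} (hq : 1 < q) (n : ℕ) : frameCount q n n ≠ 0 := by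
  refine Finset.prod_ne_zero_iff.2 fun i hi => ?_
  exact (Nat.sub_pos_of_lt (Nat.pow_lt_pow_right hq (Finset.mem_range.1 hi))).ne'

theorem card_frames (W : Type*) [AddCommGroup W] [Module k W] [FiniteDimensional k W] {d : ℕ}
    (hd : d ≤ Module.finrank k W) :
    Nat.card {s : Fin d → W // LinearIndependent k s} =
      frameCount (Nat.card k) (Module.finrank k W) d := by
  have := Fintype.ofFinite k
  have : Finite W := Module.finite_of_finite k
  rw [card_linearIndependent hd, frameCount, Finset.prod_range, Nat.card_eq_fintype_card]

/-- Linearly independent families are sorted by their span. -/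
theorem card_submodule_mul (W : Type*) [AddCommGroup W] [Module k W] [FiniteDimensional k W]
    {d : ℕ} (hd : d ≤ Module.finrank k W) :
    Nat.card {A : Submodule k W // Module.finrank k A = d} * frameCount (Nat.card k) d d =
      frameCount (Nat.card k) (Module.finrank k W) d := by
  classical
  have : Finite W := Module.finite_of_finite k
  let Ψ : (Σ A : {A : Submodule k W // Module.finrank k A = d},
      {s : Fin d → A.1 // LinearIndependent k s}) → {s : Fin d → W // LinearIndependent k s} :=
    fun p => ⟨fun i => (p.2.1 i : W), p.2.2.map' p.1.1.subtype (Submodule.ker_subtype _)⟩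
  have hspan : ∀ p, p.1.1 = Submodule.span k (Set.range (Ψ p).1) := by
    rintro ⟨⟨A, hA⟩, s, hs⟩
    symm
    refine Submodule.eq_of_le_of_finrank_eq (Submodule.span_le.2 ?_) ?_
    · rintro _ ⟨i, rfl⟩
      exact (s i).2
    · rw [finrank_span_eq_card (Ψ ⟨⟨A, hA⟩, s, hs⟩).2, Fintype.card_fin, hA]
  have hΨ : Function.Bijective Ψ := by
    constructor
    · intro p p' h
      have h1 : p.1 = p'.1 := Subtype.ext (by rw [hspan p, hspan p', h])
      obtain ⟨A, s, hs⟩ := p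
      obtain ⟨A', s', hs'⟩ := p'
      obtain rfl : A = A' := h1
      have h2 : s = s' := funext fun i => Subtype.ext (congrFun (congrArg Subtype.val h) i)
      subst h2
      rfl
    · rintro ⟨s, hs⟩
      refine ⟨⟨⟨Submodule.span k (Set.range s), ?_⟩, fun i => ⟨s i, Submodule.subset_span ⟨i, rfl⟩⟩,
        linearIndependent_span hs⟩, rfl⟩
      rw [finrank_span_eq_card hs, Fintype.card_fin]
  have hfin : Finite {A : Submodule k W // Module.finrank k A = d} := inferInstance
  have := Fintype.ofFinite {A : Submodule k W // Module.finrank k A = d}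
  rw [← card_frames W hd, ← Nat.card_congr (Equiv.ofBijective Ψ hΨ), Nat.card_sigma,
    Finset.sum_congr rfl fun A _ => (card_frames (k := k) A.1 (d := d) A.2.ge).trans
      (by rw [A.2]), Finset.sum_const, smul_eq_mul, Finset.card_univ, Nat.card_eq_fintype_card]

theorem card_linearEquiv (V W : Type*) [AddCommGroup V] [Module k V] [FiniteDimensional k V]
    [AddCommGroup W] [Module k W] [FiniteDimensional k W] {n : ℕ} (hV : Module.finrank k V = n)
    (hW : Module.finrank k W = n) :
    Nat.card (V ≃ₗ[k] W) = frameCount (Nat.card k) n n := by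
  let b := (Module.finBasisOfFinrankEq k V hV)
  have h := card_frames (k := k) W (d := n) hW.ge
  rw [hW] at h
  rw [← h]
  let F : (V ≃ₗ[k] W) → {s : Fin n → W // LinearIndependent k s} := fun e =>
    ⟨fun i => e (b i), b.linearIndependent.map' (e : V →ₗ[k] W) e.ker⟩
  refine Nat.card_congr (Equiv.ofBijective F ⟨fun e f hef => ?_, ?_⟩)
  · refine LinearEquiv.toLinearMap_injective (b.ext fun i => ?_)
    exact congrFun (congrArg Subtype.val hef) i
  · rintro ⟨s, hs⟩
    let c := basisOfLinearIndependentOfCardEqFinrank' s hs (by rw [Fintype.card_fin, hW])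
    refine ⟨b.equiv c (Equiv.refl _), Subtype.ext (funext fun i => ?_)⟩
    change b.equiv c (Equiv.refl _) (b i) = s i
    rw [Module.Basis.equiv_apply, Equiv.refl_apply]
    exact congrFun (coe_basisOfLinearIndependentOfCardEqFinrank' s hs _) i

end FiniteLinearAlgebra

namespace QuiverRep

variable {k : Type u} [Field k] {I : Type w} [Quiver.{v} I]

section Space

variable (k) in
/-- The space of representations with given vector spaces. -/
abbrev RepSpace (V : I → Type u) [∀ i, AddCommGroup (V i)] [∀ i, Module k (V i)] : Type _ :=
  ∀ p : (Σ i j : I, (i ⟶ j)), V p.1 →ₗ[k] V p.2.1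

variable {V W : I → Type u} [∀ i, AddCommGroup (V i)] [∀ i, Module k (V i)]
  [∀ i, FiniteDimensional k (V i)] [∀ i, AddCommGroup (W i)] [∀ i, Module k (W i)]
  [∀ i, FiniteDimensional k (W i)]

/-- The representation corresponding to a point of the space of representations. -/
def ofSpace (x : RepSpace k V) : QuiverRep k I where
  V := V
  map {i j} h := x ⟨i, j, h⟩

variable [Finite k] [Finite I] [∀ i j : I, Finite (i ⟶ j)]

instance finite_repSpace : Finite (RepSpace k V) := by
  have : ∀ a b : I, Finite (V a →ₗ[k] V b) := fun a b => Module.finite_of_finite k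
  infer_instance

instance fintypeRepSpace : Fintype (RepSpace k V) := Fintype.ofFinite _

variable (V) in
/-- The sum of a function of isomorphism classes over the space of representations. -/
def repSum (f : IsoClass k I → ℚ) : ℚ := ∑ x : RepSpace k V, f (IsoClass.mk (ofSpace x))

theorem repSum_congr (e : ∀ i, V i ≃ₗ[k] W i) (f : IsoClass k I → ℚ) :
    repSum V f = repSum W f := by
  let E : RepSpace k V ≃ RepSpace k W :=
    Equiv.piCongrRight fun p => ((e p.1).arrowCongr (e p.2.1)).toEquiv
  refine Fintype.sum_equiv E _ _ fun x => congrArg f (IsoClass.mk_eq.2 ⟨⟨e, fun {i j} h y => ?_⟩⟩)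
  change e j (x ⟨i, j, h⟩ y) = e j (x ⟨i, j, h⟩ ((e i).symm (e i y)))
  exact congrArg (fun z => e j (x ⟨i, j, h⟩ z)) ((e i).symm_apply_apply y).symm

/-- The sum over the space of representations of dimension vector `α`. -/
def stdSum (f : IsoClass k I → ℚ) (α : I →₀ ℕ) : ℚ := repSum (fun i => Fin (α i) → k) f

theorem repSum_eq_stdSum {α : I →₀ ℕ} (hV : ∀ i, Module.finrank k (V i) = α i)
    (f : IsoClass k I → ℚ) : repSum V f = stdSum f α :=
  repSum_congr (fun i => LinearEquiv.ofFinrankEq _ _ (by rw [hV, Module.finrank_fin_fun])) f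

theorem stdSum_congr {f g : IsoClass k I → ℚ} {α : I →₀ ℕ}
    (h : ∀ c : IsoClass k I, c.dim = α → f c = g c) : stdSum f α = stdSum g α :=
  Finset.sum_congr rfl fun _ _ => h _ (Finsupp.ext fun i =>
    (Module.finrank_fin_fun (R := k) : Module.finrank k (Fin (α i) → k) = α i))

open Classical in
-- Orbit and stabilizer: a point of the space together with an isomorphism to M is the same as a
-- family of linear isomorphisms to the spaces of M, along which the maps of M are transported.
theorem card_ofSpace_mul_cardAut (M : QuiverRep k I) {α : I →₀ ℕ} (hα : M.dim = α) [Fintype I] :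
    (Finset.univ.filter fun x : RepSpace k (fun i => Fin (α i) → k) =>
      IsoClass.mk (ofSpace x) = IsoClass.mk M).card * Nat.card (Iso M M) =
      ∏ i, frameCount (Nat.card k) (α i) (α i) := by
  let V : I → Type u := fun i => Fin (α i) → k
  have hV : ∀ i, Module.finrank k (V i) = α i := fun i => Module.finrank_fin_fun (R := k)
  let T := {x : RepSpace k V // IsoClass.mk (ofSpace x) = IsoClass.mk M}
  have hc : ∀ x : T, Nat.card (Iso (ofSpace x.1) M) = Nat.card (Iso M M) := by
    rintro ⟨x, hx⟩
    obtain ⟨e⟩ := IsoClass.mk_eq.1 hx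
    exact Nat.card_congr
      { toFun := fun f => e.symm.trans f
        invFun := fun f => e.trans f
        left_inv := fun f => Iso.ext' fun i y => by simp
        right_inv := fun f => Iso.ext' fun i y => by simp }
  let Ψ : (Σ x : T, Iso (ofSpace x.1) M) → (∀ i, V i ≃ₗ[k] M.V i) := fun p => p.2.equiv
  have hΨ : Function.Bijective Ψ := by
    constructor
    · rintro ⟨⟨x, hx⟩, e⟩ ⟨⟨y, hy⟩, f⟩ h
      have hef : e.equiv = f.equiv := h
      have hef' : ∀ i (z : V i), e.equiv i z = f.equiv i z := fun i z =>
        LinearEquiv.congr_fun (congrFun h i) z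
      have hxy : x = y := by
        funext p
        refine LinearMap.ext fun a => (e.equiv p.2.1).injective ?_
        have h1 : e.equiv p.2.1 (x p a) = M.map p.2.2 (e.equiv p.1 a) := e.comm p.2.2 a
        have h2 : f.equiv p.2.1 (y p a) = M.map p.2.2 (f.equiv p.1 a) := f.comm p.2.2 a
        exact h1.trans ((congrArg (M.map p.2.2) (hef' p.1 a)).trans
          (h2.symm.trans (hef' p.2.1 (y p a)).symm))
      subst hxy
      obtain rfl : e = f := Iso.ext hef
      rfl
    · intro e
      let x : RepSpace k V := fun p =>
        ((e p.2.1).symm : M.V p.2.1 →ₗ[k] V p.2.1) ∘ₗ M.map p.2.2 ∘ₗ (e p.1 : V p.1 →ₗ[k] M.V p.1)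
      let E : Iso (ofSpace x) M := ⟨e, fun {i j} h y => by
        change e j ((e j).symm (M.map h (e i y))) = _
        rw [LinearEquiv.apply_symm_apply]
        rfl⟩
      exact ⟨⟨⟨x, IsoClass.mk_eq.2 ⟨E⟩⟩, E⟩, rfl⟩
  have h1 := Nat.card_congr (Equiv.ofBijective Ψ hΨ)
  rw [Nat.card_sigma, Finset.sum_congr rfl fun x _ => hc x, Finset.sum_const, smul_eq_mul,
    Finset.card_univ, Nat.card_pi] at h1
  rw [← Fintype.card_subtype]
  refine h1.trans (Finset.prod_congr rfl fun i _ => ?_)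
  exact card_linearEquiv _ _ (hV i) (DFunLike.congr_fun hα i)

theorem coeff_hallIntegral_eq_stdSum [Fintype I] (f : CompletedHall k I) (α : I →₀ ℕ) :
    MvPowerSeries.coeff α (hallIntegral f) =
      stdSum f α / (∏ i, frameCount (Nat.card k) (α i) (α i) : ℕ) := by
  classical
  have h0 : ((∏ i, frameCount (Nat.card k) (α i) (α i) : ℕ) : ℚ) ≠ 0 :=
    Nat.cast_ne_zero.2 (Finset.prod_ne_zero_iff.2 fun i _ =>
      frameCount_ne_zero Finite.one_lt_card _)
  have hs : stdSum f α = ∑ x : RepSpace k (fun i => Fin (α i) → k), f (IsoClass.mk (ofSpace x)) :=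
    rfl
  rw [eq_div_iff h0, CompletedHall.coeff_hallIntegral, Finset.sum_mul, hs]
  rw [← Finset.sum_fiberwise_of_maps_to (t := (IsoClass.finite_dim_eq (k := k) α).toFinset)
    (g := fun x : RepSpace k (fun i => Fin (α i) → k) => IsoClass.mk (ofSpace x))]
  · refine Finset.sum_congr rfl fun c hc => ?_
    rw [Set.Finite.mem_toFinset, Set.mem_ofPred_eq] at hc
    have h1 := card_ofSpace_mul_cardAut c.rep ((IsoClass.dim_rep c).trans hc)
    rw [IsoClass.mk_rep] at h1
    have h2 : c.cardAut = Nat.card (Iso c.rep c.rep) := by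
      rw [← IsoClass.cardAut_mk, IsoClass.mk_rep]
    rw [Finset.sum_congr rfl fun x hx => congrArg f (Finset.mem_filter.1 hx).2, Finset.sum_const,
      nsmul_eq_mul, ← h1, ← h2, Nat.cast_mul]
    have := IsoClass.cardAut_ne_zero c
    field_simp
  · intro x _
    rw [Set.Finite.mem_toFinset, Set.mem_ofPred_eq]
    exact Finsupp.ext fun i =>
      (Module.finrank_fin_fun (R := k) : Module.finrank k (Fin (α i) → k) = α i)

/-- The points of the space of representations that preserve given subspaces. -/
def preserving (A : ∀ i, Submodule k (V i)) : Submodule k (RepSpace k V) where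
  carrier := {x | ∀ (p : Σ i j : I, (i ⟶ j)) (a : V p.1), a ∈ A p.1 → x p a ∈ A p.2.1}
  add_mem' := fun hx hy p a ha => (A p.2.1).add_mem (hx p a ha) (hy p a ha)
  zero_mem' := fun p _ _ => (A p.2.1).zero_mem
  smul_mem' := fun c _ hx p a ha => (A p.2.1).smul_mem c (hx p a ha)

/-- Restriction to the subspaces and the quotients. -/
def splitMap (A : ∀ i, Submodule k (V i)) :
    preserving A →ₗ[k] RepSpace k (fun i => A i) × RepSpace k (fun i => V i ⧸ A i) where
  toFun x := (fun p => (x.1 p).restrict (x.2 p), fun p => (A p.1).mapQ (A p.2.1) (x.1 p) (x.2 p))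
  map_add' _ _ := Prod.ext rfl (funext fun _ => Submodule.linearMap_qext _ rfl)
  map_smul' _ _ := Prod.ext rfl (funext fun _ => Submodule.linearMap_qext _ rfl)

theorem splitMap_surjective (A : ∀ i, Submodule k (V i)) : Function.Surjective (splitMap A) := by
  rintro ⟨a, b⟩
  choose π hπ using fun i => (A i).subtype.exists_leftInverse_of_injective (Submodule.ker_subtype _)
  choose s hs using fun i => (A i).mkQ.exists_rightInverse_of_surjective (Submodule.range_mkQ _)
  let x : RepSpace k V := fun p =>
    (A p.2.1).subtype ∘ₗ a p ∘ₗ π p.1 + s p.2.1 ∘ₗ b p ∘ₗ (A p.1).mkQ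
  have h1 : ∀ p (y : A p.1), x p y = a p y := by
    intro p y
    have h2 : π p.1 y = y := LinearMap.congr_fun (hπ p.1) y
    have h3 : (A p.1).mkQ y = 0 := (Submodule.Quotient.mk_eq_zero _).2 y.2
    simp only [x, LinearMap.add_apply, LinearMap.comp_apply, h2, h3, map_zero, add_zero,
      Submodule.subtype_apply]
  refine ⟨⟨x, fun p y hy => ?_⟩, Prod.ext (funext fun p => LinearMap.ext fun y =>
    Subtype.ext (h1 p y)) (funext fun p => Submodule.linearMap_qext _ (LinearMap.ext fun y => ?_))⟩
  · rw [h1 p ⟨y, hy⟩]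
    exact (a p ⟨y, hy⟩).2
  · change (A p.2.1).mkQ (x p y) = b p ((A p.1).mkQ y)
    simp only [x, LinearMap.add_apply, LinearMap.comp_apply, map_add]
    have h2 : (A p.2.1).mkQ ((A p.2.1).subtype (a p (π p.1 y))) = 0 :=
      (Submodule.Quotient.mk_eq_zero _).2 (a p (π p.1 y)).2
    rw [h2, zero_add]
    exact LinearMap.congr_fun (hs p.2.1) _

/-- The exponent in the formula for products. -/
def arrowPairing {I : Type w} [Quiver.{v} I] [Finite I] [∀ i j : I, Finite (i ⟶ j)]
    (δ ε : I →₀ ℕ) : ℕ :=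
  letI : Fintype (Σ i j : I, (i ⟶ j)) := Fintype.ofFinite _
  ∑ p : (Σ i j : I, (i ⟶ j)), ε p.1 * δ p.2.1

/-- A point that is zero on the subspaces and on the quotients is, arrow by arrow, an arbitrary
linear map from a quotient to a subspace. -/
theorem card_ker_splitMap (A : ∀ i, Submodule k (V i)) {δ ε : I →₀ ℕ}
    (hδ : ∀ i, Module.finrank k (A i) = δ i) (hε : ∀ i, Module.finrank k (V i ⧸ A i) = ε i) :
    Nat.card (LinearMap.ker (splitMap A)) = Nat.card k ^ arrowPairing δ ε := by
  let Ψ : (∀ p : (Σ i j : I, (i ⟶ j)), (V p.1 ⧸ A p.1) →ₗ[k] A p.2.1) →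
      LinearMap.ker (splitMap A) := fun y =>
    ⟨⟨fun p => (A p.2.1).subtype ∘ₗ y p ∘ₗ (A p.1).mkQ, fun p a _ => (y p _).2⟩, by
      refine Prod.ext (funext fun p => LinearMap.ext fun a => Subtype.ext ?_)
        (funext fun p => Submodule.linearMap_qext _ (LinearMap.ext fun a => ?_))
      · change ((y p ((A p.1).mkQ a) : A p.2.1) : V p.2.1) = 0
        rw [show (A p.1).mkQ (a : V p.1) = 0 from (Submodule.Quotient.mk_eq_zero _).2 a.2, map_zero]
        rfl
      · exact (Submodule.Quotient.mk_eq_zero _).2 (y p _).2⟩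
  have hΨ : Function.Bijective Ψ := by
    constructor
    · intro y z h
      funext p
      refine Submodule.linearMap_qext _ (LinearMap.ext fun a => Subtype.ext ?_)
      exact LinearMap.congr_fun (congrFun (congrArg Subtype.val (congrArg Subtype.val h)) p) a
    · rintro ⟨x, hx⟩
      have hx' := LinearMap.mem_ker.1 hx
      have h1 : ∀ p, A p.1 ≤ LinearMap.ker (x.1 p) := fun p a ha =>
        congrArg Subtype.val (LinearMap.congr_fun (congrFun (congrArg Prod.fst hx') p) ⟨a, ha⟩)
      have h2 : ∀ p a, x.1 p a ∈ A p.2.1 := fun p a =>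
        (Submodule.Quotient.mk_eq_zero _).1
          (LinearMap.congr_fun (congrFun (congrArg Prod.snd hx') p) ((A p.1).mkQ a))
      refine ⟨fun p => (A p.1).liftQ ((x.1 p).codRestrict (A p.2.1) (h2 p)) fun a ha =>
        Subtype.ext (h1 p ha),
          Subtype.ext (Subtype.ext (funext fun p => LinearMap.ext fun a => rfl))⟩
  have := Fintype.ofFinite (Σ i j : I, (i ⟶ j))
  rw [← Nat.card_congr (Equiv.ofBijective Ψ hΨ), Nat.card_pi, arrowPairing,
    ← Finset.prod_pow_eq_pow_sum]
  refine Finset.prod_congr (by congr; exact Subsingleton.elim _ _) fun p _ => ?_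
  rw [Module.natCard_eq_pow_finrank (K := k), Module.finrank_linearMap, hδ, hε]

theorem sum_preserving (A : ∀ i, Submodule k (V i)) {δ ε : I →₀ ℕ}
    (hδ : ∀ i, Module.finrank k (A i) = δ i) (hε : ∀ i, Module.finrank k (V i ⧸ A i) = ε i)
    (f g : IsoClass k I → ℚ) [Fintype (preserving A)] :
    ∑ x : preserving A, f (IsoClass.mk (ofSpace (splitMap A x).2)) *
        g (IsoClass.mk (ofSpace (splitMap A x).1)) =
      (Nat.card k : ℚ) ^ arrowPairing δ ε * (stdSum f ε * stdSum g δ) := by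
  rw [sum_comp_of_surjective (splitMap A) (splitMap_surjective A)
    (fun z => f (IsoClass.mk (ofSpace z.2)) * g (IsoClass.mk (ofSpace z.1))),
    card_ker_splitMap A hδ hε, Fintype.sum_prod_type, Nat.cast_pow]
  congr 1
  rw [← repSum_eq_stdSum (V := fun i => A i) hδ, ← repSum_eq_stdSum (V := fun i => V i ⧸ A i) hε,
    repSum, repSum, Finset.sum_mul_sum, Finset.sum_comm]

/-- The number of families of subspaces of given dimensions. -/
def subspaceCount [Fintype I] (k : Type u) [Field k] (δ γ : I →₀ ℕ) : ℕ :=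
  ∏ i, Nat.card {A : Submodule k (Fin (γ i) → k) // Module.finrank k A = δ i}

/-- The subrepresentation given by preserved subspaces. -/
def preservingSub (A : ∀ i, Submodule k (V i)) (x : preserving A) : Sub (ofSpace x.1) where
  space := A
  map_mem {i j} h _ ha := x.2 ⟨i, j, h⟩ _ ha

theorem mk_preservingSub_quotient (A : ∀ i, Submodule k (V i)) (x : preserving A) :
    IsoClass.mk (preservingSub A x).quotient = IsoClass.mk (ofSpace (splitMap A x).2) :=
  IsoClass.mk_eq.2 ⟨⟨fun i => LinearEquiv.refl k (V i ⧸ A i), fun _ _ => rfl⟩⟩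

theorem mk_preservingSub_toRep (A : ∀ i, Submodule k (V i)) (x : preserving A) :
    IsoClass.mk (preservingSub A x).toRep = IsoClass.mk (ofSpace (splitMap A x).1) :=
  IsoClass.mk_eq.2 ⟨⟨fun i => LinearEquiv.refl k (A i), fun _ _ => rfl⟩⟩

variable (V) in
/-- Subrepresentations of points of the space of representations. -/
def subEquiv (δ : I →₀ ℕ) :
    (Σ A : {A : ∀ i, Submodule k (V i) // ∀ i, Module.finrank k (A i) = δ i}, preserving A.1) ≃
      (Σ x : RepSpace k V, {U : Sub (ofSpace x) // U.toRep.dim = δ}) where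
  toFun z := ⟨z.2.1, ⟨preservingSub z.1.1 z.2, Finsupp.ext fun i => z.1.2 i⟩⟩
  invFun z := ⟨⟨z.2.1.space, fun i => DFunLike.congr_fun z.2.2 i⟩,
    ⟨z.1, fun p _ ha => z.2.1.map_mem p.2.2 ha⟩⟩
  left_inv _ := rfl
  right_inv _ := rfl

/-- The order of choice is reversed: the subspaces are fixed first, then the point preserving them.
Each family of subspaces contributes the same amount. -/
theorem sum_sub_dim_subtype {δ ε : I →₀ ℕ} (hV : ∀ i, Module.finrank k (V i) = δ i + ε i)
    (f g : IsoClass k I → ℚ)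
    [Fintype (Σ x : RepSpace k V, {U : Sub (ofSpace x) // U.toRep.dim = δ})] :
    ∑ z : (Σ x : RepSpace k V, {U : Sub (ofSpace x) // U.toRep.dim = δ}),
      f (IsoClass.mk z.2.1.quotient) * g (IsoClass.mk z.2.1.toRep) =
    (Nat.card {A : ∀ i, Submodule k (V i) // ∀ i, Module.finrank k (A i) = δ i} : ℚ) *
      ((Nat.card k : ℚ) ^ arrowPairing δ ε * (stdSum f ε * stdSum g δ)) := by
  have hVf : ∀ i, Finite (V i) := fun i => Module.finite_of_finite k
  have hB : ∀ (A : {A : ∀ i, Submodule k (V i) // ∀ i, Module.finrank k (A i) = δ i}) i,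
      Module.finrank k (V i ⧸ A.1 i) = ε i := by
    intro A i
    have h := Submodule.finrank_quotient_add_finrank (A.1 i)
    rw [A.2, hV] at h
    omega
  have := Fintype.ofFinite {A : ∀ i, Submodule k (V i) // ∀ i, Module.finrank k (A i) = δ i}
  have : ∀ A : {A : ∀ i, Submodule k (V i) // ∀ i, Module.finrank k (A i) = δ i},
    Fintype (preserving A.1) := fun A => Fintype.ofFinite _
  have h1 : ∀ z : (Σ A : {A : ∀ i, Submodule k (V i) // ∀ i, Module.finrank k (A i) = δ i},
      preserving A.1), f (IsoClass.mk (ofSpace (splitMap z.1.1 z.2).2)) *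
        g (IsoClass.mk (ofSpace (splitMap z.1.1 z.2).1)) =
      f (IsoClass.mk (subEquiv V δ z).2.1.quotient) *
        g (IsoClass.mk (subEquiv V δ z).2.1.toRep) := fun z => by
    have h2 : f (IsoClass.mk (ofSpace (splitMap z.1.1 z.2).2)) =
        f (IsoClass.mk (preservingSub z.1.1 z.2).quotient) :=
      congrArg f (mk_preservingSub_quotient z.1.1 z.2).symm
    have h3 : g (IsoClass.mk (ofSpace (splitMap z.1.1 z.2).1)) =
        g (IsoClass.mk (preservingSub z.1.1 z.2).toRep) :=
      congrArg g (mk_preservingSub_toRep z.1.1 z.2).symm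
    exact congrArg₂ (· * ·) h2 h3
  refine (Fintype.sum_equiv (subEquiv V δ) _ (fun z =>
    f (IsoClass.mk z.2.1.quotient) * g (IsoClass.mk z.2.1.toRep)) h1).symm.trans ?_
  rw [Fintype.sum_sigma]
  have h4 : ∀ A : {A : ∀ i, Submodule k (V i) // ∀ i, Module.finrank k (A i) = δ i}, _ :=
    fun A => sum_preserving A.1 A.2 (hB A) f g
  rw [Fintype.sum_congr _ _ h4, Finset.sum_const, nsmul_eq_mul, Finset.card_univ,
    Nat.card_eq_fintype_card
      (α := {A : ∀ i, Submodule k (V i) // ∀ i, Module.finrank k (A i) = δ i})]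

open Classical in
theorem sum_sub_dim [Fintype I] (δ ε : I →₀ ℕ) (f g : IsoClass k I → ℚ) :
    ∑ x : RepSpace k (fun i => Fin ((δ + ε) i) → k), ∑ U : Sub (ofSpace x) with U.toRep.dim = δ,
      f (IsoClass.mk U.quotient) * g (IsoClass.mk U.toRep) =
    (subspaceCount k δ (δ + ε) : ℚ) *
      ((Nat.card k : ℚ) ^ arrowPairing δ ε * (stdSum f ε * stdSum g δ)) := by
  have h1 : ∀ x : RepSpace k (fun i => Fin ((δ + ε) i) → k),
      ∑ U : Sub (ofSpace x) with U.toRep.dim = δ,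
      f (IsoClass.mk U.quotient) * g (IsoClass.mk U.toRep) =
      ∑ U : {U : Sub (ofSpace x) // U.toRep.dim = δ},
        f (IsoClass.mk U.1.quotient) * g (IsoClass.mk U.1.toRep) := fun x =>
    Finset.sum_subtype _ (fun U => Finset.mem_filter_univ U) _
  have h2 := sum_sub_dim_subtype (k := k) (V := fun i => Fin ((δ + ε) i) → k) (δ := δ) (ε := ε)
    (fun i => Module.finrank_fin_fun (R := k)) f g
  rw [Fintype.sum_sigma] at h2
  rw [Finset.sum_congr rfl fun x _ => h1 x, h2, subspaceCount, ← Nat.card_pi]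
  congr 2
  exact Nat.card_congr (Equiv.subtypePiEquivPi
    (p := fun i (A : Submodule k (Fin ((δ + ε) i) → k)) => Module.finrank k A = δ i))

open Classical in
/-- The basic formula for sums over subrepresentations. -/
theorem stdSum_of_eq_sum_sub [Fintype I] {γ : I →₀ ℕ} (T : IsoClass k I → ℚ)
    (f : (I →₀ ℕ) → IsoClass k I → ℚ) (g : IsoClass k I → ℚ)
    (hT : ∀ X : QuiverRep k I, X.dim = γ → T (IsoClass.mk X) =
      ∑ U : Sub X, f U.toRep.dim (IsoClass.mk U.quotient) * g (IsoClass.mk U.toRep)) :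
    stdSum T γ = ∑ p ∈ Finset.HasAntidiagonal.antidiagonal γ, (subspaceCount k p.1 γ : ℚ) *
      ((Nat.card k : ℚ) ^ arrowPairing p.1 p.2 * (stdSum (f p.1) p.2 * stdSum g p.1)) := by
  have h1 : ∀ x : RepSpace k (fun i => Fin (γ i) → k), T (IsoClass.mk (ofSpace x)) =
      ∑ p ∈ Finset.HasAntidiagonal.antidiagonal γ, ∑ U : Sub (ofSpace x) with U.toRep.dim = p.1,
        f p.1 (IsoClass.mk U.quotient) * g (IsoClass.mk U.toRep) := by
    intro x
    have hx : (ofSpace x).dim = γ := Finsupp.ext fun i =>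
      (Module.finrank_fin_fun (R := k) : Module.finrank k (Fin (γ i) → k) = γ i)
    rw [hT _ hx, ← Finset.sum_fiberwise_of_maps_to
      (t := Finset.HasAntidiagonal.antidiagonal γ)
      (g := fun U : Sub (ofSpace x) => (U.toRep.dim, U.quotient.dim))]
    · refine Finset.sum_congr rfl fun p hp => ?_
      rw [Finset.HasAntidiagonal.mem_antidiagonal] at hp
      refine Finset.sum_congr (Finset.filter_congr fun U _ => ?_) fun U hU => ?_
      · have h2 := U.dim_add_dim_quotient
        replace h2 := h2.trans (hx.trans hp.symm)
        refine ⟨fun h => congrArg Prod.fst h, fun h => Prod.ext h ?_⟩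
        rw [h] at h2
        exact add_left_cancel h2
      · rw [(Finset.mem_filter.1 hU).2]
    · intro U _
      exact Finset.HasAntidiagonal.mem_antidiagonal.2 (U.dim_add_dim_quotient.trans hx)
  rw [stdSum, repSum, Finset.sum_congr rfl fun x _ => h1 x, Finset.sum_comm]
  refine Finset.sum_congr rfl fun p hp => ?_
  rw [Finset.HasAntidiagonal.mem_antidiagonal] at hp
  subst hp
  exact sum_sub_dim p.1 p.2 (f p.1) g

end Space

end QuiverRep

end

/-! ### The ring in which the counting functions live. -/

noncomputable section


open Polynomial in
/-- The monic integral polynomials without integral zeros from `2` on. -/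
def countDenominators : Submonoid ℤ[X] where
  carrier := {D | D.Monic ∧ ∀ s : ℕ, 2 ≤ s → D.eval (s : ℤ) ≠ 0}
  mul_mem' := fun hD hE => ⟨hD.1.mul hE.1, fun s hs => by
    rw [Polynomial.eval_mul]
    exact mul_ne_zero (hD.2 s hs) (hE.2 s hs)⟩
  one_mem' := ⟨Polynomial.monic_one, fun s _ => by rw [Polynomial.eval_one]; exact one_ne_zero⟩

/-- The ring of rational functions with these denominators. -/
def CountRing : Type := Localization countDenominators

namespace CountRing

open Polynomial

instance : CommRing CountRing := inferInstanceAs (CommRing (Localization countDenominators))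

instance : Algebra ℤ[X] CountRing := inferInstanceAs (Algebra ℤ[X] (Localization countDenominators))

instance : IsLocalization countDenominators CountRing :=
  inferInstanceAs (IsLocalization countDenominators (Localization countDenominators))

theorem denominators_le : countDenominators ≤ nonZeroDivisors ℤ[X] := fun _ hD =>
  mem_nonZeroDivisors_of_ne_zero hD.1.ne_zero

instance : IsDomain CountRing :=
  IsLocalization.isDomain_of_le_nonZeroDivisors CountRing denominators_le

theorem algebraMap_injective : Function.Injective (algebraMap ℤ[X] CountRing) :=
  IsLocalization.injective CountRing denominators_le

instance : CharZero CountRing :=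
  charZero_of_injective_algebraMap algebraMap_injective

/-- The integral polynomials as elements. -/
abbrev ofPoly : ℤ[X] →+* CountRing := algebraMap ℤ[X] CountRing

theorem exists_mul_eq (x : CountRing) : ∃ P D : ℤ[X], D ∈ countDenominators ∧
    x * ofPoly D = ofPoly P := by
  obtain ⟨⟨P, D⟩, h⟩ := IsLocalization.surj countDenominators x
  exact ⟨P, D.1, D.2, h⟩

theorem isUnit_ofPoly {D : ℤ[X]} (hD : D ∈ countDenominators) : IsUnit (ofPoly D) :=
  IsLocalization.map_units CountRing (⟨D, hD⟩ : countDenominators)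

/-- Specialization at a number. -/
def ev (s : ℕ) (hs : 2 ≤ s) : CountRing →+* ℚ :=
  IsLocalization.lift (M := countDenominators)
    (g := (Int.castRingHom ℚ).comp (Polynomial.evalRingHom (s : ℤ))) fun D =>
      isUnit_iff_ne_zero.2 (Int.cast_ne_zero.2 (D.2.2 s hs))

theorem ev_ofPoly (s : ℕ) (hs : 2 ≤ s) (P : ℤ[X]) : ev s hs (ofPoly P) = (P.eval (s : ℤ) : ℤ) :=
  IsLocalization.lift_eq _ P

theorem ev_mul_eval {s : ℕ} (hs : 2 ≤ s) {x : CountRing} {P D : ℤ[X]}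
    (h : x * ofPoly D = ofPoly P) : ev s hs x * (D.eval (s : ℤ) : ℤ) = (P.eval (s : ℤ) : ℤ) := by
  rw [← ev_ofPoly s hs, ← ev_ofPoly s hs, ← map_mul, h]

/-- The elements as rational functions. -/
def toRat : CountRing →+* RatFunc ℚ :=
  IsLocalization.lift (M := countDenominators)
    (g := (algebraMap ℚ[X] (RatFunc ℚ)).comp (Polynomial.mapRingHom (Int.castRingHom ℚ))) fun D =>
      isUnit_iff_ne_zero.2 ((map_ne_zero_iff _ (RatFunc.algebraMap_injective ℚ)).2
        ((Polynomial.map_ne_zero_iff (Int.castRingHom ℚ).injective_int).2 D.2.1.ne_zero))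

theorem toRat_ofPoly (P : ℤ[X]) :
    toRat (ofPoly P) = algebraMap ℚ[X] (RatFunc ℚ) (P.map (Int.castRingHom ℚ)) :=
  IsLocalization.lift_eq _ P

theorem toRat_injective : Function.Injective toRat := by
  refine (injective_iff_map_eq_zero _).2 fun x hx => ?_
  obtain ⟨P, D, hD, h⟩ := exists_mul_eq x
  have h1 := congrArg toRat h
  rw [map_mul, hx, zero_mul, toRat_ofPoly] at h1
  have h2 : P = 0 := (Polynomial.map_eq_zero_iff (Int.castRingHom ℚ).injective_int).1
    ((map_eq_zero_iff _ (RatFunc.algebraMap_injective ℚ)).1 h1.symm)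
  rw [h2, map_zero] at h
  exact (mul_eq_zero.1 h).resolve_right (isUnit_ofPoly hD).ne_zero

theorem eval_map_cast (P : ℤ[X]) (s : ℕ) :
    (P.map (Int.castRingHom ℚ)).eval (s : ℚ) = (P.eval (s : ℤ) : ℤ) := by
  simp

/-- The reduced denominator divides an admissible one, which has no zero at s. -/
theorem toRat_regular {s : ℕ} (hs : 2 ≤ s) (x : CountRing) :
    (toRat x).denom.eval (s : ℚ) ≠ 0 ∧ (toRat x).eval (RingHom.id ℚ) (s : ℚ) = ev s hs x := by
  obtain ⟨P, D, hD, h⟩ := exists_mul_eq x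
  have hD0 : D.map (Int.castRingHom ℚ) ≠ 0 :=
    (Polynomial.map_ne_zero_iff (Int.castRingHom ℚ).injective_int).2 hD.1.ne_zero
  have h1 : toRat x = algebraMap ℚ[X] (RatFunc ℚ) (P.map (Int.castRingHom ℚ)) /
      algebraMap ℚ[X] (RatFunc ℚ) (D.map (Int.castRingHom ℚ)) := by
    rw [eq_div_iff ((map_ne_zero_iff _ (RatFunc.algebraMap_injective ℚ)).2 hD0), ← toRat_ofPoly,
      ← toRat_ofPoly, ← map_mul, h]
  have hDs : ((D.eval (s : ℤ) : ℤ) : ℚ) ≠ 0 := Int.cast_ne_zero.2 (hD.2 s hs)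
  have h2 : (toRat x).denom.eval (s : ℚ) ≠ 0 := by
    obtain ⟨c, hc⟩ := (RatFunc.denom_dvd hD0).2 ⟨_, h1⟩
    intro h3
    have h4 := congrArg (Polynomial.eval (s : ℚ)) hc
    rw [Polynomial.eval_mul, h3, zero_mul, eval_map_cast] at h4
    exact hDs h4
  refine ⟨h2, ?_⟩
  have h3 := congrArg (Polynomial.eval (s : ℚ)) ((RatFunc.num_mul_eq_mul_denom_iff hD0).2 h1)
  rw [Polynomial.eval_mul, Polynomial.eval_mul, eval_map_cast, eval_map_cast,
    ← ev_mul_eval hs h] at h3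
  rw [RatFunc.eval, ← Polynomial.eval_map, ← Polynomial.eval_map, Polynomial.map_id,
    Polynomial.map_id, div_eq_iff h2]
  refine mul_right_cancel₀ hDs ?_
  rw [h3]
  ring

theorem expand_mem {n : ℕ} (hn : n ≠ 0) {D : ℤ[X]} (hD : D ∈ countDenominators) :
    expand ℤ n D ∈ countDenominators := by
  refine ⟨hD.1.expand (Nat.pos_of_ne_zero hn), fun s hs => ?_⟩
  rw [Polynomial.expand_eval, ← Nat.cast_pow]
  exact hD.2 _ (hs.trans (Nat.le_self_pow hn s))

/-- The Adams operations. -/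
def psi (n : ℕ) : CountRing →+* CountRing :=
  if hn : n = 0 then RingHom.id _ else
    IsLocalization.map (M := countDenominators) (T := countDenominators) CountRing
      (expand ℤ n : ℤ[X] →+* ℤ[X]) (fun _ hD => expand_mem hn hD)

theorem psi_ofPoly {n : ℕ} (hn : n ≠ 0) (P : ℤ[X]) : psi n (ofPoly P) = ofPoly (expand ℤ n P) := by
  rw [psi, dif_neg hn]
  exact IsLocalization.map_eq _ P

theorem hom_ext {R : Type*} [CommRing R] {f g : CountRing →+* R}
    (h : ∀ P, f (ofPoly P) = g (ofPoly P)) : f = g :=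
  IsLocalization.ringHom_ext countDenominators (RingHom.ext h)

theorem psi_one (x : CountRing) : psi 1 x = x := by
  have : psi 1 = RingHom.id CountRing := hom_ext fun P => by
    rw [psi_ofPoly one_ne_zero, Polynomial.expand_one, RingHom.id_apply]
  rw [this, RingHom.id_apply]

theorem psi_psi {m n : ℕ} (hm : m ≠ 0) (hn : n ≠ 0) (x : CountRing) :
    psi m (psi n x) = psi (m * n) x := by
  have : (psi m).comp (psi n) = psi (m * n) := hom_ext fun P => by
    rw [RingHom.comp_apply, psi_ofPoly hn, psi_ofPoly hm, psi_ofPoly (mul_ne_zero hm hn),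
      Polynomial.expand_mul]
  exact RingHom.congr_fun this x

theorem ev_psi {s n : ℕ} (hs : 2 ≤ s) (hn : n ≠ 0) (hsn : 2 ≤ s ^ n) (x : CountRing) :
    ev s hs (psi n x) = ev (s ^ n) hsn x := by
  have : (ev s hs).comp (psi n) = ev (s ^ n) hsn := hom_ext fun P => by
    rw [RingHom.comp_apply, psi_ofPoly hn, ev_ofPoly, ev_ofPoly, Polynomial.expand_eval,
      Nat.cast_pow]
  exact RingHom.congr_fun this x

theorem ratFuncAdams_algebraMap {n : ℕ} (hn : n ≠ 0) (p : ℚ[X]) :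
    ratFuncAdams n hn (algebraMap ℚ[X] (RatFunc ℚ) p) =
      algebraMap ℚ[X] (RatFunc ℚ) (expand ℚ n p) := by
  have := RatFunc.map_apply_div (expand ℚ n : ℚ[X] →+* ℚ[X])
    (nonZeroDivisors_le_comap_nonZeroDivisors_of_injective _
      (Polynomial.expand_injective (Nat.pos_of_ne_zero hn))) p 1
  rw [map_one, map_one, map_one, div_one, div_one] at this
  exact this

theorem toRat_psi {n : ℕ} (hn : n ≠ 0) (x : CountRing) :
    toRat (psi n x) = ratFuncAdams n hn (toRat x) := by
  have : toRat.comp (psi n) = (ratFuncAdams n hn).comp toRat := hom_ext fun P => by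
    rw [RingHom.comp_apply, RingHom.comp_apply, psi_ofPoly hn, toRat_ofPoly, toRat_ofPoly,
      ratFuncAdams_algebraMap, Polynomial.map_expand]
  exact RingHom.congr_fun this x

/-- For an integral polynomial, P(q)^p and P(q^p) agree modulo p. A fraction P/D is reduced to this
by multiplying with the unit D^p·D(q^p). This is the integrality behind the plethystic logarithm,
and the reason for integral rather than rational coefficients. -/
theorem dvd_psi_sub_pow {p : ℕ} (hp : p.Prime) (x : CountRing) :
    (p : CountRing) ∣ x ^ p - psi p x := by
  have hP : ∀ P : ℤ[X], (p : ℤ[X]) ∣ P ^ p - expand ℤ p P := by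
    intro P
    have : Fact p.Prime := ⟨hp⟩
    have h1 : (P ^ p - expand ℤ p P).map (Int.castRingHom (ZMod p)) = 0 := by
      rw [Polynomial.map_sub, Polynomial.map_pow, Polynomial.map_expand, ZMod.expand_card, sub_self]
    have h2 : (C (p : ℤ)) ∣ P ^ p - expand ℤ p P := by
      rw [Polynomial.C_dvd_iff_dvd_coeff]
      intro i
      rw [← ZMod.intCast_zmod_eq_zero_iff_dvd]
      have := congrArg (fun Q => Polynomial.coeff Q i) h1
      rwa [Polynomial.coeff_map, eq_intCast, Polynomial.coeff_zero] at this
    simpa using h2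
  obtain ⟨P, D, hD, h⟩ := exists_mul_eq x
  have hDp := expand_mem hp.ne_zero hD
  have h' : psi p x * ofPoly (expand ℤ p D) = ofPoly (expand ℤ p P) := by
    rw [← psi_ofPoly hp.ne_zero, ← psi_ofPoly hp.ne_zero, ← map_mul, h]
  have hu : IsUnit (ofPoly D ^ p * ofPoly (expand ℤ p D)) :=
    ((isUnit_ofPoly hD).pow p).mul (isUnit_ofPoly hDp)
  rw [← hu.dvd_mul_right]
  have h3 : (x ^ p - psi p x) * (ofPoly D ^ p * ofPoly (expand ℤ p D)) =
      ofPoly (P ^ p - expand ℤ p P) * ofPoly (expand ℤ p D) -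
        ofPoly (expand ℤ p P) * ofPoly (D ^ p - expand ℤ p D) := by
    simp only [map_sub, map_pow, ← h, ← h']
    ring
  rw [h3, ← map_natCast ofPoly p]
  exact dvd_sub (dvd_mul_of_dvd_left (_root_.map_dvd _ (hP P)) _)
    (dvd_mul_of_dvd_right (_root_.map_dvd _ (hP D)) _)

/-- An element with integral values is a polynomial. -/
theorem exists_eq_ofPoly (x : CountRing)
    (h : ∀ N : ℕ, ∃ s, ∃ hs : 2 ≤ s, N ≤ s ∧ ∃ z : ℤ, ev s hs x = z) : ∃ P, x = ofPoly P := by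
  obtain ⟨P, D, hD, hx⟩ := exists_mul_eq x
  set R := P %ₘ D
  set Q := P /ₘ D
  have hPD : R + D * Q = P := Polynomial.modByMonic_add_div P D
  -- Write x = Q + R/D with deg R < deg D, possible over ℤ since D is monic. Wherever x is integral
  -- so is R/D; but R/D tends to zero, so R vanishes at arbitrarily large integers and R = 0.
  have hlim : Filter.Tendsto (fun t : ℝ => (R.map (Int.castRingHom ℝ)).eval t /
      (D.map (Int.castRingHom ℝ)).eval t) Filter.atTop (nhds 0) := by
    refine Polynomial.div_tendsto_atTop_zero_of_degree_lt _ _ ?_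
    rw [Polynomial.degree_map_eq_of_injective (Int.castRingHom ℝ).injective_int,
      Polynomial.degree_map_eq_of_injective (Int.castRingHom ℝ).injective_int]
    exact Polynomial.degree_modByMonic_lt P hD.1
  have h1 : ∀ᶠ t : ℕ in Filter.atTop,
      |((R.eval (t : ℤ) : ℤ) : ℝ) / ((D.eval (t : ℤ) : ℤ) : ℝ)| < 1 := by
    have h2 := (hlim.comp tendsto_natCast_atTop_atTop).abs.eventually_lt_const
      (u := (1 : ℝ)) (by simp)
    refine h2.mono fun t ht => ?_
    have h3 : ∀ P : ℤ[X], (P.map (Int.castRingHom ℝ)).eval (t : ℝ) =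
        ((P.eval (t : ℤ) : ℤ) : ℝ) := by
      intro P
      simp
    rw [Function.comp_apply, h3, h3] at ht
    exact ht
  obtain ⟨N, hN⟩ := Filter.eventually_atTop.1 h1
  have hR : R = 0 := by
    by_contra hR0
    obtain ⟨B, hB⟩ : ∃ B : ℕ, ∀ s : ℕ, B ≤ s → R.eval (s : ℤ) ≠ 0 := by
      have hfin : Set.Finite {s : ℕ | R.eval (s : ℤ) = 0} :=
        Set.Finite.of_finite_image (f := fun s : ℕ => (s : ℤ))
          ((R.roots.toFinset.finite_toSet).subset (by
            rintro _ ⟨s, hs, rfl⟩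
            simpa [hR0] using hs)) (Nat.cast_injective.injOn)
      obtain ⟨B, hB⟩ := hfin.bddAbove
      exact ⟨B + 1, fun s hs h0 => absurd (hB h0) (by omega)⟩
    obtain ⟨s, hs, hsN, z, hz⟩ := h (max N B)
    have h3 := ev_mul_eval hs hx
    rw [hz, ← hPD, Polynomial.eval_add, Polynomial.eval_mul] at h3
    have hDs := hD.2 s hs
    have h4 : R.eval (s : ℤ) = D.eval (s : ℤ) * (z - Q.eval (s : ℤ)) := by
      have h5 : z * D.eval (s : ℤ) = R.eval (s : ℤ) + D.eval (s : ℤ) * Q.eval (s : ℤ) := by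
        exact_mod_cast h3
      linear_combination -h5
    have h6 := hN s (le_of_max_le_left hsN)
    rw [h4, Int.cast_mul, mul_div_cancel_left₀ _ (Int.cast_ne_zero.2 hDs)] at h6
    have h7 : |z - Q.eval (s : ℤ)| < 1 := by exact_mod_cast h6
    have h8 : z - Q.eval (s : ℤ) = 0 := Int.abs_lt_one_iff.1 h7
    rw [h8, mul_zero] at h4
    exact hB s (le_of_max_le_right hsN) h4
  refine ⟨Q, ?_⟩
  rw [hR, zero_add] at hPD
  rw [← hPD, map_mul, mul_comm] at hx
  exact mul_left_cancel₀ (isUnit_ofPoly hD).ne_zero hx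

end CountRing

/-! ### Dwork's lemma for commuting Frobenius lifts. -/

section Ghost

/-- A family of commuting Frobenius lifts. -/
structure FrobeniusLifts (S : Type*) [CommRing S] where
  psi : ℕ → S →+* S
  psi_one : ∀ x, psi 1 x = x
  psi_psi : ∀ m n : ℕ, m ≠ 0 → n ≠ 0 → ∀ x, psi m (psi n x) = psi (m * n) x
  dvd : ∀ p : ℕ, p.Prime → ∀ x, (p : S) ∣ x ^ p - psi p x

variable {S : Type*} [CommRing S]

/-- Distinct prime powers are comaximal in ℤ, hence in every commutative ring. -/
theorem natCast_dvd_of_prime_pow {g : ℕ} (hg : g ≠ 0) {x : S}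
    (h : ∀ p, p.Prime → p ∣ g → ((p ^ g.factorization p : ℕ) : S) ∣ x) : (g : S) ∣ x := by
  rw [← Nat.prod_factorization_pow_eq_self hg, Finsupp.prod, Nat.cast_prod]
  refine Finset.prod_dvd_of_coprime ?_ fun p hp => ?_
  · intro p hp q hq hpq
    have h1 : IsCoprime ((p ^ g.factorization p : ℕ) : ℤ) ((q ^ g.factorization q : ℕ) : ℤ) :=
      Nat.isCoprime_iff_coprime.2 (Nat.coprime_pow_primes _ _ (Nat.prime_of_mem_primeFactors hp)
        (Nat.prime_of_mem_primeFactors hq) hpq)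
    have h2 := h1.map (Int.castRingHom S)
    rwa [map_natCast, map_natCast] at h2
  · exact h p (Nat.prime_of_mem_primeFactors hp) (Nat.dvd_of_mem_primeFactors hp)

theorem pow_factorization_dvd {p g d : ℕ} (hp : p.Prime) (hg : g ≠ 0) (hd : d ∣ g)
    (hpg : p ∣ g) (h : ¬ d ∣ g / p) : p ^ g.factorization p ∣ d := by
  have hd0 : d ≠ 0 := ne_zero_of_dvd_ne_zero hg hd
  have hgp : g / p ≠ 0 := (Nat.div_pos (Nat.le_of_dvd (Nat.pos_of_ne_zero hg) hpg) hp.pos).ne'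
  rw [hp.pow_dvd_iff_le_factorization hd0]
  by_contra! hlt
  refine h ((Nat.factorization_le_iff_dvd hd0 hgp).1 fun q => ?_)
  rw [Nat.factorization_div hpg, Finsupp.tsub_apply, hp.factorization]
  have h1 := (Nat.factorization_le_iff_dvd hd0 hg).2 hd q
  by_cases hq : q = p
  · subst hq
    rw [Finsupp.single_eq_same]
    omega
  · rw [Finsupp.single_eq_of_ne hq]
    exact h1

namespace FrobeniusLifts

variable (Φ : FrobeniusLifts S)

/-- A congruence modulo p improves to one modulo p^(j+1) under the p^j-th power. -/
theorem pow_dvd {p : ℕ} (hp : p.Prime) (x : S) (m : ℕ) :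
    ((p ^ (m.factorization p + 1) : ℕ) : S) ∣ x ^ (p * m) - Φ.psi p x ^ m := by
  obtain ⟨j, m', hm⟩ : ∃ j m', m = p ^ j * m' ∧ m.factorization p = j :=
    ⟨_, _, (Nat.ordProj_mul_ordCompl_eq_self m p).symm, rfl⟩
  have h1 := dvd_sub_pow_of_dvd_sub (Φ.dvd p hp x) (m.factorization p)
  rw [← hm.2] at hm
  rw [Nat.cast_pow]
  refine h1.trans ?_
  conv_rhs => rw [pow_mul, hm.1, pow_mul, pow_mul (Φ.psi p x)]
  exact sub_dvd_pow_sub_pow _ _ _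

/-- The condition on `b` at `g`. -/
def Ghost (u b : ℕ → S) (g : ℕ) : Prop :=
  ∑ d ∈ g.divisors, (d : S) * u d ^ (g / d) = ∑ d ∈ g.divisors, (d : S) * Φ.psi (g / d) (b d)

/-- It is checked one prime power at a time. For p ∣ g, the terms whose d does not divide g/p are
divisible by the p-part of g, since d already is. The remaining terms with b are the image under ψ_p
of the ghost equation at g/p, and differ from those with u by the congruence between x^(pm) and
ψ_p(x)^m. -/
theorem dvd_ghost {u b : ℕ → S} {g : ℕ} (hg : g ≠ 0)
    (h : ∀ g' < g, g' ≠ 0 → Φ.Ghost u b g') :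
    (g : S) ∣ ∑ d ∈ g.divisors, (d : S) * u d ^ (g / d) -
      ∑ d ∈ g.properDivisors, (d : S) * Φ.psi (g / d) (b d) := by
  classical
  refine natCast_dvd_of_prime_pow hg fun p hp hpg => ?_
  obtain ⟨g', rfl⟩ := hpg
  have hg' : g' ≠ 0 := right_ne_zero_of_mul hg
  have hlt : g' < p * g' := lt_mul_left (Nat.pos_of_ne_zero hg') hp.one_lt
  have hdiv : p * g' / p = g' := Nat.mul_div_cancel_left _ hp.pos
  have hsub : g'.divisors ⊆ (p * g').properDivisors := fun d hd => by
    rw [Nat.mem_properDivisors]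
    have := Nat.dvd_of_mem_divisors hd
    exact ⟨this.mul_left p, (Nat.le_of_dvd (Nat.pos_of_ne_zero hg') this).trans_lt hlt⟩
  have hsub' : g'.divisors ⊆ (p * g').divisors :=
    hsub.trans (Nat.properDivisors_subset_divisors)
  have hq : ∀ d ∈ g'.divisors, p * g' / d = p * (g' / d) := fun d hd =>
    Nat.mul_div_assoc p (Nat.dvd_of_mem_divisors hd)
  have hq0 : ∀ d ∈ g'.divisors, g' / d ≠ 0 := fun d hd =>
    (Nat.div_pos (Nat.le_of_dvd (Nat.pos_of_ne_zero hg') (Nat.dvd_of_mem_divisors hd))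
      (Nat.pos_of_mem_divisors hd)).ne'
  rw [← Finset.sum_sdiff hsub, ← Finset.sum_sdiff hsub', add_sub_add_comm]
  have hout : ∀ d, d ∣ p * g' → d ∉ g'.divisors →
      ((p ^ (p * g').factorization p : ℕ) : S) ∣ (d : S) := fun d hd hd' =>
    Nat.cast_dvd_cast (pow_factorization_dvd hp hg hd (dvd_mul_right _ _) fun h1 =>
      hd' (Nat.mem_divisors.2 ⟨hdiv ▸ h1, hg'⟩))
  refine dvd_add (dvd_sub (Finset.dvd_sum fun d hd => ?_) (Finset.dvd_sum fun d hd => ?_)) ?_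
  · rw [Finset.mem_sdiff] at hd
    exact (hout d (Nat.dvd_of_mem_divisors hd.1) hd.2).mul_right _
  · rw [Finset.mem_sdiff, Nat.mem_properDivisors] at hd
    exact (hout d hd.1.1 hd.2).mul_right _
  · have h1 := congrArg (Φ.psi p) (h g' hlt hg')
    rw [map_sum, map_sum] at h1
    have h2 : ∑ d ∈ g'.divisors, (d : S) * Φ.psi (p * g' / d) (b d) =
        ∑ d ∈ g'.divisors, (d : S) * Φ.psi p (u d) ^ (g' / d) := by
      refine Eq.trans (Finset.sum_congr rfl fun d hd => ?_)
        (h1.symm.trans (Finset.sum_congr rfl fun d hd => ?_))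
      · rw [map_mul, map_natCast, Φ.psi_psi _ _ hp.ne_zero (hq0 d hd), hq d hd]
      · rw [map_mul, map_natCast, map_pow]
    rw [h2, ← Finset.sum_sub_distrib]
    refine Finset.dvd_sum fun d hd => ?_
    rw [← mul_sub, hq d hd]
    have hd0 : d ≠ 0 := (Nat.pos_of_mem_divisors hd).ne'
    have h3 : (p * g').factorization p = d.factorization p + ((g' / d).factorization p + 1) := by
      have h4 : d * (g' / d) = g' := Nat.mul_div_cancel' (Nat.dvd_of_mem_divisors hd)
      conv_lhs => rw [← h4]
      rw [Nat.factorization_mul hp.ne_zero (mul_ne_zero hd0 (hq0 d hd)),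
        Nat.factorization_mul hd0 (hq0 d hd), Finsupp.add_apply, Finsupp.add_apply,
        hp.factorization_self]
      ring
    rw [h3, pow_add, Nat.cast_mul]
    exact mul_dvd_mul (Nat.cast_dvd_cast (Nat.ordProj_dvd d p)) (Φ.pow_dvd hp (u d) (g' / d))

open Classical in
/-- The solution of the ghost equations. -/
def ghostSolution (u : ℕ → S) : ℕ → S := fun g =>
  -- Solving the equation at g for its top term requires divisibility by g, which holds by
  -- `dvd_ghost`; the default value never occurs at g ≠ 0.
  if h : ∃ c, (g : S) * c = ∑ d ∈ g.divisors, (d : S) * u d ^ (g / d) -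
      ∑ d ∈ g.properDivisors.attach, (d.1 : S) * Φ.psi (g / d.1)
        (ghostSolution u d.1) then h.choose else 0
termination_by g => g
decreasing_by exact (Nat.mem_properDivisors.1 d.2).2

theorem ghost_ghostSolution (u : ℕ → S) {g : ℕ} (hg : g ≠ 0) :
    Φ.Ghost u (Φ.ghostSolution u) g := by
  induction g using Nat.strong_induction_on with
  | h g ih =>
  have h1 := Φ.dvd_ghost hg ih
  have h2 : ∃ c, (g : S) * c = ∑ d ∈ g.divisors, (d : S) * u d ^ (g / d) -
      ∑ d ∈ g.properDivisors.attach, (d.1 : S) * Φ.psi (g / d.1) (Φ.ghostSolution u d.1) := by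
    obtain ⟨c, hc⟩ := h1
    exact ⟨c, by rw [← hc, Finset.sum_attach g.properDivisors
      (fun d => (d : S) * Φ.psi (g / d) (Φ.ghostSolution u d))]⟩
  have h3 : (g : S) * Φ.ghostSolution u g = ∑ d ∈ g.divisors, (d : S) * u d ^ (g / d) -
      ∑ d ∈ g.properDivisors, (d : S) * Φ.psi (g / d) (Φ.ghostSolution u d) := by
    rw [← Finset.sum_attach g.properDivisors
      (fun d => (d : S) * Φ.psi (g / d) (Φ.ghostSolution u d))]
    conv_lhs => rw [ghostSolution, dif_pos h2]
    exact h2.choose_spec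
  rw [Ghost, ← Nat.insert_self_properDivisors hg,
    Finset.sum_insert (f := fun d : ℕ => (d : S) * Φ.psi (g / d) (Φ.ghostSolution u d))
      Nat.self_notMem_properDivisors, Nat.insert_self_properDivisors hg,
    Nat.div_self (Nat.pos_of_ne_zero hg), Φ.psi_one, h3]
  ring

end FrobeniusLifts

end Ghost

/-- The Frobenius lifts of the ring of counting functions. -/
def CountRing.lifts : FrobeniusLifts CountRing where
  psi := CountRing.psi
  psi_one := CountRing.psi_one
  psi_psi _ _ hm hn x := CountRing.psi_psi hm hn x
  dvd _ hp x := CountRing.dvd_psi_sub_pow hp x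

end

/-! ### Factorization of a power series into geometric series. -/

noncomputable section


section GeometricProduct

variable {σ : Type*} {F : Type*} [Field F]

theorem fst_ne_zero_of_mem_divisorPairs {β : σ →₀ ℕ} (hβ : β ≠ 0) {p : ℕ × (σ →₀ ℕ)}
    (hp : p ∈ divisorPairs β) : p.1 ≠ 0 := fun h => hβ (by
  rw [← (mem_divisorPairs hβ).1 hp, h, zero_smul])

theorem snd_ne_zero_of_mem_divisorPairs {β : σ →₀ ℕ} (hβ : β ≠ 0) {p : ℕ × (σ →₀ ℕ)}
    (hp : p ∈ divisorPairs β) : p.2 ≠ 0 := fun h => hβ (by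
  rw [← (mem_divisorPairs hβ).1 hp, h, smul_zero])

theorem mul_degree_of_mem_divisorPairs {β : σ →₀ ℕ} (hβ : β ≠ 0) {p : ℕ × (σ →₀ ℕ)}
    (hp : p ∈ divisorPairs β) : p.1 * p.2.degree = β.degree := by
  rw [← (mem_divisorPairs hβ).1 hp, map_nsmul, smul_eq_mul]

theorem degree_le_of_mem_divisorPairs {β : σ →₀ ℕ} (hβ : β ≠ 0) {p : ℕ × (σ →₀ ℕ)}
    (hp : p ∈ divisorPairs β) : p.2.degree ≤ β.degree := by
  rw [← mul_degree_of_mem_divisorPairs hβ hp]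
  exact Nat.le_mul_of_pos_left _ (Nat.pos_of_ne_zero (fst_ne_zero_of_mem_divisorPairs hβ hp))

theorem divisorPairs_zero : divisorPairs (0 : σ →₀ ℕ) = ∅ := by
  classical
  rw [divisorPairs, map_zero, Finset.Icc_eq_empty (by norm_num), Finset.empty_product,
    Finset.filter_empty]

/-- The geometric series. -/
def geomSeries (c : F) : PowerSeries F := PowerSeries.mk fun n => c ^ n

/-- The logarithm of the geometric series. -/
def geomLog (c : F) : PowerSeries F := PowerSeries.mk fun n => (n : F)⁻¹ * c ^ n

theorem derivative_geomSeries [CharZero F] (c : F) : PowerSeries.derivative F (geomSeries c) =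
    PowerSeries.derivative F (geomLog c) * geomSeries c := by
  ext n
  rw [PowerSeries.coeff_derivative, PowerSeries.coeff_mul, geomSeries, PowerSeries.coeff_mk,
    Finset.sum_congr rfl (g := fun _ => c ^ (n + 1))]
  · rw [Finset.sum_const, Finset.Nat.card_antidiagonal, nsmul_eq_mul]
    push_cast
    ring
  · intro p hp
    rw [← Finset.HasAntidiagonal.mem_antidiagonal.1 hp, PowerSeries.coeff_derivative, geomLog,
      PowerSeries.coeff_mk, PowerSeries.coeff_mk]
    have h : (p.1 : F) + 1 ≠ 0 := Nat.cast_add_one_ne_zero _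
    push_cast
    field_simp
    ring

theorem isLog_geomSeries [CharZero F] (c : F) {β : σ →₀ ℕ} (hβ : β ≠ 0) :
    MvPowerSeries.IsLog ((geomLog c).subst (MvPowerSeries.monomial β (1 : F)))
      ((geomSeries c).subst (MvPowerSeries.monomial β (1 : F))) :=
  MvPowerSeries.isLog_subst_monomial hβ (by simp [geomSeries]) (derivative_geomSeries c)

open scoped Classical in
theorem coeff_geomLog_subst (c : F) {β γ : σ →₀ ℕ} (hβ : β ≠ 0) (hγ : γ ≠ 0) :
    MvPowerSeries.coeff γ ((geomLog c).subst (MvPowerSeries.monomial β (1 : F))) =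
      ∑ p ∈ divisorPairs γ, if p.2 = β then (p.1 : F)⁻¹ * c ^ p.1 else 0 := by
  rw [MvPowerSeries.coeff_subst_monomial hβ _ (Nat.lt_succ_self _), ← Finset.sum_filter,
    ← Finset.sum_filter]
  refine Finset.sum_bij' (fun n _ => (n, β)) (fun p _ => p.1) ?_ ?_ ?_ ?_ ?_
  · intro n hn
    rw [Finset.mem_filter] at hn
    exact Finset.mem_filter.2 ⟨(mem_divisorPairs hγ).2 hn.2, rfl⟩
  · intro p hp
    rw [Finset.mem_filter] at hp
    have h1 := mul_degree_of_mem_divisorPairs hγ hp.1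
    refine Finset.mem_filter.2 ⟨Finset.mem_range.2 (Nat.lt_succ_of_le ?_), ?_⟩
    · rw [← h1]
      exact Nat.le_mul_of_pos_right _ (Nat.pos_of_ne_zero fun h =>
        snd_ne_zero_of_mem_divisorPairs hγ hp.1 ((Finsupp.degree_eq_zero_iff _).1 h))
    · rw [← hp.2]
      exact (mem_divisorPairs hγ).1 hp.1
  · intro n _
    rfl
  · intro p hp
    exact Prod.ext rfl (Finset.mem_filter.1 hp).2.symm
  · intro n _
    exact PowerSeries.coeff_mk _ _

variable [Finite σ]

/-- The nonzero exponents of a given degree. -/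
def exponents (σ : Type*) [Finite σ] (N : ℕ) : Finset (σ →₀ ℕ) :=
  ((Finsupp.finite_of_degree_le (σ := σ) N).subset
    (t := {β : σ →₀ ℕ | β ≠ 0 ∧ β.degree = N}) fun _ h => h.2.le).toFinset

theorem mem_exponents {N : ℕ} {β : σ →₀ ℕ} : β ∈ exponents σ N ↔ β ≠ 0 ∧ β.degree = N := by
  rw [exponents, Set.Finite.mem_toFinset]
  rfl

/-- The approximations of a series by products of geometric series. -/
def geomApprox (G : MvPowerSeries σ F) : ℕ → MvPowerSeries σ F
  | 0 => 1
  | N + 1 => geomApprox G N * ∏ β ∈ exponents σ N,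
      (geomSeries (MvPowerSeries.coeff β G - MvPowerSeries.coeff β (geomApprox G N))).subst
        (MvPowerSeries.monomial β (1 : F))

/-- The exponents of the product of geometric series. -/
def geomCoord (G : MvPowerSeries σ F) (β : σ →₀ ℕ) : F :=
  MvPowerSeries.coeff β G - MvPowerSeries.coeff β (geomApprox G β.degree)

open scoped Classical in
/-- The logarithm of the approximation. -/
def geomApproxLog (u : (σ →₀ ℕ) → F) (N : ℕ) : MvPowerSeries σ F := fun γ =>
  ∑ p ∈ divisorPairs γ, if p.2.degree < N then (p.1 : F)⁻¹ * u p.2 ^ p.1 else 0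

open scoped Classical in
theorem coeff_geomApproxLog (u : (σ →₀ ℕ) → F) (N : ℕ) (γ : σ →₀ ℕ) :
    MvPowerSeries.coeff γ (geomApproxLog u N) =
      ∑ p ∈ divisorPairs γ, if p.2.degree < N then (p.1 : F)⁻¹ * u p.2 ^ p.1 else 0 := rfl

variable [CharZero F]

theorem isLog_congr {L L' G : MvPowerSeries σ F} (h : MvPowerSeries.IsLog L G)
    (hL : ∀ β ≠ 0, MvPowerSeries.coeff β L = MvPowerSeries.coeff β L') :
    MvPowerSeries.IsLog L' G := by
  refine ⟨h.coeff_zero, ?_⟩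
  rw [h.euler_eq]
  congr 1
  ext β
  rw [MvPowerSeries.coeff_euler, MvPowerSeries.coeff_euler]
  by_cases hβ : β = 0
  · simp [hβ]
  · rw [hL β hβ]

/-- The N-th step multiplies by geometric series in the monomials of degree N, and this adds to the
logarithm exactly the pairs whose second entry has degree N. -/
theorem isLog_geomApprox (G : MvPowerSeries σ F) (N : ℕ) :
    MvPowerSeries.IsLog (geomApproxLog (geomCoord G) N) (geomApprox G N) := by
  classical
  induction N with
  | zero =>
    refine isLog_congr MvPowerSeries.IsLog.one fun β _ => ?_
    rw [coeff_geomApproxLog, map_zero]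
    exact (Finset.sum_eq_zero fun p _ => if_neg (Nat.not_lt_zero _)).symm
  | succ N ih =>
    refine isLog_congr (ih.mul (MvPowerSeries.IsLog.prod (exponents σ N) fun β hβ =>
      isLog_geomSeries _ (mem_exponents.1 hβ).1)) fun γ hγ => ?_
    rw [map_add, map_sum, coeff_geomApproxLog, coeff_geomApproxLog,
      Finset.sum_congr rfl fun β hβ => coeff_geomLog_subst _ (mem_exponents.1 hβ).1 hγ,
      Finset.sum_comm, ← Finset.sum_add_distrib]
    refine Finset.sum_congr rfl fun p hp => ?_
    rw [Finset.sum_ite_eq]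
    by_cases h : p.2.degree = N
    · rw [if_neg (by omega), if_pos (mem_exponents.2 ⟨snd_ne_zero_of_mem_divisorPairs hγ hp, h⟩),
        if_pos (by omega), zero_add, geomCoord, h]
    · rw [if_neg (c := p.2 ∈ _) (fun h' => h (mem_exponents.1 h').2), add_zero]
      exact if_congr (by omega) rfl rfl

theorem coeff_geomApproxLog_of_lt (u : (σ →₀ ℕ) → F) {N : ℕ} {γ : σ →₀ ℕ} (h : γ.degree < N) :
    MvPowerSeries.coeff γ (geomApproxLog u N) =
      ∑ p ∈ divisorPairs γ, (p.1 : F)⁻¹ * u p.2 ^ p.1 := by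
  classical
  by_cases hγ : γ = 0
  · rw [coeff_geomApproxLog, hγ, divisorPairs_zero, Finset.sum_empty, Finset.sum_empty]
  · exact Finset.sum_congr rfl fun p hp =>
      if_pos ((degree_le_of_mem_divisorPairs hγ hp).trans_lt h)

/-- Passing from N to N + 1 changes nothing below degree N and in positive degree N adds the
coordinate, which was defined as the error there. -/
theorem coeff_geomApprox {G : MvPowerSeries σ F} (hG : MvPowerSeries.coeff 0 G = 1) {N : ℕ}
    {γ : σ →₀ ℕ} (h : γ.degree < N) :
    MvPowerSeries.coeff γ (geomApprox G N) = MvPowerSeries.coeff γ G := by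
  classical
  induction N with
  | zero => exact absurd h (Nat.not_lt_zero _)
  | succ N ih =>
    have hL := isLog_geomApprox G N
    have hL' := isLog_geomApprox G (N + 1)
    have hlow : ∀ β : σ →₀ ℕ, β.degree < N →
        MvPowerSeries.coeff β (geomApproxLog (geomCoord G) (N + 1)) =
          MvPowerSeries.coeff β (geomApproxLog (geomCoord G) N) := fun β hβ => by
      rw [coeff_geomApproxLog_of_lt _ hβ, coeff_geomApproxLog_of_lt _ (Nat.lt_succ_of_lt hβ)]
    have hlow' : ∀ β : σ →₀ ℕ, β.degree < N → MvPowerSeries.coeff β (geomApprox G (N + 1)) =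
        MvPowerSeries.coeff β (geomApprox G N) := fun β hβ =>
      hL'.coeff_eq hL fun δ hδ _ => hlow δ ((Finsupp.degree_mono hδ).trans_lt hβ)
    by_cases hγN : γ.degree < N
    · rw [hlow' γ hγN, ih hγN]
    · have hγ : γ.degree = N := by omega
      by_cases hγ0 : γ = 0
      · rw [hγ0, hG, hL'.coeff_zero]
      · have h1 := hL'.coeff_sub_coeff hL hγ0
          (fun β hβ _ => hlow β (hγ ▸ MvPowerSeries.IsLog.degree_lt_of_lt hβ))
          (fun β hβ => hlow' β (hγ ▸ MvPowerSeries.IsLog.degree_lt_of_lt hβ))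
        have h2 : MvPowerSeries.coeff γ (geomApproxLog (geomCoord G) (N + 1)) -
            MvPowerSeries.coeff γ (geomApproxLog (geomCoord G) N) = geomCoord G γ := by
          rw [coeff_geomApproxLog, coeff_geomApproxLog, ← Finset.sum_sub_distrib,
            Finset.sum_eq_single (1, γ)]
          · rw [if_pos (by omega), if_neg (by omega), Nat.cast_one, inv_one, one_mul, pow_one,
              sub_zero]
          · intro p hp hne
            have h3 := degree_le_of_mem_divisorPairs hγ0 hp
            have h4 : p.2.degree ≠ N := fun h4 => by
              have h5 := mul_degree_of_mem_divisorPairs hγ0 hp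
              have hN : N ≠ 0 := fun hN => hγ0 ((Finsupp.degree_eq_zero_iff _).1 (hγ.trans hN))
              rw [h4, hγ] at h5
              have h6 : p.1 = 1 := by
                refine Nat.eq_of_mul_eq_mul_right (Nat.pos_of_ne_zero hN) ?_
                rw [h5, one_mul]
              refine hne (Prod.ext h6 ?_)
              have h7 := (mem_divisorPairs hγ0).1 hp
              rwa [h6, one_smul] at h7
            rw [if_pos (by omega), if_pos (by omega), sub_self]
          · intro hn
            exact absurd ((mem_divisorPairs hγ0).2 (one_smul _ _)) hn
        rw [h2, geomCoord, hγ] at h1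
        linear_combination h1

/-- Every series is a product of geometric series. -/
theorem isLog_geomCoord {G : MvPowerSeries σ F} (hG : MvPowerSeries.coeff 0 G = 1) :
    MvPowerSeries.IsLog (fun γ => ∑ p ∈ divisorPairs γ, (p.1 : F)⁻¹ * geomCoord G p.2 ^ p.1) G := by
  classical
  refine ⟨hG, ?_⟩
  ext α
  have h := (isLog_geomApprox G (α.degree + 1)).degree_mul_coeff α
  rw [coeff_geomApprox hG (Nat.lt_succ_self _)] at h
  rw [MvPowerSeries.coeff_euler, h, MvPowerSeries.coeff_mul]
  refine Finset.sum_congr rfl fun p hp => ?_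
  have hp' := congrArg Finsupp.degree (Finset.HasAntidiagonal.mem_antidiagonal.1 hp)
  rw [map_add] at hp'
  rw [coeff_geomApprox hG (by omega), coeff_geomApproxLog_of_lt _ (by omega)]
  rfl

/-- No division occurs in forming the coordinates. This is the advantage of geometric series over
the logarithm, and it keeps everything inside the ring of counting functions. -/
theorem coeff_geomApprox_mem (R : Subring F) {G : MvPowerSeries σ F}
    (hR : ∀ α, MvPowerSeries.coeff α G ∈ R) (N : ℕ) (α : σ →₀ ℕ) :
    MvPowerSeries.coeff α (geomApprox G N) ∈ R := by
  classical
  have hmul : ∀ f g : MvPowerSeries σ F, (∀ α, MvPowerSeries.coeff α f ∈ R) →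
      (∀ α, MvPowerSeries.coeff α g ∈ R) → ∀ α, MvPowerSeries.coeff α (f * g) ∈ R := by
    intro f g hf hg α
    rw [MvPowerSeries.coeff_mul]
    exact R.sum_mem fun p _ => R.mul_mem (hf _) (hg _)
  have hone : ∀ α, MvPowerSeries.coeff α (1 : MvPowerSeries σ F) ∈ R := by
    intro α
    rw [MvPowerSeries.coeff_one]
    split_ifs
    · exact R.one_mem
    · exact R.zero_mem
  induction N generalizing α with
  | zero => exact hone α
  | succ N ih =>
    refine hmul _ _ ih (fun α => ?_) α
    refine Finset.prod_induction _ (fun f => ∀ α, MvPowerSeries.coeff α f ∈ R) hmul hone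
      (fun β hβ α => ?_) α
    rw [MvPowerSeries.coeff_subst_monomial (mem_exponents.1 hβ).1 _ (Nat.lt_succ_self _)]
    refine R.sum_mem fun n _ => ?_
    split_ifs
    · rw [geomSeries, PowerSeries.coeff_mk]
      exact R.pow_mem (R.sub_mem (hR β) (ih β)) n
    · exact R.zero_mem

theorem geomCoord_mem (R : Subring F) {G : MvPowerSeries σ F}
    (hR : ∀ α, MvPowerSeries.coeff α G ∈ R) (β : σ →₀ ℕ) : geomCoord G β ∈ R :=
  R.sub_mem (hR β) (coeff_geomApprox_mem R hR _ β)

end GeometricProduct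

/-! ### Divisors of an exponent, and the plethystic logarithm. -/

section Content

variable {σ : Type*}

/-- The greatest common divisor of the entries. -/
def content (β : σ →₀ ℕ) : ℕ := β.support.gcd β

/-- The primitive vector of which `β` is a multiple. -/
def primitivePart (β : σ →₀ ℕ) : σ →₀ ℕ :=
  β.mapRange (fun m => m / content β) (Nat.zero_div _)

theorem content_dvd (β : σ →₀ ℕ) (i : σ) : content β ∣ β i := by
  by_cases h : i ∈ β.support
  · exact Finset.gcd_dvd h
  · rw [Finsupp.notMem_support_iff.1 h]
    exact dvd_zero _

theorem dvd_content_iff {β : σ →₀ ℕ} {d : ℕ} : d ∣ content β ↔ ∀ i, d ∣ β i :=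
  ⟨fun h i => h.trans (content_dvd β i), fun h => Finset.dvd_gcd fun i _ => h i⟩

theorem content_smul_primitivePart (β : σ →₀ ℕ) : content β • primitivePart β = β := by
  ext i
  exact Nat.mul_div_cancel' (content_dvd β i)

theorem content_ne_zero {β : σ →₀ ℕ} (hβ : β ≠ 0) : content β ≠ 0 := fun h => hβ (by
  rw [← content_smul_primitivePart β, h, zero_smul])

theorem content_smul (d : ℕ) (β : σ →₀ ℕ) : content (d • β) = d * content β := by
  refine Nat.dvd_antisymm ?_ (dvd_content_iff.2 fun i =>
    Nat.mul_dvd_mul_left d (content_dvd β i))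
  by_cases hd : d = 0
  · simp [hd]
  · obtain ⟨c, hc⟩ : d ∣ content (d • β) := dvd_content_iff.2 fun i => dvd_mul_right d (β i)
    rw [hc]
    refine Nat.mul_dvd_mul_left d (dvd_content_iff.2 fun i => ?_)
    exact Nat.dvd_of_mul_dvd_mul_left (Nat.pos_of_ne_zero hd)
      (hc ▸ content_dvd (d • β) i)

theorem primitivePart_smul {d : ℕ} (hd : d ≠ 0) (β : σ →₀ ℕ) :
    primitivePart (d • β) = primitivePart β := by
  ext i
  change d * β i / content (d • β) = β i / content β
  rw [content_smul]
  exact Nat.mul_div_mul_left _ _ (Nat.pos_of_ne_zero hd)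

/-- All α with nα = β lie on the ray of the primitive vector of β. Sums over them are sums over the
divisors of a single number, so Dwork's lemma applies ray by ray. -/
theorem sum_divisorPairs_eq {S : Type*} [AddCommMonoid S] {β : σ →₀ ℕ} (hβ : β ≠ 0)
    (f : ℕ → (σ →₀ ℕ) → S) : ∑ p ∈ divisorPairs β, f p.1 p.2 =
      ∑ d ∈ (content β).divisors, f (content β / d) (d • primitivePart β) := by
  have hg := content_ne_zero hβ
  symm
  refine Finset.sum_bij' (fun d _ => (content β / d, d • primitivePart β))
    (fun p _ => content p.2) ?_ ?_ ?_ ?_ ?_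
  · intro d hd
    rw [mem_divisorPairs hβ, smul_smul, Nat.div_mul_cancel (Nat.dvd_of_mem_divisors hd),
      content_smul_primitivePart]
  · intro p hp
    rw [← (mem_divisorPairs hβ).1 hp, content_smul] at hg ⊢
    exact Nat.mem_divisors.2 ⟨dvd_mul_left _ _, hg⟩
  · intro d hd
    have h1 : content (primitivePart β) = 1 := by
      have h2 := content_smul (content β) (primitivePart β)
      rw [content_smul_primitivePart] at h2
      exact Nat.eq_of_mul_eq_mul_left (Nat.pos_of_ne_zero hg) (h2.symm.trans (mul_one _).symm)
    rw [content_smul, h1, mul_one]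
  · intro p hp
    have h1 := (mem_divisorPairs hβ).1 hp
    have h2 := fst_ne_zero_of_mem_divisorPairs hβ hp
    have h3 := content_ne_zero (snd_ne_zero_of_mem_divisorPairs hβ hp)
    refine Prod.ext ?_ ?_
    · change content β / content p.2 = p.1
      rw [← h1, content_smul, Nat.mul_div_cancel _ (Nat.pos_of_ne_zero h3)]
    · change content p.2 • primitivePart β = p.2
      rw [← h1, primitivePart_smul h2, content_smul_primitivePart]
  · intro d _
    rfl

end Content

namespace FrobeniusLifts

variable {S : Type*} [CommRing S] (Φ : FrobeniusLifts S) {σ : Type*}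

/-- The ghost equations for functions on exponents. -/
theorem exists_ghost (u : (σ →₀ ℕ) → S) : ∃ b : (σ →₀ ℕ) → S, ∀ β ≠ 0,
    ∑ p ∈ divisorPairs β, (p.2.degree : S) * u p.2 ^ p.1 =
      ∑ p ∈ divisorPairs β, (p.2.degree : S) * Φ.psi p.1 (b p.2) := by
  refine ⟨fun β => Φ.ghostSolution (fun d => u (d • primitivePart β)) (content β), fun β hβ => ?_⟩
  have hg := content_ne_zero hβ
  rw [sum_divisorPairs_eq hβ fun n γ => (γ.degree : S) * u γ ^ n,
    sum_divisorPairs_eq hβ fun n γ => (γ.degree : S) *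
      Φ.psi n (Φ.ghostSolution (fun d => u (d • primitivePart γ)) (content γ))]
  -- The degree of d times a primitive vector is d times its degree, so the ghost equation along the
  -- ray only has to be multiplied by that constant.
  have h := congrArg (((primitivePart β).degree : S) * ·)
    (Φ.ghost_ghostSolution (fun d => u (d • primitivePart β)) hg)
  have h1 : content (primitivePart β) = 1 := by
    have h2 := content_smul (content β) (primitivePart β)
    rw [content_smul_primitivePart] at h2
    exact Nat.eq_of_mul_eq_mul_left (Nat.pos_of_ne_zero hg) (h2.symm.trans (mul_one _).symm)
  simp only [Finset.mul_sum] at h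
  refine Eq.trans (Finset.sum_congr rfl fun d _ => ?_)
    (h.trans (Finset.sum_congr rfl fun d hd => ?_))
  · rw [map_nsmul, smul_eq_mul, Nat.cast_mul]
    ring
  · have h2 : primitivePart (d • primitivePart β) = primitivePart β := by
      rw [primitivePart_smul (Nat.pos_of_mem_divisors hd).ne',
        ← primitivePart_smul hg (primitivePart β), content_smul_primitivePart]
    rw [map_nsmul, smul_eq_mul, Nat.cast_mul, content_smul, h1, mul_one, h2]
    ring

end FrobeniusLifts

/-- Plethystic logarithms over the ring of counting functions. -/
theorem CountRing.exists_plethysticLog {σ : Type*} [Finite σ] (G : (σ →₀ ℕ) → CountRing)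
    (hG : G 0 = 1) : ∃ b : (σ →₀ ℕ) → CountRing, ∀ (F : Type) [Field F] [CharZero F]
      (ε : CountRing →+* F) (L' G' : MvPowerSeries σ F),
      (∀ γ ≠ 0, MvPowerSeries.coeff γ L' =
        ∑ p ∈ divisorPairs γ, (p.1 : F)⁻¹ * ε (psi p.1 (b p.2))) →
      (∀ α, MvPowerSeries.coeff α G' = ε (G α)) → MvPowerSeries.IsLog L' G' := by
  classical
  have hGR : ∀ α, MvPowerSeries.coeff α (fun α => toRat (G α) : MvPowerSeries σ (RatFunc ℚ)) ∈
      toRat.range := fun α => ⟨G α, rfl⟩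
  choose u hu using geomCoord_mem toRat.range hGR
  obtain ⟨b, hb⟩ := CountRing.lifts.exists_ghost u
  have hsum : ∀ (F : Type) [Field F] [CharZero F] (β : σ →₀ ℕ) (f : ℕ → (σ →₀ ℕ) → F), β ≠ 0 →
      (β.degree : F) * ∑ p ∈ divisorPairs β, (p.1 : F)⁻¹ * f p.1 p.2 =
        ∑ p ∈ divisorPairs β, (p.2.degree : F) * f p.1 p.2 := by
    intro F _ _ β f hβ
    rw [Finset.mul_sum]
    refine Finset.sum_congr rfl fun p hp => ?_
    have hp0 : (p.1 : F) ≠ 0 := Nat.cast_ne_zero.2 (fst_ne_zero_of_mem_divisorPairs hβ hp)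
    rw [← mul_degree_of_mem_divisorPairs hβ hp, Nat.cast_mul]
    field_simp
  -- The Euler relation for the product of geometric series. Multiplication by deg β turns 1/n into
  -- the degree of β/n, so there are no denominators and the relation descends from the rational
  -- functions to the ring itself. From there it can be carried along any ε, both to rational
  -- functions and to numbers.
  have key : ∀ α : σ →₀ ℕ, (α.degree : CountRing) * G α =
      ∑ q ∈ Finset.HasAntidiagonal.antidiagonal α,
        (∑ p ∈ divisorPairs q.1, (p.2.degree : CountRing) * u p.2 ^ p.1) * G q.2 := by
    intro α
    apply toRat_injective
    have h := (isLog_geomCoord (F := RatFunc ℚ)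
      (G := (fun α => toRat (G α) : MvPowerSeries σ (RatFunc ℚ)))
      (by change toRat (G 0) = 1; rw [hG, map_one])).degree_mul_coeff α
    rw [map_mul, map_natCast, map_sum]
    refine h.trans (Finset.sum_congr rfl fun q hq => ?_)
    rw [map_mul]
    refine congrArg (· * toRat (G q.2)) ?_
    by_cases hq0 : q.1 = 0
    · rw [hq0, divisorPairs_zero, Finset.sum_empty, map_zero, map_zero, Nat.cast_zero, zero_mul]
    · refine (hsum (RatFunc ℚ) q.1 (fun n γ => geomCoord _ γ ^ n) hq0).trans ?_
      rw [map_sum]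
      refine Finset.sum_congr rfl fun p _ => ?_
      rw [map_mul, map_natCast, map_pow, hu]
  refine ⟨b, fun F _ _ ε L' G' hL' hG' => ⟨?_, ?_⟩⟩
  · rw [hG', hG, map_one]
  · ext α
    have h := congrArg ε (key α)
    rw [map_mul, map_natCast, map_sum] at h
    rw [MvPowerSeries.coeff_euler, MvPowerSeries.coeff_mul, hG']
    refine h.trans (Finset.sum_congr rfl fun q hq => ?_)
    rw [map_mul, MvPowerSeries.coeff_euler, hG']
    refine congrArg (· * ε (G q.2)) ?_
    by_cases hq0 : q.1 = 0
    · rw [hq0, divisorPairs_zero, Finset.sum_empty, map_zero, map_zero, Nat.cast_zero, zero_mul]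
    · rw [hL' _ hq0, hsum F q.1 (fun n γ => ε (psi n (b γ))) hq0, hb q.1 hq0, map_sum]
      refine Finset.sum_congr rfl fun p _ => ?_
      rw [map_mul, map_natCast]
      rfl

end

/-! ### The Harder–Narasimhan recursion. -/

noncomputable section


namespace QuiverRep

section HarderNarasimhan

variable {k : Type u} [Field k] {I : Type w} [Quiver.{v} I] [Fintype I] {θ : I → ℤ}
  {X : QuiverRep k I}

/-- All nonzero subrepresentations have slope less than `ν`. -/
def SubSlopeLT (θ : I → ℤ) (ν : ℚ) (X : QuiverRep k I) : Prop :=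
  ∀ W : Sub X, W ≠ ⊥ → slopeForm θ ν W.toRep.dim < 0

theorem SubSlopeLT.of_iso {ν : ℚ} {Y : QuiverRep k I} (h : SubSlopeLT θ ν X) (e : Iso X Y) :
    SubSlopeLT θ ν Y := by
  intro W hW
  obtain ⟨W, rfl⟩ := (Sub.mapIso_bijective e).2 W
  rw [Ne, ← Sub.dim_eq_zero, dim_mapIso, Sub.dim_eq_zero] at hW
  rw [dim_mapIso]
  exact h W hW

theorem SubSlopeLT.of_isZero {ν : ℚ} (h : X.IsZero) : SubSlopeLT θ ν X := fun W hW => by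
  refine absurd (Sub.dim_eq_zero.1 (le_antisymm ?_ (zero_le))) hW
  rw [← (isZero_iff_dim X).1 h]
  exact W.dim_le

/-- The first step of the Harder–Narasimhan filtration. -/
structure IsMaximalDestabilizing (θ : I → ℤ) (U : Sub X) : Prop where
  ne_bot : U ≠ ⊥
  semi : SemiFor (slopeForm θ (dimSlope θ U.toRep.dim)) U.toRep
  quotient : SubSlopeLT θ (dimSlope θ U.toRep.dim) U.quotient

namespace IsMaximalDestabilizing

/-- Since φ(U) = 0, φ(T) is the sum of the values at U ⊔ T and U ⊓ T. The meet is nonpositive by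
semistability of U, and the join is measured in X/U, where it is negative unless T ≤ U. Maximality
of slope and of size, and hence uniqueness of U, follow. -/
theorem slopeForm_le {U : Sub X} (h : IsMaximalDestabilizing θ U) (T : Sub X) :
    slopeForm θ (dimSlope θ U.toRep.dim) T.toRep.dim ≤ 0 ∧
      (slopeForm θ (dimSlope θ U.toRep.dim) T.toRep.dim = 0 → T ≤ U) := by
  obtain ⟨φ, hφ⟩ : ∃ φ, φ = slopeForm θ (dimSlope θ U.toRep.dim) := ⟨_, rfl⟩
  have hs := h.semi
  have hq := h.quotient
  rw [SubSlopeLT] at hq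
  rw [← hφ] at hs hq ⊢
  have h1 := phi_sup_add_inf (φ := φ) U T
  have h2 : φ (U ⊓ T).toRep.dim ≤ 0 := by
    rw [← U.incl_restr (U ⊓ T) (Sub.le_iff.1 inf_le_left), U.dim_incl]
    exact hs.2 _
  have h3 := U.pull_push (U ⊔ T) (Sub.le_iff.1 le_sup_left)
  have h4 := congrArg (fun W : Sub X => φ W.toRep.dim) h3
  simp only [U.dim_pull, map_add, hs.1, zero_add] at h4
  by_cases hW : U.push (U ⊔ T) = ⊥
  · have h5 : U ⊔ T = U := by
      refine (Sub.eq_of_le_of_dim le_sup_left ?_).symm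
      rw [← h3, U.dim_pull, hW, Sub.dim_bot, add_zero]
    refine ⟨?_, fun _ => sup_eq_left.1 h5⟩
    rw [h5, hs.1] at h1
    linarith
  · have h5 := hq _ hW
    rw [hs.1] at h1
    exact ⟨by linarith, fun h0 => by linarith⟩

theorem dimSlope_le {U : Sub X} (h : IsMaximalDestabilizing θ U) {T : Sub X} (hT : T ≠ ⊥) :
    dimSlope θ T.toRep.dim ≤ dimSlope θ U.toRep.dim :=
  (slopeForm_nonpos (mt Sub.dim_eq_zero.1 hT)).1 (h.slopeForm_le T).1

theorem unique {U U' : Sub X} (h : IsMaximalDestabilizing θ U) (h' : IsMaximalDestabilizing θ U') :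
    U = U' := by
  have h1 := le_antisymm (h.dimSlope_le h'.ne_bot) (h'.dimSlope_le h.ne_bot)
  refine le_antisymm ((h'.slopeForm_le U).2 ?_) ((h.slopeForm_le U').2 ?_)
  · exact (slopeForm_eq_zero (mt Sub.dim_eq_zero.1 h.ne_bot)).2 h1.symm
  · exact (slopeForm_eq_zero (mt Sub.dim_eq_zero.1 h'.ne_bot)).2 h1

theorem subSlopeLT_iff {U : Sub X} (h : IsMaximalDestabilizing θ U) {ν : ℚ} :
    SubSlopeLT θ ν X ↔ dimSlope θ U.toRep.dim < ν := by
  constructor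
  · exact fun hX => (slopeForm_neg (mt Sub.dim_eq_zero.1 h.ne_bot)).1 (hX U h.ne_bot)
  · exact fun hν W hW => (slopeForm_neg (mt Sub.dim_eq_zero.1 hW)).2
      ((h.dimSlope_le hW).trans_lt hν)

end IsMaximalDestabilizing

/-- Among the nonzero subobjects of maximal slope a maximal one is taken; any subobject of the
quotient that is not of smaller slope could be added to it. -/
theorem exists_isMaximalDestabilizing [Finite k] (hX : ¬ X.IsZero) :
    ∃ U : Sub X, IsMaximalDestabilizing θ U := by
  have htop : (⊤ : Sub X) ≠ ⊥ := by
    rwa [Ne, ← Sub.dim_eq_zero, Sub.dim_top, ← isZero_iff_dim]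
  obtain ⟨A, hA, hmax⟩ := (Set.toFinite {U : Sub X | U ≠ ⊥}).exists_maximalFor
    (fun U => dimSlope θ U.toRep.dim) _ ⟨⊤, htop⟩
  obtain ⟨φ, hφ⟩ : ∃ φ, φ = slopeForm θ (dimSlope θ A.toRep.dim) := ⟨_, rfl⟩
  have hle : ∀ T : Sub X, φ T.toRep.dim ≤ 0 := by
    intro T
    by_cases hT : T = ⊥
    · rw [hT, Sub.dim_bot, map_zero]
    · rw [hφ, slopeForm_nonpos (mt Sub.dim_eq_zero.1 hT)]
      exact (le_total _ _).elim id fun h => hmax hT h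
  have hA0 : φ A.toRep.dim = 0 := by
    rw [hφ, slopeForm_eq_zero (mt Sub.dim_eq_zero.1 hA)]
  obtain ⟨U, hAU, hU⟩ := (Set.toFinite {U : Sub X | φ U.toRep.dim = 0}).exists_le_maximal hA0
  have hU0 : U ≠ ⊥ := fun h => hA (le_bot_iff.1 (h ▸ hAU))
  have hslope : dimSlope θ U.toRep.dim = dimSlope θ A.toRep.dim := by
    rw [← slopeForm_eq_zero (mt Sub.dim_eq_zero.1 hU0), ← hφ]
    exact hU.1
  refine ⟨U, hU0, ?_, ?_⟩
  · rw [hslope, ← hφ]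
    exact ⟨hU.1, fun T => U.dim_incl T ▸ hle (U.incl T)⟩
  · rw [SubSlopeLT, hslope, ← hφ]
    intro W hW
    have h1 : φ U.toRep.dim = 0 := hU.1
    have h2 := hle (U.pull W)
    rw [U.dim_pull, map_add, h1, zero_add] at h2
    refine lt_of_le_of_ne h2 fun h3 => hW ?_
    have h4 : U.pull W ∈ {U : Sub X | φ U.toRep.dim = 0} := by
      change φ (U.pull W).toRep.dim = 0
      rw [U.dim_pull, map_add, h1, h3, zero_add]
    have h5 := Sub.dim_mono (hU.2 h4 (Sub.le_iff.2 (U.le_pull W)))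
    rw [U.dim_pull] at h5
    refine Sub.dim_eq_zero.1 (le_antisymm ?_ (zero_le))
    exact le_of_add_le_add_left (h5.trans (add_zero _).ge)

open Classical in
/-- The indicator of the representations whose nonzero subrepresentations have slope less
than `ν`. -/
def subSlopeInd (θ : I → ℤ) (ν : ℚ) (c : IsoClass k I) : ℚ :=
  if SubSlopeLT θ ν c.rep then 1 else 0

/-- The indicator of the semistable representations. -/
def semiInd (θ : I → ℤ) (c : IsoClass k I) : ℚ :=
  CompletedHall.semiSum k (slopeForm θ (dimSlope θ c.dim)) c

open Classical in
theorem subSlopeInd_mk (ν : ℚ) (X : QuiverRep k I) :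
    subSlopeInd θ ν (IsoClass.mk X) = if SubSlopeLT θ ν X then 1 else 0 := by
  obtain ⟨e⟩ : Nonempty (Iso (IsoClass.mk X).rep X) := IsoClass.mk_eq.1 (IsoClass.mk_rep _)
  exact if_congr ⟨fun h => h.of_iso e, fun h => h.of_iso e.symm⟩ rfl rfl

open Classical in
theorem semiInd_mk [Finite k] (X : QuiverRep k I) : semiInd θ (IsoClass.mk X) =
    if SemiFor (slopeForm θ (dimSlope θ X.dim)) X then 1 else 0 :=
  CompletedHall.semiSum_apply X

/-- A summand is nonzero only if W is itself a maximal destabilizing subobject, and that is unique.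
-/
theorem IsMaximalDestabilizing.sum_eq [Finite k] {U : Sub X} (h : IsMaximalDestabilizing θ U)
    (P : ℚ → Prop) [DecidablePred P] [DecidableEq (I →₀ ℕ)] :
    ∑ W : Sub X, (if W.toRep.dim ≠ 0 ∧ P (dimSlope θ W.toRep.dim) then
      subSlopeInd θ (dimSlope θ W.toRep.dim) (IsoClass.mk W.quotient) else 0) *
        semiInd θ (IsoClass.mk W.toRep) = if P (dimSlope θ U.toRep.dim) then 1 else 0 := by
  classical
  rw [Finset.sum_eq_single U]
  · rw [subSlopeInd_mk, semiInd_mk, if_pos h.quotient, if_pos h.semi, mul_one]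
    exact if_congr (and_iff_right (mt Sub.dim_eq_zero.1 h.ne_bot)) rfl rfl
  · intro W _ hW
    rw [subSlopeInd_mk, semiInd_mk, ← ite_and]
    split_ifs with h1 h2
    · exact absurd (IsMaximalDestabilizing.unique (θ := θ)
        ⟨mt Sub.dim_eq_zero.2 h1.1.1, h2, h1.2⟩ h) hW
    · exact mul_zero _
    · exact zero_mul _
    · exact zero_mul _
  · exact fun hn => absurd (Finset.mem_univ _) hn

end HarderNarasimhan

section Recursion

variable {k : Type u} [Field k] [Finite k] {I : Type w} [Quiver.{v} I] [Fintype I]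
  [∀ i j : I, Finite (i ⟶ j)] {θ : I → ℤ}

theorem stdSum_one (α : I →₀ ℕ) :
    stdSum (fun _ : IsoClass k I => 1) α = (Nat.card k : ℚ) ^ arrowPairing α α := by
  have := Fintype.ofFinite (Σ i j : I, (i ⟶ j))
  rw [stdSum, repSum, Finset.sum_const, nsmul_eq_mul, mul_one, Finset.card_univ,
    ← Nat.card_eq_fintype_card (α := RepSpace k fun i => Fin (α i) → k), Nat.card_pi,
    ← Nat.cast_pow, arrowPairing, ← Finset.prod_pow_eq_pow_sum]
  refine congrArg Nat.cast (Finset.prod_congr (by congr; exact Subsingleton.elim _ _) fun p _ => ?_)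
  rw [Module.natCard_eq_pow_finrank (K := k), Module.finrank_linearMap, Module.finrank_fin_fun,
    Module.finrank_fin_fun]

theorem arrowPairing_zero (γ : I →₀ ℕ) : arrowPairing γ 0 = 0 :=
  Finset.sum_eq_zero fun _ _ => zero_mul _

theorem stdSum_zero_of_eq_one {f : IsoClass k I → ℚ} (h : ∀ c : IsoClass k I, c.dim = 0 → f c = 1) :
    stdSum f (0 : I →₀ ℕ) = 1 := by
  rw [stdSum_congr (g := fun _ => 1) h, stdSum_one, arrowPairing_zero, pow_zero]

theorem subspaceCount_self (γ : I →₀ ℕ) : subspaceCount k γ γ = 1 := by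
  refine Finset.prod_eq_one fun i _ => ?_
  rw [Nat.card_eq_one_iff_unique]
  refine ⟨⟨fun A B => Subtype.ext ?_⟩, ⟨⊤, ?_⟩⟩
  · have h : ∀ A : {A : Submodule k (Fin (γ i) → k) // Module.finrank k A = γ i}, A.1 = ⊤ :=
      fun A => Submodule.eq_top_of_finrank_eq (A.2.trans (Module.finrank_fin_fun k).symm)
    rw [h A, h B]
  · rw [finrank_top, Module.finrank_fin_fun]

theorem IsoClass.isZero_rep {c : IsoClass k I} (hc : c.dim = 0) : c.rep.IsZero := by
  rw [isZero_iff_dim, IsoClass.dim_rep, hc]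

theorem stdSum_subSlopeInd_zero (ν : ℚ) :
    stdSum (subSlopeInd (k := k) θ ν) (0 : I →₀ ℕ) = 1 :=
  stdSum_zero_of_eq_one fun _ hc => if_pos (SubSlopeLT.of_isZero (IsoClass.isZero_rep hc))

theorem semiSum_of_dim_eq_zero {φ : (I →₀ ℕ) →+ ℚ} {c : IsoClass k I} (hc : c.dim = 0) :
    CompletedHall.semiSum k φ c = 1 := by
  classical
  rw [← c.mk_rep, CompletedHall.semiSum_apply,
    if_pos (SemiFor.of_isZero (IsoClass.isZero_rep hc))]

open Classical in
-- Representations are sorted by the first step of the Harder–Narasimhan filtration, with P a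
-- condition on its slope. The condition `True` counts everything, and slope `< ν` counts the
-- objects all of whose nonzero subobjects have slope less than ν.
theorem stdSum_harderNarasimhan {γ : I →₀ ℕ} (hγ : γ ≠ 0) (P : ℚ → Prop)
    (T : IsoClass k I → ℚ) (hT : ∀ (X : QuiverRep k I) (U : Sub X), IsMaximalDestabilizing θ U →
      T (IsoClass.mk X) = if P (dimSlope θ U.toRep.dim) then 1 else 0) :
    stdSum T γ = ∑ p ∈ Finset.HasAntidiagonal.antidiagonal γ, (subspaceCount k p.1 γ : ℚ) *
      ((Nat.card k : ℚ) ^ arrowPairing p.1 p.2 *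
        ((if p.1 ≠ 0 ∧ P (dimSlope θ p.1) then
          stdSum (subSlopeInd (k := k) θ (dimSlope θ p.1)) p.2 else 0) *
          stdSum (semiInd (k := k) θ) p.1)) := by
  have h := stdSum_of_eq_sum_sub (k := k) (γ := γ) T
    -- The bound imposed on the quotient is the slope of the subobject, so the function applied to
    -- the quotient has to depend on δ.
    (fun δ c => if δ ≠ 0 ∧ P (dimSlope θ δ) then subSlopeInd θ (dimSlope θ δ) c else 0)
    (semiInd θ) (by
      intro X hX
      have hX0 : ¬ X.IsZero := fun h0 => hγ (hX ▸ (isZero_iff_dim X).1 h0)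
      obtain ⟨U, hU⟩ := exists_isMaximalDestabilizing (θ := θ) hX0
      rw [hT X U hU, ← hU.sum_eq P])
  rw [h]
  refine Finset.sum_congr rfl fun p _ => ?_
  by_cases hp : p.1 ≠ 0 ∧ P (dimSlope θ p.1)
  · simp only [if_pos hp]
  · simp only [if_neg hp]
    rw [stdSum, repSum, Finset.sum_const_zero]

theorem stdSum_semiSum {μ : ℚ} (α : I →₀ ℕ) :
    stdSum (CompletedHall.semiSum k (slopeForm θ μ)) α =
      if α = 0 then 1 else if dimSlope θ α = μ then stdSum (semiInd (k := k) θ) α else 0 := by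
  classical
  split_ifs with h0 h1
  · rw [h0]
    exact stdSum_zero_of_eq_one fun c hc => semiSum_of_dim_eq_zero hc
  · refine stdSum_congr fun c hc => ?_
    rw [semiInd, hc, h1]
  · refine (stdSum_congr (g := fun _ => 0) fun c hc => ?_).trans ?_
    · rw [← c.mk_rep, CompletedHall.semiSum_apply, if_neg]
      refine fun h => h1 ((slopeForm_eq_zero h0).1 ?_)
      rw [← hc, ← IsoClass.dim_rep]
      exact h.1
    · rw [stdSum, repSum, Finset.sum_const_zero]

open Classical in
-- The relation e·e⁻¹ = 1 away from zero, summed over the space of representations; it determines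
-- the sums for e⁻¹ recursively.
theorem stdSum_semiInv {φ : (I →₀ ℕ) →+ ℚ} {γ : I →₀ ℕ} (hγ : γ ≠ 0) :
    0 = ∑ p ∈ Finset.HasAntidiagonal.antidiagonal γ, (subspaceCount k p.1 γ : ℚ) *
      ((Nat.card k : ℚ) ^ arrowPairing p.1 p.2 * (stdSum (CompletedHall.semiSum k φ) p.2 *
        stdSum (CompletedHall.semiInv k φ : CompletedHall k I) p.1)) := by
  rw [← stdSum_of_eq_sum_sub (k := k) (γ := γ) (fun _ => 0) (fun _ => CompletedHall.semiSum k φ)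
    (CompletedHall.semiInv k φ)]
  · rw [stdSum, repSum, Finset.sum_const_zero]
  · intro X hX
    have hX0 : ¬ X.IsZero := fun h0 => hγ (hX ▸ (isZero_iff_dim X).1 h0)
    rw [← CompletedHall.one_apply_of_not_isZero hX0,
      ← CompletedHall.semiSum_mul_semiInv (φ := φ)]
    rfl

end Recursion

end QuiverRep

end

/-! ### Uniformity of the counts in the finite field. -/

noncomputable section


/-- A function of finite fields given by an element of the ring of counting functions. -/
def IsUniform (f : ∀ (k : Type u) [Field k] [Finite k], ℚ) : Prop :=
  ∃ x : CountRing, ∀ (k : Type u) [Field k] [Finite k],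
    f k = CountRing.ev (Nat.card k) Finite.one_lt_card x

namespace IsUniform

variable {f g : ∀ (k : Type u) [Field k] [Finite k], ℚ}

theorem congr (hf : IsUniform f) (h : ∀ (k : Type u) [Field k] [Finite k], g k = f k) :
    IsUniform g := by
  obtain ⟨x, hx⟩ := hf
  exact ⟨x, fun k _ _ => (h k).trans (hx k)⟩

theorem ofPoly (P : Polynomial ℤ)
    (h : ∀ (k : Type u) [Field k] [Finite k], f k = (P.eval (Nat.card k : ℤ) : ℤ)) :
    IsUniform f :=
  ⟨CountRing.ofPoly P, fun k _ _ => (h k).trans (CountRing.ev_ofPoly _ _ P).symm⟩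

theorem zero : IsUniform fun (k : Type u) [Field k] [Finite k] => 0 :=
  ⟨0, fun _ _ _ => (map_zero _).symm⟩

theorem one : IsUniform fun (k : Type u) [Field k] [Finite k] => 1 :=
  ⟨1, fun _ _ _ => (map_one _).symm⟩

theorem add (hf : IsUniform f) (hg : IsUniform g) : IsUniform fun k => f k + g k := by
  obtain ⟨x, hx⟩ := hf
  obtain ⟨y, hy⟩ := hg
  exact ⟨x + y, fun k _ _ => by simp only [map_add, hx, hy]⟩

theorem sub (hf : IsUniform f) (hg : IsUniform g) : IsUniform fun k => f k - g k := by
  obtain ⟨x, hx⟩ := hf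
  obtain ⟨y, hy⟩ := hg
  exact ⟨x - y, fun k _ _ => by simp only [map_sub, hx, hy]⟩

theorem mul (hf : IsUniform f) (hg : IsUniform g) : IsUniform fun k => f k * g k := by
  obtain ⟨x, hx⟩ := hf
  obtain ⟨y, hy⟩ := hg
  exact ⟨x * y, fun k _ _ => by simp only [map_mul, hx, hy]⟩

theorem sum {ι : Type*} (s : Finset ι) {f : ι → ∀ (k : Type u) [Field k] [Finite k], ℚ}
    (h : ∀ i ∈ s, IsUniform (f i)) : IsUniform fun k => ∑ i ∈ s, f i k := by
  classical
  induction s using Finset.induction_on with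
  | empty => exact zero.congr fun k _ _ => Finset.sum_empty
  | insert a s ha ih =>
    exact ((h a (Finset.mem_insert_self _ _)).add
      (ih fun i hi => h i (Finset.mem_insert_of_mem hi))).congr fun k _ _ => Finset.sum_insert ha

theorem prod {ι : Type*} (s : Finset ι) {f : ι → ∀ (k : Type u) [Field k] [Finite k], ℚ}
    (h : ∀ i ∈ s, IsUniform (f i)) : IsUniform fun k => ∏ i ∈ s, f i k := by
  classical
  induction s using Finset.induction_on with
  | empty => exact one.congr fun k _ _ => Finset.prod_empty
  | insert a s ha ih =>
    exact ((h a (Finset.mem_insert_self _ _)).mul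
      (ih fun i hi => h i (Finset.mem_insert_of_mem hi))).congr fun k _ _ => Finset.prod_insert ha

theorem ite (P : Prop) [Decidable P] (hf : P → IsUniform f) (hg : ¬ P → IsUniform g) :
    IsUniform fun k => if P then f k else g k := by
  by_cases h : P
  · exact (hf h).congr fun k _ _ => if_pos h
  · exact (hg h).congr fun k _ _ => if_neg h

theorem card_pow (n : ℕ) :
    IsUniform fun (k : Type u) [Field k] [Finite k] => (Nat.card k : ℚ) ^ n :=
  ofPoly (Polynomial.X ^ n) fun k _ _ => by simp

/-- The polynomial counting frames. -/
def framePoly (n d : ℕ) : Polynomial ℤ :=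
  ∏ i ∈ Finset.range d, (Polynomial.X ^ n - Polynomial.X ^ i)

theorem eval_framePoly {n d q : ℕ} (hd : d ≤ n) (hq : 2 ≤ q) :
    (framePoly n d).eval (q : ℤ) = (frameCount q n d : ℤ) := by
  rw [framePoly, Polynomial.eval_prod, frameCount, Nat.cast_prod]
  refine Finset.prod_congr rfl fun i hi => ?_
  rw [Nat.cast_sub (Nat.pow_le_pow_right (by omega) ((Finset.mem_range.1 hi).le.trans hd))]
  simp

theorem framePoly_mem (d : ℕ) : framePoly d d ∈ countDenominators := by
  refine ⟨Polynomial.monic_prod_of_monic _ _ fun i hi => ?_, fun s hs => ?_⟩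
  · refine Polynomial.monic_X_pow_sub ?_
    rw [Polynomial.degree_X_pow]
    exact_mod_cast Finset.mem_range.1 hi
  · rw [eval_framePoly le_rfl hs]
    exact_mod_cast frameCount_ne_zero hs d

theorem div_poly {D : Polynomial ℤ} (hD : D ∈ countDenominators) (hf : IsUniform f)
    (h : ∀ (k : Type u) [Field k] [Finite k], g k * (D.eval (Nat.card k : ℤ) : ℤ) = f k) :
    IsUniform g := by
  obtain ⟨x, hx⟩ := hf
  obtain ⟨y, hy⟩ := (CountRing.isUnit_ofPoly hD).exists_right_inv
  refine ⟨x * y, fun k _ _ => ?_⟩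
  have h1 := congrArg (CountRing.ev (Nat.card k) Finite.one_lt_card) hy
  rw [map_mul, CountRing.ev_ofPoly, map_one] at h1
  rw [map_mul, ← hx, ← h, mul_assoc, h1, mul_one]

theorem card_submodule {n d : ℕ} (hd : d ≤ n) : IsUniform fun (k : Type u) [Field k] [Finite k] =>
    (Nat.card {A : Submodule k (Fin n → k) // Module.finrank k A = d} : ℚ) := by
  refine div_poly (framePoly_mem d)
    (ofPoly (f := fun k _ _ => (frameCount (Nat.card k) n d : ℚ)) (framePoly n d)
      fun k _ _ => ?_) fun k _ _ => ?_
  · rw [eval_framePoly hd Finite.one_lt_card, Int.cast_natCast]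
  · rw [eval_framePoly le_rfl Finite.one_lt_card, Int.cast_natCast]
    have h := card_submodule_mul (k := k) (Fin n → k) (d := d) (by rwa [Module.finrank_fin_fun])
    rw [Module.finrank_fin_fun] at h
    exact_mod_cast h

end IsUniform

namespace QuiverRep

variable {I : Type w} [Quiver.{v} I] [Fintype I] [∀ i j : I, Finite (i ⟶ j)] {θ : I → ℤ}

theorem isUniform_subspaceCount {δ γ : I →₀ ℕ} (h : δ ≤ γ) :
    IsUniform fun (k : Type u) [Field k] [Finite k] => (subspaceCount k δ γ : ℚ) :=
  (IsUniform.prod Finset.univ fun i _ => IsUniform.card_submodule (h i)).congr fun k _ _ => by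
    rw [subspaceCount, Nat.cast_prod]

open Classical in
/-- Splitting the sum over all decompositions of an exponent. -/
theorem sum_antidiagonal_erase (γ : I →₀ ℕ) (t : (I →₀ ℕ) × (I →₀ ℕ) → ℚ) :
    ∑ p ∈ Finset.HasAntidiagonal.antidiagonal γ, t p = t (γ, 0) +
      ∑ p ∈ (Finset.HasAntidiagonal.antidiagonal γ).erase (γ, 0), t p :=
  (Finset.add_sum_erase _ _ (Finset.HasAntidiagonal.mem_antidiagonal.2 (add_zero γ))).symm

open Classical in
theorem degree_fst_lt {γ : I →₀ ℕ} {p : (I →₀ ℕ) × (I →₀ ℕ)}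
    (hp : p ∈ (Finset.HasAntidiagonal.antidiagonal γ).erase (γ, 0)) : p.1.degree < γ.degree := by
  rw [Finset.mem_erase, Finset.HasAntidiagonal.mem_antidiagonal] at hp
  have h2 : p.2 ≠ 0 := fun h => hp.1 (Prod.ext (by rw [← hp.2, h, add_zero]) h)
  have h3 := (Finsupp.degree_eq_zero_iff p.2).not.2 h2
  rw [← hp.2, map_add]
  omega

open Classical in
-- A joint induction on the degree. In the recursion for all representations the term (γ, 0) is the
-- unknown count of semistables, and every other nonzero term has smaller degree in both entries; so
-- it can be solved for. The recursion for bounded slope then expresses the other count.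
theorem isUniform_semi_subSlope (θ : I → ℤ) (n : ℕ) : ∀ γ : I →₀ ℕ, γ.degree = n →
    (IsUniform fun (k : Type u) [Field k] [Finite k] => stdSum (semiInd (k := k) θ) γ) ∧
    ∀ ν, IsUniform fun (k : Type u) [Field k] [Finite k] =>
      stdSum (subSlopeInd (k := k) θ ν) γ := by
  induction n using Nat.strong_induction_on with
  | h n ih =>
  intro γ hn
  by_cases hγ : γ = 0
  · subst hγ
    exact ⟨IsUniform.one.congr fun k _ _ =>
        stdSum_zero_of_eq_one fun c hc => semiSum_of_dim_eq_zero hc,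
      fun ν => IsUniform.one.congr fun k _ _ => stdSum_subSlopeInd_zero ν⟩
  have hd : ∀ p ∈ Finset.HasAntidiagonal.antidiagonal γ, p.1 ≤ γ ∧
      p.1.degree + p.2.degree = γ.degree := fun p hp => by
    rw [Finset.HasAntidiagonal.mem_antidiagonal] at hp
    rw [← map_add, hp]
    exact ⟨hp ▸ le_self_add, rfl⟩
  have hterm : ∀ (P : ℚ → Prop), ∀ p ∈ Finset.HasAntidiagonal.antidiagonal γ,
      (IsUniform fun (k : Type u) [Field k] [Finite k] => stdSum (semiInd (k := k) θ) p.1) →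
      IsUniform fun (k : Type u) [Field k] [Finite k] => (subspaceCount k p.1 γ : ℚ) *
        ((Nat.card k : ℚ) ^ arrowPairing p.1 p.2 *
          ((if p.1 ≠ 0 ∧ P (dimSlope θ p.1) then
            stdSum (subSlopeInd (k := k) θ (dimSlope θ p.1)) p.2 else 0) *
            stdSum (semiInd (k := k) θ) p.1)) := by
    intro P p hp hE
    obtain ⟨h1, h2⟩ := hd p hp
    refine (isUniform_subspaceCount h1).mul ((IsUniform.card_pow _).mul
      ((IsUniform.ite _ (fun h => ?_) fun _ => IsUniform.zero).mul hE))
    have h3 := (Finsupp.degree_eq_zero_iff p.1).not.2 h.1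
    exact (ih p.2.degree (by omega) p.2 rfl).2 _
  have hE : IsUniform fun (k : Type u) [Field k] [Finite k] => stdSum (semiInd (k := k) θ) γ := by
    refine ((IsUniform.card_pow (arrowPairing γ γ)).sub (IsUniform.sum
      ((Finset.HasAntidiagonal.antidiagonal γ).erase (γ, 0)) fun p hp =>
        hterm (fun _ => True) p (Finset.mem_of_mem_erase hp)
          (ih p.1.degree (hn ▸ degree_fst_lt hp) p.1 rfl).1)).congr fun k _ _ => ?_
    have h := stdSum_harderNarasimhan (k := k) (θ := θ) hγ (fun _ => True) (fun _ => 1)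
      fun X U _ => (if_pos trivial).symm
    rw [sum_antidiagonal_erase, stdSum_one] at h
    simp only [arrowPairing_zero, subspaceCount_self, stdSum_subSlopeInd_zero,
      if_pos (And.intro hγ trivial), Nat.cast_one, pow_zero, one_mul] at h
    rw [h, add_sub_cancel_right]
  refine ⟨hE, fun ν => (IsUniform.sum (Finset.HasAntidiagonal.antidiagonal γ) fun p hp =>
    hterm (· < ν) p hp ?_).congr fun k _ _ => ?_⟩
  -- The term (γ, 0) involves the semistables of dimension γ itself, which have just been dealt
  -- with.
  · by_cases hp' : p = (γ, 0)
    · rw [hp']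
      exact hE
    · exact (ih p.1.degree (hn ▸ degree_fst_lt (Finset.mem_erase.2 ⟨hp', hp⟩)) p.1 rfl).1
  · refine stdSum_harderNarasimhan hγ (· < ν) (subSlopeInd θ ν) fun X U hU => ?_
    rw [subSlopeInd_mk]
    by_cases h : dimSlope θ U.toRep.dim < ν
    · rw [if_pos h, if_pos (hU.subSlopeLT_iff.2 h)]
    · rw [if_neg h, if_neg (mt hU.subSlopeLT_iff.1 h)]

theorem isUniform_semiSum (θ : I → ℤ) (μ : ℚ) (α : I →₀ ℕ) :
    IsUniform fun (k : Type u) [Field k] [Finite k] =>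
      stdSum (CompletedHall.semiSum k (slopeForm θ μ)) α := by
  exact (IsUniform.ite _ (fun _ => IsUniform.one) fun _ => IsUniform.ite _
    (fun _ => (isUniform_semi_subSlope θ _ α rfl).1) fun _ => IsUniform.zero).congr
      fun k _ _ => stdSum_semiSum α

theorem isUniform_semiInv (θ : I → ℤ) (μ : ℚ) (n : ℕ) : ∀ γ : I →₀ ℕ, γ.degree = n →
    IsUniform fun (k : Type u) [Field k] [Finite k] =>
      stdSum (CompletedHall.semiInv k (slopeForm θ μ) : CompletedHall k I) γ := by
  classical
  induction n using Nat.strong_induction_on with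
  | h n ih =>
  intro γ hn
  by_cases hγ : γ = 0
  · subst hγ
    refine IsUniform.one.congr fun k _ _ => stdSum_zero_of_eq_one fun c hc => ?_
    rw [← c.mk_rep]
    exact CompletedHall.semiInv_of_isZero (IsoClass.isZero_rep hc)
  refine (IsUniform.zero.sub (IsUniform.sum
    ((Finset.HasAntidiagonal.antidiagonal γ).erase (γ, 0)) fun p hp =>
      (isUniform_subspaceCount (δ := p.1) (γ := γ) ?_).mul
        ((IsUniform.card_pow (arrowPairing p.1 p.2)).mul ((isUniform_semiSum θ μ p.2).mul
          (ih p.1.degree (hn ▸ degree_fst_lt hp) p.1 rfl))))).congr fun k _ _ => ?_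
  · rw [← Finset.HasAntidiagonal.mem_antidiagonal.1 (Finset.mem_of_mem_erase hp)]
    exact le_self_add
  · have h := stdSum_semiInv (k := k) (φ := slopeForm θ μ) hγ
    rw [sum_antidiagonal_erase, arrowPairing_zero, subspaceCount_self, Nat.cast_one, pow_zero,
      one_mul, one_mul, stdSum_semiSum, if_pos rfl, one_mul] at h
    linear_combination -h

/-- The integral is the sum over the space of representations divided by the order of a product of
general linear groups, and this order is an admissible denominator. -/
theorem isUniform_coeff_semiInv (θ : I → ℤ) (μ : ℚ) (α : I →₀ ℕ) :
    IsUniform fun (k : Type u) [Field k] [Finite k] => MvPowerSeries.coeff α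
      (hallIntegral (CompletedHall.semiInv k (slopeForm θ μ) : CompletedHall k I)) := by
  refine IsUniform.div_poly (D := ∏ i, IsUniform.framePoly (α i) (α i))
    (prod_mem fun i _ => IsUniform.framePoly_mem (α i))
    (isUniform_semiInv θ μ _ α rfl) fun k _ _ => ?_
  rw [coeff_hallIntegral_eq_stdSum, Polynomial.eval_prod]
  have h : ∀ i, (IsUniform.framePoly (α i) (α i)).eval (Nat.card k : ℤ) =
      (frameCount (Nat.card k) (α i) (α i) : ℤ) := fun i =>
    IsUniform.eval_framePoly le_rfl Finite.one_lt_card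
  rw [Finset.prod_congr rfl fun i _ => h i, ← Nat.cast_prod, Int.cast_natCast]
  refine div_mul_cancel₀ _ (Nat.cast_ne_zero.2 (Finset.prod_ne_zero_iff.2 fun i _ =>
    frameCount_ne_zero Finite.one_lt_card _))

end QuiverRep

end

/-! ### Brick counts as polynomials, and comparison with the plethystic exponential. -/

noncomputable section


theorem CountRing.eq_zero (x : CountRing)
    (h : ∀ N : ℕ, ∃ s, ∃ hs : 2 ≤ s, N ≤ s ∧ ev s hs x = 0) : x = 0 := by
  obtain ⟨P, rfl⟩ := x.exists_eq_ofPoly fun N => by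
    obtain ⟨s, hs, hN, h0⟩ := h N
    exact ⟨s, hs, hN, 0, h0.trans Int.cast_zero.symm⟩
  rw [Polynomial.eq_zero_of_infinite_isRoot P, map_zero]
  refine Set.infinite_of_not_bddAbove fun ⟨B, hB⟩ => ?_
  obtain ⟨s, hs, hN, h0⟩ := h (B.toNat + 1)
  rw [ev_ofPoly, Int.cast_eq_zero] at h0
  have := hB h0
  omega

theorem exists_extension (k : Type u) [Field k] [Finite k] (n : ℕ) :
    ∃ (K : Type u) (_ : Field K) (_ : Algebra k K),
      FiniteDimensional k K ∧ (n ≠ 0 → Module.finrank k K = n) := by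
  by_cases hn : n = 0
  · exact ⟨k, inferInstance, inferInstance, inferInstance, fun h => absurd hn h⟩
  have : NeZero n := ⟨hn⟩
  have : Fact (ringChar k).Prime := ⟨CharP.char_is_prime k _⟩
  let e : ULift.{u} (FiniteField.Extension k (ringChar k) n) ≃ₗ[k]
    FiniteField.Extension k (ringChar k) n := ULift.moduleEquiv
  refine ⟨ULift.{u} (FiniteField.Extension k (ringChar k) n), inferInstance, inferInstance,
    Module.Finite.equiv e.symm, fun _ => ?_⟩
  rw [e.finrank_eq, FiniteField.finrank_extension]

/-- Finite fields of arbitrarily large order. -/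
theorem exists_finite_field_le_card (N : ℕ) :
    ∃ (F : Type u) (_ : Field F) (_ : Finite F), N ≤ Nat.card F := by
  obtain ⟨p, hp, hp'⟩ := Nat.exists_infinite_primes N
  have : Fact p.Prime := ⟨hp'⟩
  exact ⟨ULift.{u} (ZMod p), inferInstance, inferInstance, by rwa [Nat.card_ulift, Nat.card_zmod]⟩

namespace QuiverRep

variable {I : Type w} [Quiver.{v} I] [Fintype I] [∀ i j : I, Finite (i ⟶ j)]

open CompletedHall in
/-- The plethystic logarithm of the series `∫ e_μ⁻¹`. -/
theorem exists_plethysticLog_semiInv (θ : I → ℤ) (μ : ℚ) :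
    ∃ G b : (I →₀ ℕ) → CountRing,
      (∀ (k : Type u) [Field k] [Finite k] (α : I →₀ ℕ), MvPowerSeries.coeff α
        (hallIntegral (semiInv k (slopeForm θ μ) : CompletedHall k I)) =
          CountRing.ev (Nat.card k) Finite.one_lt_card (G α)) ∧
      ∀ (F : Type) [Field F] [CharZero F] (ε : CountRing →+* F) (L' G' : MvPowerSeries I F),
        (∀ γ ≠ 0, MvPowerSeries.coeff γ L' =
          ∑ p ∈ divisorPairs γ, (p.1 : F)⁻¹ * ε (CountRing.psi p.1 (b p.2))) →
        (∀ α, MvPowerSeries.coeff α G' = ε (G α)) → MvPowerSeries.IsLog L' G' := by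
  classical
  choose H hH using isUniform_coeff_semiInv.{u} θ μ
  -- The chosen H 0 is specified only through its values at orders of finite fields, while the
  -- logarithm needs constant term 1 in the ring; so it is simply replaced.
  obtain ⟨b, hb⟩ := CountRing.exists_plethysticLog (fun α => if α = 0 then 1 else H α) (if_pos rfl)
  refine ⟨_, b, fun k _ _ α => ?_, hb⟩
  by_cases hα : α = 0
  · rw [if_pos hα, hα, map_one, coeff_zero_hallIntegral_semiInv]
  · rw [if_neg hα]
    exact hH α k

theorem brickCount_eq_of_finrank_eq_one {k : Type u} [Field k] [Finite k] {K : Type u} [Field K]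
    [Algebra k K] [FiniteDimensional k K] (h : Module.finrank k K = 1) (φ : (I →₀ ℕ) →+ ℚ)
    (α : I →₀ ℕ) : brickCount K φ α = brickCount k φ α := by
  classical
  rw [brickCount_eq (k := k) (K := K) (N := α.degree) (by rw [h, one_mul]),
    brickCount_eq (k := k) (K := k) (N := α.degree) (by rw [Module.finrank_self, one_mul]), h,
    Module.finrank_self]

open CompletedHall in
/-- The numbers of stable bricks are given by the plethystic logarithm. -/
theorem brickCount_eq_ev {φ : (I →₀ ℕ) →+ ℚ} {b : (I →₀ ℕ) → CountRing}
    (hb : ∀ (k : Type u) [Field k] [Finite k], ∀ β ≠ 0, MvPowerSeries.coeff β (stableLog k φ) =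
      ∑ p ∈ divisorPairs β, (p.1 : ℚ)⁻¹ * CountRing.ev (Nat.card k) Finite.one_lt_card
        (CountRing.psi p.1 (b p.2))) (n : ℕ) :
    ∀ β : I →₀ ℕ, β ≠ 0 → β.degree = n → ∀ (k : Type u) [Field k] [Finite k],
      (brickCount k φ β : ℚ) =
        (1 - (Nat.card k : ℚ)) * CountRing.ev (Nat.card k) Finite.one_lt_card (b β) := by
  classical
  induction n using Nat.strong_induction_on with
  | h n ih =>
  intro β hβ hn k _ _
  choose K hKF hKA hKfd hK using exists_extension k
  have h1 := coeff_stableLog (φ := φ) hβ K hK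
  have hK' : ∀ m ≠ 0, Nat.card (K m) = Nat.card k ^ m := fun m hm => by
    rw [Module.natCard_eq_pow_finrank (K := k) (V := K m), hK m hm]
  have hne : ∀ m ≠ 0, (1 : ℚ) - (Nat.card k : ℚ) ^ m ≠ 0 := fun m hm => by
    have h2 := one_lt_pow₀ (a := (Nat.card k : ℚ)) (by exact_mod_cast Finite.one_lt_card) hm
    linarith
  have hmem : (1, β) ∈ divisorPairs β := (mem_divisorPairs hβ).2 (one_smul _ _)
  rw [hb k β hβ, ← Finset.add_sum_erase _ _ hmem, ← Finset.add_sum_erase _ _ hmem] at h1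
  -- Two expressions for the logarithm at β are compared. All pairs (n, α) with n > 1 agree by
  -- induction, applied to the extension of k of degree n, where ψₙ becomes evaluation at qⁿ. What
  -- is left is the pair (1, β).
  have h2 : ∀ p ∈ (divisorPairs β).erase (1, β), (p.1 : ℚ)⁻¹ *
      CountRing.ev (Nat.card k) Finite.one_lt_card (CountRing.psi p.1 (b p.2)) =
      (p.1 : ℚ)⁻¹ * ((brickCount (K p.1) φ p.2 : ℚ) * (1 - (Nat.card k : ℚ) ^ p.1)⁻¹) := by
    intro p hp
    rw [Finset.mem_erase] at hp
    have hp1 := fst_ne_zero_of_mem_divisorPairs hβ hp.2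
    have hp2 := snd_ne_zero_of_mem_divisorPairs hβ hp.2
    have hdeg := mul_degree_of_mem_divisorPairs hβ hp.2
    have hp1' : p.1 ≠ 1 := fun h => hp.1 (Prod.ext h (by
      have := (mem_divisorPairs hβ).1 hp.2
      rwa [h, one_smul] at this))
    have hlt : p.2.degree < n := by
      rw [← hn, ← hdeg]
      exact lt_mul_left (Nat.pos_of_ne_zero fun h => hp2 ((Finsupp.degree_eq_zero_iff _).1 h))
        (by omega)
    have hfin : Finite (K p.1) := Module.finite_of_finite k
    have h3 := ih _ hlt p.2 hp2 rfl (K p.1)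
    have hs : 2 ≤ Nat.card k ^ p.1 := by
      rw [← hK' _ hp1]
      exact Finite.one_lt_card
    have h4 : CountRing.ev (Nat.card (K p.1)) Finite.one_lt_card (b p.2) =
        CountRing.ev (Nat.card k ^ p.1) hs (b p.2) := by
      congr 2
      exact hK' _ hp1
    rw [h3, h4, CountRing.ev_psi Finite.one_lt_card hp1 hs, hK' _ hp1, Nat.cast_pow,
      mul_comm (1 - _), mul_assoc, mul_inv_cancel₀ (hne _ hp1), mul_one]
  rw [Finset.sum_congr rfl h2, add_left_inj, CountRing.psi_one, Nat.cast_one, inv_one, one_mul,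
    one_mul, pow_one, brickCount_eq_of_finrank_eq_one (hK 1 one_ne_zero)] at h1
  have h5 := hne 1 one_ne_zero
  rw [pow_one] at h5
  rw [h1]
  field_simp

theorem brickCount_eq_zero {k : Type u} [Field k] {φ : (I →₀ ℕ) →+ ℚ} {β : I →₀ ℕ}
    (h : φ β ≠ 0) : brickCount k φ β = 0 := by
  have : IsEmpty {c : IsoClass k I // StableFor φ c.rep ∧ IsBrick c.rep ∧ c.dim = β} :=
    ⟨fun c => h (by rw [← c.2.2.2, ← IsoClass.dim_rep]; exact c.2.1.2.1)⟩
  exact Nat.card_of_isEmpty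

theorem absStableCount_zero {k : Type u} [Field k] (θ : I → ℤ) :
    absStableCount k θ (0 : I →₀ ℕ) = 0 := by
  refine (congrArg Set.ncard ?_).trans (Set.ncard_empty _)
  refine Set.eq_empty_iff_forall_notMem.2 fun c ⟨M, _, hM, h⟩ => h.1.1 ((isZero_iff_dim M).2 hM)

end QuiverRep

theorem coeff_adams {σ : Type w} {f : MvPowerSeries σ (RatFunc ℚ)} {b : (σ →₀ ℕ) → CountRing}
    (hf : ∀ γ ≠ 0, MvPowerSeries.coeff γ f = CountRing.toRat (b γ)) {n : ℕ} (hn : n ≠ 0)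
    {γ : σ →₀ ℕ} (hγ : γ ≠ 0) : MvPowerSeries.coeff γ (adams n hn f) =
      ∑ p ∈ divisorPairs γ, if p.1 = n then CountRing.toRat (CountRing.psi p.1 (b p.2)) else 0 := by
  classical
  by_cases h : ∃ δ, n • δ = γ
  · obtain ⟨δ, rfl⟩ := h
    have hδ : δ ≠ 0 := fun h => hγ (by rw [h, smul_zero])
    rw [adams, MvPowerSeries.coeff_expand_smul, MvPowerSeries.coeff_map, hf δ hδ,
      ← CountRing.toRat_psi, Finset.sum_eq_single (n, δ)]
    · rw [if_pos rfl]
    · intro p hp hne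
      refine if_neg fun hpn => hne (Prod.ext hpn ?_)
      have := (mem_divisorPairs hγ).1 hp
      rw [hpn] at this
      ext i
      exact Nat.eq_of_mul_eq_mul_left (Nat.pos_of_ne_zero hn) (DFunLike.congr_fun this i)
    · exact fun hn => absurd ((mem_divisorPairs hγ).2 rfl) hn
  · rw [Finset.sum_eq_zero]
    · obtain ⟨i, hi⟩ : ∃ i, ¬ n ∣ γ i := by
        by_contra! hd
        refine h ⟨γ.mapRange (· / n) (Nat.zero_div n), ?_⟩
        ext i
        exact Nat.mul_div_cancel' (hd i)
      exact MvPowerSeries.coeff_expand_of_not_dvd n hn _ hi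
    · intro p hp
      refine if_neg fun hpn => h ⟨p.2, ?_⟩
      rw [← hpn]
      exact (mem_divisorPairs hγ).1 hp

theorem constantCoeff_adamsSum {σ : Type w} (f : MvPowerSeries σ (RatFunc ℚ)) :
    MvPowerSeries.constantCoeff (adamsSum f) = 0 := by
  change ∑ n ∈ Finset.range (Finsupp.degree (0 : σ →₀ ℕ)), (1 / ((n : RatFunc ℚ) + 1)) *
    MvPowerSeries.coeff 0 (adams (n + 1) n.succ_ne_zero f) = _
  rw [map_zero, Finset.sum_range_zero]

theorem coeff_adamsSum {σ : Type w} {f : MvPowerSeries σ (RatFunc ℚ)} {b : (σ →₀ ℕ) → CountRing}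
    (hf : ∀ γ ≠ 0, MvPowerSeries.coeff γ f = CountRing.toRat (b γ)) {γ : σ →₀ ℕ} (hγ : γ ≠ 0) :
    MvPowerSeries.coeff γ (adamsSum f) = ∑ p ∈ divisorPairs γ,
      (p.1 : RatFunc ℚ)⁻¹ * CountRing.toRat (CountRing.psi p.1 (b p.2)) := by
  change ∑ n ∈ Finset.range γ.degree, (1 / ((n : RatFunc ℚ) + 1)) *
    MvPowerSeries.coeff γ (adams (n + 1) n.succ_ne_zero f) = _
  simp only [coeff_adams hf (Nat.succ_ne_zero _) hγ, Finset.mul_sum]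
  rw [Finset.sum_comm]
  refine Finset.sum_congr rfl fun p hp => ?_
  have hp1 := fst_ne_zero_of_mem_divisorPairs hγ hp
  have hp2 : p.2.degree ≠ 0 := fun h =>
    snd_ne_zero_of_mem_divisorPairs hγ hp ((Finsupp.degree_eq_zero_iff _).1 h)
  have hle : p.1 ≤ γ.degree := by
    rw [← mul_degree_of_mem_divisorPairs hγ hp]
    exact Nat.le_mul_of_pos_right _ (Nat.pos_of_ne_zero hp2)
  -- The index of `adamsSum` starts at 0 and stands for the operation one higher.
  obtain ⟨m, hm⟩ := Nat.exists_eq_succ_of_ne_zero hp1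
  rw [Finset.sum_eq_single m]
  · rw [if_pos hm, hm, Nat.cast_succ, one_div]
  · intro j _ hj
    rw [if_neg (by omega), mul_zero]
  · intro hn
    rw [Finset.mem_range] at hn
    omega

end

/-- The polynomials `a_α` counting absolutely stable representations exist, and for each finite
field `k` the element `e_μ` is invertible with `∫ e_μ⁻¹ = Exp (a(q) / (1 - q))` at `q = #k`. -/
theorem theorem4p2 {I : Type w} [Fintype I] [Quiver.{v} I] [∀ i j : I, Finite (i ⟶ j)]
    (θ : I → ℤ) :
    ∃ a : (I →₀ ℕ) → Polynomial ℤ,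
      (∀ (α : I →₀ ℕ) (F : Type u) [Field F] [Finite F],
        (a α).eval (Nat.card F : ℤ) = (absStableCount F θ α : ℤ)) ∧
      ∀ (μ : ℚ) (k : Type u) [Field k] [Finite k],
        IsUnit (semistableSum k θ μ) ∧
        RegularAt (Nat.card k : ℚ)
          (plethysticExp (MvPowerSeries.C (1 / (1 - RatFunc.X)) * genFun θ μ a)) ∧
        hallIntegral (Ring.inverse (semistableSum k θ μ)) =
          specialize (Nat.card k : ℚ)
            (plethysticExp (MvPowerSeries.C (1 / (1 - RatFunc.X)) * genFun θ μ a)) := by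
  classical
  choose G b hG hlog using fun μ => QuiverRep.exists_plethysticLog_semiInv.{u} θ μ
  have hcount : ∀ μ, ∀ β : I →₀ ℕ, β ≠ 0 → ∀ (k : Type u) [Field k] [Finite k],
      (QuiverRep.brickCount k (QuiverRep.slopeForm θ μ) β : ℚ) =
        CountRing.ev (Nat.card k) Finite.one_lt_card
        (CountRing.ofPoly (1 - Polynomial.X) * b μ β) := by
    intro μ β hβ k _ _
    rw [QuiverRep.brickCount_eq_ev (b := b μ) (fun k _ _ β hβ => ?_) _ β hβ rfl k, map_mul,
      CountRing.ev_ofPoly]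
    · simp
    · let L' : MvPowerSeries I ℚ := fun γ => ∑ p ∈ divisorPairs γ, (p.1 : ℚ)⁻¹ *
        CountRing.ev (Nat.card k) Finite.one_lt_card (CountRing.psi p.1 (b μ p.2))
      -- The logarithm from the stable classes and the uniform one belong to the same series, so
      -- they have the same coefficients away from 0.
      exact (CompletedHall.isLog_stableLog (k := k) (φ := QuiverRep.slopeForm θ μ)).eq_of
        (hlog μ ℚ (CountRing.ev (Nat.card k) Finite.one_lt_card) L' _ (fun γ _ => rfl) (hG μ k)) hβ
  have hpoly : ∀ α : I →₀ ℕ, ∃ P : Polynomial ℤ, (α = 0 → P = 0) ∧ (α ≠ 0 →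
      CountRing.ofPoly (1 - Polynomial.X) * b (dimSlope θ α) α = CountRing.ofPoly P) := by
    intro α
    by_cases hα : α = 0
    · exact ⟨0, fun _ => rfl, absurd hα⟩
    -- Each α is treated at its own slope. The values at orders of finite fields are numbers of
    -- bricks, hence integers, and such orders are arbitrarily large.
    · obtain ⟨P, hP⟩ := CountRing.exists_eq_ofPoly
        (CountRing.ofPoly (1 - Polynomial.X) * b (dimSlope θ α) α) fun N => by
          obtain ⟨F, _, _, hF⟩ := exists_finite_field_le_card.{u} N
          refine ⟨Nat.card F, Finite.one_lt_card, hF,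
            (QuiverRep.brickCount F (QuiverRep.slopeForm θ (dimSlope θ α)) α : ℕ), ?_⟩
          rw [← hcount _ α hα F, Int.cast_natCast]
      exact ⟨P, fun h => absurd h hα, fun _ => hP⟩
  choose a ha0 ha using hpoly
  -- There are no stable objects for φ in dimensions where φ ≠ 0, so (1 - q)·b has infinitely many
  -- zeros. This matches the restriction to slope μ in the generating function.
  have hzero : ∀ μ, ∀ β : I →₀ ℕ, β ≠ 0 → dimSlope θ β ≠ μ → b μ β = 0 := by
    intro μ β hβ hμ
    have h1 : CountRing.ofPoly (1 - Polynomial.X) * b μ β = 0 := by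
      refine CountRing.eq_zero _ fun N => ?_
      obtain ⟨F, _, _, hF⟩ := exists_finite_field_le_card.{u} N
      refine ⟨Nat.card F, Finite.one_lt_card, hF, ?_⟩
      rw [← hcount μ β hβ F, QuiverRep.brickCount_eq_zero (mt (QuiverRep.slopeForm_eq_zero hβ).1 hμ),
        Nat.cast_zero]
    refine (mul_eq_zero.1 h1).resolve_left fun h2 => ?_
    have h3 := CountRing.algebraMap_injective (h2.trans (map_zero _).symm)
    exact absurd (congrArg (Polynomial.eval 0) h3) (by simp)
  refine ⟨a, fun α F _ _ => ?_, fun μ k _ _ => ?_⟩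
  · by_cases hα : α = 0
    · rw [ha0 α hα, hα, QuiverRep.absStableCount_zero, Polynomial.eval_zero, Nat.cast_zero]
    · have h1 := hcount (dimSlope θ α) α hα F
      rw [ha α hα, CountRing.ev_ofPoly, ← QuiverRep.absStableCount_eq_brickCount rfl] at h1
      exact_mod_cast h1.symm
  · set f := MvPowerSeries.C (1 / (1 - RatFunc.X)) *
      genFun θ μ a with hf
    have hX : (1 : RatFunc ℚ) - RatFunc.X ≠ 0 := by
      rw [← RatFunc.algebraMap_X, ← map_one (algebraMap (Polynomial ℚ) (RatFunc ℚ)), ← map_sub]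
      refine (map_ne_zero_iff _ (RatFunc.algebraMap_injective ℚ)).2 fun h => ?_
      exact absurd (congrArg (Polynomial.eval 0) h) (by simp)
    have hfb : ∀ γ ≠ 0, MvPowerSeries.coeff γ f = CountRing.toRat (b μ γ) := by
      intro γ hγ
      rw [hf, MvPowerSeries.coeff_C_mul]
      change _ * (if γ ≠ 0 ∧ dimSlope θ γ = μ then _ else _) = _
      by_cases hμ : dimSlope θ γ = μ
      · rw [if_pos ⟨hγ, hμ⟩, ← CountRing.toRat_ofPoly, ← ha γ hγ, hμ,
          map_mul, CountRing.toRat_ofPoly, ← mul_assoc]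
        simp [hX]
      · rw [if_neg fun h => hμ h.2, hzero μ γ hγ hμ, map_zero, mul_zero]
    let G' : MvPowerSeries I (RatFunc ℚ) := fun α => CountRing.toRat (G μ α)
    -- Both series have the logarithm `adamsSum f`: one by definition of Exp, the other because b is
    -- the plethystic logarithm of G. Regularity and specialization are then properties of elements
    -- of `CountRing`.
    have hcoeff : ∀ α, MvPowerSeries.coeff α (plethysticExp f) = CountRing.toRat (G μ α) :=
      fun α => (MvPowerSeries.isLog_exp (constantCoeff_adamsSum f)).coeff_eq
        (hlog μ (RatFunc ℚ) CountRing.toRat (adamsSum f) G'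
          (fun γ hγ => coeff_adamsSum hfb hγ) fun _ => rfl) fun _ _ _ => rfl
    rw [QuiverRep.semistableSum_eq]
    refine ⟨CompletedHall.isUnit_semiSum, fun α => ?_, ?_⟩
    · rw [hcoeff]
      exact (CountRing.toRat_regular Finite.one_lt_card _).1
    · ext α
      refine (hG μ k α).trans ?_
      change _ = (MvPowerSeries.coeff α (plethysticExp f)).eval (RingHom.id ℚ) (Nat.card k : ℚ)
      rw [hcoeff]
      exact (CountRing.toRat_regular Finite.one_lt_card _).2.symm
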